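/- Let $p\in(0,1]$ and let $\mu$ be a probability distribution on $\mathbb R$ with mean $0$ and variance $1$, symmetric around $0$, with no atoms and with all moments $\mu_j=\int x^j\,d\mu$ finite. For $d\ge 1$ and positive integers $n_0,\dots,n_d$, let $M=X^{(d)}\cdots X^{(1)}$ with $$X^{(i)}=(p\,n_{i-1})^{-1/2}D^{(i)}W^{(i)},$$ where $D^{(i)}$ is the $n_i\times n_i$ diagonal matrix whose diagonal entries are $\{0,1\}$-valued Bernoulli($p$) variables, $W^{(i)}$ is an $n_i\times n_{i-1}$ matrix with entries distributed according to $\mu$, and all these variables (over all entries and all $i=1,\dots,d$) are independent. Let $u\in\mathbb R^{n_0}$ with $\|u\|_2=1$, and put $$\beta=\Big(\frac3p-1\Big)\sum_{i=1}^d\frac1{n_i}+\frac{\mu_4-3}{p\,n_1}\|u\|_4^4,\qquad Z=\frac{n_0}{n_d}\|Mu\|_2^2,\qquad S=\sum_{i=1}^d\frac1{n_i^2}.$$ (1) For all compact sets $K\subset(0,1]$ and $B\subset(0,\infty)$ there is a constant $C$, depending only on $K$, $B$ and the moments of $\mu$, such that whenever $p\in K$ and $\beta\in B$, $$d_{\mathrm{KS}}\big(\ln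 Z,\ \mathcal N(-\tfrac12\beta,\beta)\big)\le C\,S^{1/5},$$ where $d_{\mathrm{KS}}$ is the Kolmogorov–Smirnov distance (the supremum over $t\in\mathbb R$ of the difference of the distribution functions) and $\ln 0=-\infty$. (2) For every integer $k\ge 0$ there is a constant $C$, depending only on $k$, $p$ and the moments of $\mu$, such that whenever $\binom k2<\min_{1\le i\le d}n_i$, the moment $\mathbf E[Z^k]$ is finite and $$\mathbf E[Z^k]=\exp\Big[\binom k2\beta+\varepsilon\Big]\quad\text{for some real }\varepsilon\text{ with } |\varepsilon|\le C\,S .$$ (3) For every integer $k\ge0$ and every $b$ there is a constant $C$, depending only on $k$, $p$, $b$ and the moments of $\mu$, such that whenever $\binom k2<\min_{1\le i\le d}n_i$ and $\beta\le b$, $$\Big|\mathbf E[Z^k]-\mathbf E\big[(\exp G)^k\big]\Big|\le C\,\beta^{-1}S,\qquad G\sim\mathcal N(-\tfrac12\beta,\beta).$$ -/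

import Mathlib

open MeasureTheory ProbabilityTheory

universe v

noncomputable section

namespace RandomMatrixProduct

/-- The admissible distributions `μ` of the matrix entries: mean zero, variance one, symmetric
around `0`, all moments finite, no atoms. -/
structure IsEntryLaw (μ : Measure ℝ) : Prop where
  isProbabilityMeasure : IsProbabilityMeasure μ
  mean_eq_zero : ∫ x, x ∂μ = 0
  variance_eq_one : ∫ x, x ^ 2 ∂μ = 1
  symmetric : μ.map (fun x => -x) = μ
  integrable_pow : ∀ k : ℕ, Integrable (fun x : ℝ => x ^ k) μ
  no_atoms : ∀ x : ℝ, μ {x} = 0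

/-- Index set of all scalar random variables occurring in `d` layers. For the layer `i : Fin d`,
which maps `ℝ ^ n i` to `ℝ ^ n (i + 1)`, there is one index for each matrix entry `(a, b)` and one
for each diagonal Bernoulli variable `a`. -/
abbrev EntryIndex (n : ℕ → ℕ) (d : ℕ) : Type :=
  (i : Fin d) × ((Fin (n (i + 1)) × Fin (n i)) ⊕ Fin (n (i + 1)))

/-- The family of all entries of `W` and all the Bernoulli variables `ξ` of the first `d` layers,
as real random variables. -/
def entries {Ω : Type*} (n : ℕ → ℕ) (d : ℕ)
    (W : (i : ℕ) → Ω → Matrix (Fin (n (i + 1))) (Fin (n i)) ℝ)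
    (ξ : (i : ℕ) → Ω → Fin (n (i + 1)) → ℝ) : EntryIndex n d → Ω → ℝ
  | ⟨i, Sum.inl ab⟩, ω => W i ω ab.1 ab.2
  | ⟨i, Sum.inr a⟩, ω => ξ i ω a

/-- The probabilistic model: in the first `d` layers all matrix entries have law `μ`, all diagonal
variables are Bernoulli(`p`) with values in `{0, 1}`, and all these variables are jointly
independent. Layers are counted from `0`. -/
structure IsModel {Ω : Type*} [MeasurableSpace Ω] (P : Measure Ω) (μ : Measure ℝ)
    (p : unitInterval) (n : ℕ → ℕ) (d : ℕ)
    (W : (i : ℕ) → Ω → Matrix (Fin (n (i + 1))) (Fin (n i)) ℝ)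
    (ξ : (i : ℕ) → Ω → Fin (n (i + 1)) → ℝ) : Prop where
  hasLaw_entry : ∀ i < d, ∀ (a : Fin (n (i + 1))) (b : Fin (n i)),
    HasLaw (fun ω => W i ω a b) μ P
  hasLaw_bernoulli : ∀ i < d, ∀ a : Fin (n (i + 1)),
    HasLaw (fun ω => ξ i ω a) (bernoulliMeasure (1 : ℝ) 0 p) P
  independent : iIndepFun (entries n d W ξ) P

/-- The factor `(p * n i) ^ (-1/2) * Diag (ξ i) * W i` of the matrix product. -/
def layer {Ω : Type*} (p : unitInterval) (n : ℕ → ℕ)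
    (W : (i : ℕ) → Ω → Matrix (Fin (n (i + 1))) (Fin (n i)) ℝ)
    (ξ : (i : ℕ) → Ω → Fin (n (i + 1)) → ℝ) (i : ℕ) (ω : Ω) :
    Matrix (Fin (n (i + 1))) (Fin (n i)) ℝ :=
  (Real.sqrt ((p : ℝ) * n i))⁻¹ • (Matrix.diagonal (ξ i ω) * W i ω)

/-- The product of the first `d` layers, the last layer standing on the left. -/
def matrixProduct {Ω : Type*} (p : unitInterval) (n : ℕ → ℕ)
    (W : (i : ℕ) → Ω → Matrix (Fin (n (i + 1))) (Fin (n i)) ℝ)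
    (ξ : (i : ℕ) → Ω → Fin (n (i + 1)) → ℝ) :
    (d : ℕ) → Ω → Matrix (Fin (n d)) (Fin (n 0)) ℝ
  | 0, _ => 1
  | d + 1, ω => layer p n W ξ d ω * matrixProduct p n W ξ d ω

/-- The random variable `(n 0 / n d) * ‖M u‖ ^ 2` (Euclidean norm). -/
def normSq {Ω : Type*} (p : unitInterval) (n : ℕ → ℕ) (d : ℕ)
    (W : (i : ℕ) → Ω → Matrix (Fin (n (i + 1))) (Fin (n i)) ℝ)
    (ξ : (i : ℕ) → Ω → Fin (n (i + 1)) → ℝ)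
    (u : EuclideanSpace ℝ (Fin (n 0))) (ω : Ω) : ℝ :=
  ((n 0 : ℝ) / n d) *
    ‖(WithLp.toLp 2 ((matrixProduct p n W ξ d ω).mulVec u.ofLp) :
        EuclideanSpace ℝ (Fin (n d)))‖ ^ 2

/-- `ln ((n 0 / n d) * ‖M u‖ ^ 2)`, with the value `ln 0 = -∞`. -/
def logNormSq {Ω : Type*} (p : unitInterval) (n : ℕ → ℕ) (d : ℕ)
    (W : (i : ℕ) → Ω → Matrix (Fin (n (i + 1))) (Fin (n i)) ℝ)
    (ξ : (i : ℕ) → Ω → Fin (n (i + 1)) → ℝ)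
    (u : EuclideanSpace ℝ (Fin (n 0))) (ω : Ω) : EReal :=
  ENNReal.log (ENNReal.ofReal (normSq p n d W ξ u ω))

/-- `β = (3/p - 1) ∑ 1 / n i + (μ₄ - 3) / (p n 1) * ‖u‖₄⁴`, the sum being over `i = 1, …, d`. -/
def beta (μ : Measure ℝ) (p : unitInterval) (n : ℕ → ℕ) (d : ℕ)
    (u : EuclideanSpace ℝ (Fin (n 0))) : ℝ :=
  (3 / (p : ℝ) - 1) * ∑ i ∈ Finset.Icc 1 d, 1 / (n i : ℝ) +
    ((∫ x, x ^ 4 ∂μ) - 3) / ((p : ℝ) * n 1) * ∑ j, |u j| ^ 4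

/-- `∑ 1 / (n i) ^ 2` over `i = 1, …, d`. -/
def sumInvSq (n : ℕ → ℕ) (d : ℕ) : ℝ :=
  ∑ i ∈ Finset.Icc 1 d, 1 / (n i : ℝ) ^ 2

/-- The Gaussian measure with mean `-β/2` and variance `β` (used for `β > 0`). -/
def limitGaussian (β : ℝ) : Measure ℝ :=
  gaussianReal (-(β / 2)) β.toNNReal

/-- Kolmogorov–Smirnov distance between the law under `P` of an extended real random variable `X`
and a law `ν` on `ℝ`: the supremum over real `t` of the difference of distribution functions. -/
def ksDist {Ω : Type*} [MeasurableSpace Ω] (P : Measure Ω) (X : Ω → EReal) (ν : Measure ℝ) : ℝ :=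
  ⨆ t : ℝ, |P.real {ω | X ω ≤ (t : EReal)} - ν.real (Set.Iic t)|

end RandomMatrixProduct

end

/-!
The vector `u` passes through the layers one after the other, and everything rests on what a
single layer does to a vector `x`. With the normalisation `(p * n i) ^ (-1/2)` by the output
dimension the images form a Markov chain (`IsModel.integral_state_succ`) whose last squared norm
is `Z = normSq p n d W ξ u`, and the expected squared norm stays equal to one. For a unit vector
`x` the squared norm of the output of a layer of width `N` is an average of `N` independent
variables of mean one. Hence its centred second moment is exactly `((3/p - 1) + (μ₄ - 3)/p *
‖x‖₄⁴) / N` (`IsLayer.integral_sumSq_sub_one_sq`), and its centred moments of order at least three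
are `O(1 / N ^ 2)` (`IsLayer.abs_integral_sumSq_pow_le_div`). Moreover the output is spread out:
its `ℓ⁴` norm to the fourth power is `O(1 / N)` in the mean. So `‖x‖₄⁴` matters to leading order
only for the initial vector, and the centred second moments add up to `β`, up to `O(S)` with `S =
sumInvSq n d`.

*Moments.* Binomial expansion in one layer gives `E Zᵢ₊₁ ^ k = E Zᵢ ^ k * (1 + (k choose 2) * βᵢ +
O(n ^ (-2)))` for the squared norms `Zᵢ` of the images, where `βᵢ` is the contribution of the
layer to `β` (`IsModel.abs_log_moment_step_le`). Taking logarithms and summing over the layers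
yields the multiplicative form, with an error `O(S)` (`IsModel.exists_moment_eq`). As the fourth
moment of a law without atoms exceeds one, `β` dominates `∑ 1 / n i` and thus `S`; this makes the
error bounded when `β` is, and the comparison with the log-normal moments `exp ((k choose 2) * β)`
follows (`IsModel.abs_moment_sub_le`).

*Distribution function.* The layers are replaced, one after the other, by independent Gaussian
increments of the logarithm (Lindeberg's method). If `R ≥ 0` has mean one and `f` has four bounded
derivatives, then `E f (l + log R) = f l + (f'' l - f' l) / 2 * E (R - 1) ^ 2`, up to the size of
the third and fourth centred moments of `R` (`BoundedJet.abs_integral_sub_le`). This applies to a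
layer and to the log-normal law alike, the value of `f (log R)` at `R = 0` being an arbitrary
bounded number. Since the Gaussian laws `N(-β/2, β)` form a convolution semigroup, each
replacement costs `O(1 / n ^ 2)` (`IsModel.abs_replacement_step_le`), the total cost being `O(S)`
times the bound for the derivatives. Enclosing the indicator of a half-line between smooth steps
of width `h` costs `O(S * h ^ (-4) + h)` (`abs_measureReal_sub_le`), and `h = S ^ (1/5)` gives the
rate (`IsModel.ksDist_le`).
-/

namespace RandomMatrixProduct

set_option linter.unusedSectionVars false

/-! ### Moments of sums of independent centred variables -/

section Moments

variable {Ω : Type*} [MeasurableSpace Ω] {P : Measure Ω}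

/-- A real random variable has finite moments of every order. -/
def HasAllMoments (X : Ω → ℝ) (P : Measure Ω) : Prop := ∀ k : ℕ, MemLp X k P

lemma HasAllMoments.aemeasurable {X : Ω → ℝ} (hX : HasAllMoments X P) : AEMeasurable X P :=
  (hX 0).aestronglyMeasurable.aemeasurable

lemma HasAllMoments.integrable {X : Ω → ℝ} (hX : HasAllMoments X P) : Integrable X P := by
  have := hX 1
  rwa [Nat.cast_one, memLp_one_iff_integrable] at this

lemma HasAllMoments.add {X Y : Ω → ℝ} (hX : HasAllMoments X P) (hY : HasAllMoments Y P) :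
    HasAllMoments (fun ω => X ω + Y ω) P := fun k => (hX k).add (hY k)

lemma HasAllMoments.sub {X Y : Ω → ℝ} (hX : HasAllMoments X P) (hY : HasAllMoments Y P) :
    HasAllMoments (fun ω => X ω - Y ω) P := fun k => (hX k).sub (hY k)

lemma HasAllMoments.mul {X Y : Ω → ℝ} (hX : HasAllMoments X P) (hY : HasAllMoments Y P) :
    HasAllMoments (fun ω => X ω * Y ω) P := fun k => by
  have : ENNReal.HolderTriple ((2 * k : ℕ) : ENNReal) ((2 * k : ℕ) : ENNReal) (k : ENNReal) := by
    constructor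
    rw [Nat.cast_mul, ENNReal.mul_inv (by simp) (by simp), ← add_mul]
    simp [ENNReal.inv_two_add_inv_two]
  exact MemLp.mul (hY (2 * k)) (hX (2 * k))

lemma HasAllMoments.const [IsFiniteMeasure P] (c : ℝ) : HasAllMoments (fun _ : Ω => c) P :=
  fun _ => memLp_const c

lemma HasAllMoments.const_mul {X : Ω → ℝ} (hX : HasAllMoments X P) (c : ℝ) :
    HasAllMoments (fun ω => c * X ω) P := fun k => (hX k).const_mul c

lemma HasAllMoments.pow [IsFiniteMeasure P] {X : Ω → ℝ} (hX : HasAllMoments X P) (k : ℕ) :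
    HasAllMoments (fun ω => X ω ^ k) P := by
  induction k with
  | zero => simpa using HasAllMoments.const (P := P) 1
  | succ k ih => simpa [pow_succ] using ih.mul hX

lemma HasAllMoments.sum {ι : Type*} (s : Finset ι) {X : ι → Ω → ℝ}
    (hX : ∀ i ∈ s, HasAllMoments (X i) P) : HasAllMoments (fun ω => ∑ i ∈ s, X i ω) P :=
  fun k => memLp_finsetSum s fun i hi => hX i hi k

lemma hasAllMoments_of_integrable_pow {X : Ω → ℝ} (hX : AEStronglyMeasurable X P)
    (h : ∀ k : ℕ, Integrable (fun ω => X ω ^ k) P) : HasAllMoments X P := by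
  intro k
  rcases Nat.eq_zero_or_pos k with rfl | hk
  · simpa using hX
  rw [← integrable_norm_rpow_iff hX (by simpa using hk.ne') (by simp)]
  refine ((h k).norm).congr (ae_of_all _ fun ω => ?_)
  simp

lemma HasAllMoments.comp_hasLaw {X : Ω → ℝ} {ν : Measure ℝ} (hX : HasLaw X ν P)
    (h : HasAllMoments (fun x : ℝ => x) ν) : HasAllMoments X P := by
  intro k
  have h1 := h k
  rw [← hX.map_eq] at h1
  exact (memLp_map_measure_iff h1.aestronglyMeasurable hX.aemeasurable).1 h1

/-- The binomial expansion of the moments of a sum of two independent variables. -/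
lemma integral_add_pow_of_indepFun [IsFiniteMeasure P] {X Y : Ω → ℝ} (h : IndepFun X Y P)
    (hX : HasAllMoments X P) (hY : HasAllMoments Y P) (r : ℕ) :
    ∫ ω, (X ω + Y ω) ^ r ∂P =
      ∑ j ∈ Finset.range (r + 1),
        (∫ ω, X ω ^ j ∂P) * (∫ ω, Y ω ^ (r - j) ∂P) * (r.choose j : ℝ) := by
  simp_rw [add_pow]
  rw [integral_finsetSum]
  · refine Finset.sum_congr rfl fun j _ => ?_
    rw [integral_mul_const]
    congr 1
    have h2 : IndepFun (fun ω => X ω ^ j) (fun ω => Y ω ^ (r - j)) P :=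
      h.comp (φ := fun x => x ^ j) (ψ := fun x => x ^ (r - j)) (by fun_prop) (by fun_prop)
    exact h2.integral_fun_mul_eq_mul_integral (hX.pow j).integrable.aestronglyMeasurable
      (hY.pow _).integrable.aestronglyMeasurable
  · intro j _
    exact (((hX.pow j).mul (hY.pow (r - j))).integrable).mul_const _

variable {ι : Type*} {X : ι → Ω → ℝ}

/-- Every variable of the family is independent of each finite sum over other indices. -/
def IndepOfSums (X : ι → Ω → ℝ) (P : Measure Ω) : Prop :=
  ∀ (s : Finset ι) (i : ι), i ∉ s → IndepFun (fun ω => ∑ j ∈ s, X j ω) (X i) P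

lemma integral_sum_pow_two [IsProbabilityMeasure P] (hX : ∀ i, HasAllMoments (X i) P)
    (hind : IndepOfSums X P) (h0 : ∀ i, ∫ ω, X i ω ∂P = 0) (s : Finset ι) :
    ∫ ω, (∑ i ∈ s, X i ω) ^ 2 ∂P = ∑ i ∈ s, ∫ ω, X i ω ^ 2 ∂P := by
  classical
  induction s using Finset.induction_on with
  | empty => simp
  | insert i s hi ih =>
    have hS := HasAllMoments.sum s (fun j _ => hX j)
    simp_rw [Finset.sum_insert hi, add_comm (X i _)]
    rw [integral_add_pow_of_indepFun (hind s i hi) hS (hX i) 2]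
    simp [Finset.sum_range_succ, h0, ih]

lemma integral_sum_eq_zero (hX : ∀ i, HasAllMoments (X i) P)
    (h0 : ∀ i, ∫ ω, X i ω ∂P = 0) (s : Finset ι) :
    ∫ ω, ∑ i ∈ s, X i ω ∂P = 0 := by
  rw [integral_finsetSum _ fun i _ => (hX i).integrable]
  simp [h0]

lemma integral_sum_pow_three [IsProbabilityMeasure P] (hX : ∀ i, HasAllMoments (X i) P)
    (hind : IndepOfSums X P) (h0 : ∀ i, ∫ ω, X i ω ∂P = 0) (s : Finset ι) :
    ∫ ω, (∑ i ∈ s, X i ω) ^ 3 ∂P = ∑ i ∈ s, ∫ ω, X i ω ^ 3 ∂P := by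
  classical
  induction s using Finset.induction_on with
  | empty => simp
  | insert i s hi ih =>
    have hS := HasAllMoments.sum s (fun j _ => hX j)
    simp_rw [Finset.sum_insert hi, add_comm (X i _)]
    rw [integral_add_pow_of_indepFun (hind s i hi) hS (hX i) 3]
    have := integral_sum_eq_zero hX h0 s
    simp [Finset.sum_range_succ, h0, ih, this]

lemma integral_sum_pow_four [IsProbabilityMeasure P] (hX : ∀ i, HasAllMoments (X i) P)
    (hind : IndepOfSums X P) (h0 : ∀ i, ∫ ω, X i ω ∂P = 0) (s : Finset ι) :
    ∫ ω, (∑ i ∈ s, X i ω) ^ 4 ∂P = ∑ i ∈ s, ∫ ω, X i ω ^ 4 ∂P +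
      3 * ((∑ i ∈ s, ∫ ω, X i ω ^ 2 ∂P) ^ 2 - ∑ i ∈ s, (∫ ω, X i ω ^ 2 ∂P) ^ 2) := by
  classical
  induction s using Finset.induction_on with
  | empty => simp
  | insert i s hi ih =>
    have hS := HasAllMoments.sum s (fun j _ => hX j)
    simp_rw [Finset.sum_insert hi, add_comm (X i _)]
    rw [integral_add_pow_of_indepFun (hind s i hi) hS (hX i) 4]
    have h1 := integral_sum_eq_zero hX h0 s
    have h2 := integral_sum_pow_two hX hind h0 s
    have h3 := integral_sum_pow_three hX hind h0 s
    have hc : (Nat.choose 4 2 : ℝ) = 6 := by norm_num [Nat.choose]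
    simp [Finset.sum_range_succ, h0, ih, h1, h2, h3, hc]
    ring

/-- Constants for the Marcinkiewicz–Zygmund type bound `abs_integral_sum_pow_le`. -/
noncomputable def momentConst (M : ℕ → ℝ) : ℕ → ℝ
  | 0 => 1
  | r + 1 => ∑ j : Fin r, momentConst M j * M (r + 1 - j) * ((r + 1).choose j : ℝ)

lemma momentConst_nonneg {M : ℕ → ℝ} (hM : ∀ r, 0 ≤ M r) (r : ℕ) : 0 ≤ momentConst M r := by
  induction r using Nat.strong_induction_on with
  | _ r ih =>
    cases r with
    | zero => simp [momentConst]
    | succ r =>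
      rw [momentConst]
      refine Finset.sum_nonneg fun j _ => ?_
      have := ih j (by omega)
      have := hM (r + 1 - j)
      positivity

/-- If the `r`-th moments of independent centred variables `X i` are bounded by `M r * c i ^ r`,
then the moments of `∑ X i` are bounded by the powers of the Euclidean norm of `c`. Only centring
matters: in the binomial expansion of `(S + X i) ^ r` the term linear in `X i` vanishes, and the
terms of order `≥ 2` in `c i` are absorbed by the increment of the `r`-th power of the Euclidean
norm. -/
lemma abs_integral_sum_pow_le [IsProbabilityMeasure P] {M : ℕ → ℝ} (hM : ∀ r, 0 ≤ M r)
    {c : ι → ℝ} (hc : ∀ i, 0 ≤ c i) (hX : ∀ i, HasAllMoments (X i) P)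
    (hind : IndepOfSums X P) (h0 : ∀ i, ∫ ω, X i ω ∂P = 0)
    (hXM : ∀ i r, |∫ ω, X i ω ^ r ∂P| ≤ M r * c i ^ r) (s : Finset ι) (r : ℕ) :
    |∫ ω, (∑ i ∈ s, X i ω) ^ r ∂P| ≤
      momentConst M r * Real.sqrt (∑ i ∈ s, c i ^ 2) ^ r := by
  classical
  induction s using Finset.induction_on generalizing r with
  | empty =>
    rcases Nat.eq_zero_or_pos r with rfl | hr
    · simp [momentConst]
    · simp [hr.ne']
  | insert i s hi ih =>
    have hS := HasAllMoments.sum s (fun j _ => hX j)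
    simp_rw [Finset.sum_insert hi, add_comm (X i _), add_comm (c i ^ 2)]
    rw [integral_add_pow_of_indepFun (hind s i hi) hS (hX i) r]
    rcases r with _ | r
    · simp [momentConst]
    set a := Real.sqrt (∑ i ∈ s, c i ^ 2) with ha
    have ha0 : 0 ≤ a := Real.sqrt_nonneg _
    have hss : 0 ≤ ∑ i ∈ s, c i ^ 2 := Finset.sum_nonneg fun j _ => sq_nonneg _
    have ha2 : a ^ 2 = ∑ i ∈ s, c i ^ 2 := Real.sq_sqrt hss
    set t := Real.sqrt (∑ i ∈ s, c i ^ 2 + c i ^ 2) with ht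
    have ht0 : 0 ≤ t := Real.sqrt_nonneg _
    have ht2 : t ^ 2 = a ^ 2 + c i ^ 2 := by rw [ha2]; exact Real.sq_sqrt (by positivity)
    have hat : a ≤ t := by
      apply Real.sqrt_le_sqrt; nlinarith [sq_nonneg (c i)]
    have hct : c i ≤ t := by
      apply Real.le_sqrt_of_sq_le; linarith
    rw [Finset.sum_range_succ, Finset.sum_range_succ]
    have e1 : r + 1 - r = 1 := by omega
    simp only [Nat.sub_self, pow_zero, e1, pow_one, h0 i, mul_zero, zero_mul, add_zero,
      integral_const, probReal_univ, one_smul, Nat.choose_self, Nat.cast_one, mul_one]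
    rcases r with _ | r
    · have := integral_sum_eq_zero hX h0 s
      simp [this, momentConst]
    have hmain : ∀ j ∈ Finset.range (r + 1),
        |(∫ ω, (∑ i ∈ s, X i ω) ^ j ∂P) * (∫ ω, X i ω ^ (r + 1 + 1 - j) ∂P) *
          ((r + 1 + 1).choose j : ℝ)| ≤
        momentConst M j * M (r + 1 + 1 - j) * ((r + 1 + 1).choose j : ℝ) *
          (t ^ (r + 1 + 1) - a ^ (r + 1 + 1)) := by
      intro j hj
      have hj' : j ≤ r := by simpa [Nat.lt_succ_iff] using hj
      obtain ⟨l, rfl⟩ := Nat.exists_eq_add_of_le hj'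
      have e2 : j + l + 1 + 1 - j = l + 2 := by omega
      rw [e2, abs_mul, abs_mul, Nat.abs_cast]
      have key : a ^ j * c i ^ (l + 2) ≤ t ^ (j + l + 1 + 1) - a ^ (j + l + 1 + 1) := by
        have k1 : a ^ j * c i ^ l ≤ t ^ (j + l) := by
          rw [pow_add]
          exact mul_le_mul (pow_le_pow_left₀ ha0 hat _) (pow_le_pow_left₀ (hc i) hct _)
            (pow_nonneg (hc i) _) (pow_nonneg ht0 _)
        have k2 : a ^ (j + l) ≤ t ^ (j + l) := pow_le_pow_left₀ ha0 hat _
        have e3 : t ^ (j + l + 1 + 1) = t ^ (j + l) * (a ^ 2 + c i ^ 2) := by rw [← ht2]; ring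
        have e4 : a ^ (j + l + 1 + 1) = a ^ (j + l) * a ^ 2 := by ring
        have e5 : a ^ j * c i ^ (l + 2) = (a ^ j * c i ^ l) * c i ^ 2 := by ring
        rw [e3, e4, e5]
        nlinarith [sq_nonneg a, sq_nonneg (c i), mul_le_mul_of_nonneg_right k1 (sq_nonneg (c i)),
          mul_le_mul_of_nonneg_right k2 (sq_nonneg a)]
      have n1 := momentConst_nonneg hM j
      have n2 := hM (l + 2)
      calc _ ≤ (momentConst M j * a ^ j) * (M (l + 2) * c i ^ (l + 2)) *
            ((j + l + 1 + 1).choose j : ℝ) := by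
            exact mul_le_mul_of_nonneg_right (mul_le_mul (ih j) (hXM i _) (abs_nonneg _)
              (mul_nonneg n1 (pow_nonneg ha0 j))) (Nat.cast_nonneg _)
        _ = momentConst M j * M (l + 2) * ((j + l + 1 + 1).choose j : ℝ) *
            (a ^ j * c i ^ (l + 2)) := by ring
        _ ≤ _ := by gcongr
    calc _ ≤ ∑ j ∈ Finset.range (r + 1), momentConst M j * M (r + 1 + 1 - j) *
          ((r + 1 + 1).choose j : ℝ) * (t ^ (r + 1 + 1) - a ^ (r + 1 + 1)) +
          momentConst M (r + 1 + 1) * a ^ (r + 1 + 1) := by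
          refine (abs_add_le _ _).trans (add_le_add ?_ (ih _))
          exact (Finset.abs_sum_le_sum_abs _ _).trans (Finset.sum_le_sum hmain)
      _ = _ := by
          rw [← Finset.sum_mul]
          have : ∑ j ∈ Finset.range (r + 1), momentConst M j * M (r + 1 + 1 - j) *
              ((r + 1 + 1).choose j : ℝ) = momentConst M (r + 1 + 1) := by
            rw [momentConst, Finset.sum_range
              (fun j => momentConst M j * M (r + 1 + 1 - j) * ((r + 1 + 1).choose j : ℝ))]
          rw [this]; ring

end Moments

/-! ### Moments of one random layer -/

section Layer

variable {Ω : Type*} [MeasurableSpace Ω] {P : Measure Ω}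

/-- Functions of disjoint groups of independent variables are independent. That `φ` depends only on
the coordinates in `S` is expressed on the full product space. -/
lemma indepFun_of_disjoint {κ : Type*} [Fintype κ] {f : κ → Ω → ℝ}
    (hf : iIndepFun f P) (hm : ∀ k, AEMeasurable (f k) P) {S T : Finset κ} (hST : Disjoint S T)
    {β γ : Type*} [MeasurableSpace β] [MeasurableSpace γ]
    {φ : (κ → ℝ) → β} {ψ : (κ → ℝ) → γ} (hφ : Measurable φ) (hψ : Measurable ψ)
    (hφS : ∀ e e', (∀ k ∈ S, e k = e' k) → φ e = φ e')
    (hψT : ∀ e e', (∀ k ∈ T, e k = e' k) → ψ e = ψ e') :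
    IndepFun (fun ω => φ (fun k => f k ω)) (fun ω => ψ (fun k => f k ω)) P := by
  classical
  have h := iIndepFun.indepFun_finset₀ S T hST hf hm
  have hext : ∀ U : Finset κ, Measurable
      (fun (e : U → ℝ) (k : κ) => if hk : k ∈ U then e ⟨k, hk⟩ else 0) := by
    intro U
    refine measurable_pi_lambda _ fun k => ?_
    by_cases hk : k ∈ U
    · simpa [hk] using measurable_pi_apply _
    · simp [hk]
  have h2 := h.comp (hφ.comp (hext S)) (hψ.comp (hext T))
  convert h2 using 1
  · funext ω
    exact hφS _ _ fun k hk => by simp [hk]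
  · funext ω
    exact hψT _ _ fun k hk => by simp [hk]

lemma IsEntryLaw.hasAllMoments {μ : Measure ℝ} (hμ : IsEntryLaw μ) :
    HasAllMoments (fun x : ℝ => x) μ :=
  hasAllMoments_of_integrable_pow aestronglyMeasurable_id hμ.integrable_pow

/-- The entries of a weight matrix and of a diagonal Bernoulli matrix as one family. -/
def layerEntries {N' N : ℕ} (w : Ω → Fin N' → Fin N → ℝ) (z : Ω → Fin N' → ℝ) :
    (Fin N' × Fin N) ⊕ Fin N' → Ω → ℝ
  | Sum.inl ab, ω => w ω ab.1 ab.2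
  | Sum.inr a, ω => z ω a

/-- `w` and `z` are the weights and the Bernoulli variables of a single layer of the model. -/
structure IsLayer {N' N : ℕ} (P : Measure Ω) (μ : Measure ℝ) (p : unitInterval)
    (w : Ω → Fin N' → Fin N → ℝ) (z : Ω → Fin N' → ℝ) : Prop where
  hasLaw_weight : ∀ a b, HasLaw (fun ω => w ω a b) μ P
  hasLaw_bernoulli : ∀ a, HasLaw (fun ω => z ω a) (bernoulliMeasure (1 : ℝ) 0 p) P
  independent : iIndepFun (layerEntries w z) P

/-- The action of one layer on a vector, with the normalisation `(p * N') ^ (-1/2)` by the output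
dimension, for which the squared norm is preserved in the mean. -/
noncomputable def layerStep {N' N : ℕ} (p : unitInterval) (w : Fin N' → Fin N → ℝ)
    (z : Fin N' → ℝ) (x : Fin N → ℝ) : Fin N' → ℝ :=
  fun a => (Real.sqrt ((p : ℝ) * N'))⁻¹ * (z a * ∑ b, w a b * x b)

/-- The squared Euclidean norm of a vector. -/
def sumSq {N : ℕ} (x : Fin N → ℝ) : ℝ := ∑ a, x a ^ 2

/-- The fourth power of the `ℓ⁴` norm of a vector. -/
def sumFourth {N : ℕ} (x : Fin N → ℝ) : ℝ := ∑ a, x a ^ 4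

lemma sumSq_nonneg {N : ℕ} (x : Fin N → ℝ) : 0 ≤ sumSq x :=
  Finset.sum_nonneg fun _ _ => sq_nonneg _

lemma sumFourth_nonneg {N : ℕ} (x : Fin N → ℝ) : 0 ≤ sumFourth x :=
  Finset.sum_nonneg fun a _ => by positivity

lemma sumFourth_le {N : ℕ} (x : Fin N → ℝ) : sumFourth x ≤ sumSq x ^ 2 := by
  have h : ∀ a ∈ Finset.univ, x a ^ 4 ≤ x a ^ 2 * sumSq x := fun a ha => by
    have := Finset.single_le_sum (f := fun a => x a ^ 2) (fun i _ => sq_nonneg _) ha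
    have h2 : x a ^ 4 = x a ^ 2 * x a ^ 2 := by ring
    rw [h2]
    exact mul_le_mul_of_nonneg_left this (sq_nonneg _)
  calc sumFourth x ≤ ∑ a, x a ^ 2 * sumSq x := Finset.sum_le_sum h
    _ = sumSq x ^ 2 := by rw [← Finset.sum_mul, sq]; rfl

lemma sumSq_smul {N : ℕ} (c : ℝ) (x : Fin N → ℝ) : sumSq (c • x) = c ^ 2 * sumSq x := by
  simp [sumSq, Finset.mul_sum, mul_pow]

lemma sumFourth_smul {N : ℕ} (c : ℝ) (x : Fin N → ℝ) :
    sumFourth (c • x) = c ^ 4 * sumFourth x := by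
  simp [sumFourth, Finset.mul_sum, mul_pow]

lemma eq_zero_of_sumSq {N : ℕ} {x : Fin N → ℝ} (h : sumSq x = 0) : x = 0 := by
  rw [sumSq, Finset.sum_eq_zero_iff_of_nonneg fun _ _ => sq_nonneg _] at h
  funext a
  simpa using h a (Finset.mem_univ a)

lemma layerStep_smul {N' N : ℕ} (p : unitInterval) (w : Fin N' → Fin N → ℝ)
    (z : Fin N' → ℝ) (c : ℝ) (x : Fin N → ℝ) :
    layerStep p w z (c • x) = c • layerStep p w z x := by
  funext a
  simp only [layerStep, Pi.smul_apply, smul_eq_mul, mul_left_comm _ c, ← Finset.mul_sum]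

/-- The constants bounding the moments `E (∑ w_b x_b) ^ (2 r)` for unit vectors `x`. -/
noncomputable def rowConst (m : ℕ → ℝ) (r : ℕ) : ℝ := momentConst (fun j => |m j|) (2 * r)

lemma rowConst_nonneg (m : ℕ → ℝ) (r : ℕ) : 0 ≤ rowConst m r :=
  momentConst_nonneg (fun _ => abs_nonneg _) _

/-- The constants bounding the centred moments of the summands of the squared norm of the output
of a layer. -/
noncomputable def summandConst (m : ℕ → ℝ) (p₀ : ℝ) (r : ℕ) : ℝ :=
  2 ^ r * ((p₀⁻¹) ^ r * rowConst m r + 1)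

/-- The constants bounding the centred moments of the squared norm of the output of a layer. -/
noncomputable def stepConst (m : ℕ → ℝ) (p₀ : ℝ) (r : ℕ) : ℝ :=
  momentConst (summandConst m p₀) r + summandConst m p₀ r

variable {N' N : ℕ} {μ : Measure ℝ} {p : unitInterval}
  {w : Ω → Fin N' → Fin N → ℝ} {z : Ω → Fin N' → ℝ} {m : ℕ → ℝ}

namespace IsLayer

lemma hasAllMoments_weight (h : IsLayer P μ p w z) (hμ : IsEntryLaw μ) (a : Fin N') (b : Fin N) :
    HasAllMoments (fun ω => w ω a b) P :=
  HasAllMoments.comp_hasLaw (h.hasLaw_weight a b) hμ.hasAllMoments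

lemma hasAllMoments_bernoulli (h : IsLayer P μ p w z) (a : Fin N') :
    HasAllMoments (fun ω => z ω a) P := by
  refine HasAllMoments.comp_hasLaw (h.hasLaw_bernoulli a)
    (hasAllMoments_of_integrable_pow aestronglyMeasurable_id fun k => ?_)
  rw [bernoulliMeasure_def]
  exact ((integrable_dirac (by simp)).smul_measure_nnreal).add_measure
    ((integrable_dirac (by simp)).smul_measure_nnreal)

lemma aemeasurable_layerEntries (h : IsLayer P μ p w z) (k) :
    AEMeasurable (layerEntries w z k) P := by
  rcases k with ⟨a, b⟩ | a
  · exact (h.hasLaw_weight a b).aemeasurable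
  · exact (h.hasLaw_bernoulli a).aemeasurable

lemma integral_weight_pow (h : IsLayer P μ p w z) (hm : ∀ j : ℕ, ∫ x, x ^ j ∂μ = m j)
    (a : Fin N') (b : Fin N) (r : ℕ) : ∫ ω, w ω a b ^ r ∂P = m r := by
  rw [← hm r]
  exact (h.hasLaw_weight a b).integral_comp (f := fun x => x ^ r) (by fun_prop)

lemma integral_bernoulli_pow (h : IsLayer P μ p w z) (a : Fin N') {r : ℕ} (hr : r ≠ 0) :
    ∫ ω, z ω a ^ r ∂P = p := by
  have := (h.hasLaw_bernoulli a).integral_comp (f := fun x => x ^ r) (by fun_prop)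
  rw [integral_bernoulliMeasure] at this
  simpa [hr] using this

variable [IsProbabilityMeasure P]

lemma hasAllMoments_row (h : IsLayer P μ p w z) (hμ : IsEntryLaw μ) (a : Fin N') (x : Fin N → ℝ) :
    HasAllMoments (fun ω => ∑ b, w ω a b * x b) P := by
  refine HasAllMoments.sum _ fun b _ => ?_
  simpa only [mul_comm] using (h.hasAllMoments_weight hμ a b).const_mul (x b)

lemma indepOfSums_row (h : IsLayer P μ p w z) (a : Fin N') (x : Fin N → ℝ) :
    IndepOfSums (fun b ω => w ω a b * x b) P := by
  classical
  intro s b hb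
  exact indepFun_of_disjoint h.independent h.aemeasurable_layerEntries
    (S := s.image fun b => Sum.inl (a, b)) (T := {Sum.inl (a, b)})
    (φ := fun e => ∑ b ∈ s, e (Sum.inl (a, b)) * x b) (ψ := fun e => e (Sum.inl (a, b)) * x b)
    (by simpa using hb) (by fun_prop) (by fun_prop)
    (fun e e' he => Finset.sum_congr rfl fun b hb => by
      rw [he _ (Finset.mem_image_of_mem _ hb)])
    (fun e e' he => by rw [he _ (by simp)])

lemma integral_row_pow_le (h : IsLayer P μ p w z) (hμ : IsEntryLaw μ)
    (hm : ∀ j : ℕ, ∫ x, x ^ j ∂μ = m j) (a : Fin N') {x : Fin N → ℝ} (hx : sumSq x = 1) (r : ℕ) :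
    ∫ ω, (∑ b, w ω a b * x b) ^ (2 * r) ∂P ≤ rowConst m r := by
  have h0 : ∀ b, ∫ ω, w ω a b * x b ∂P = 0 := fun b => by
    have h1 := h.integral_weight_pow hm a b 1
    have h2 := hm 1
    simp only [pow_one, hμ.mean_eq_zero] at h1 h2
    rw [integral_mul_const, h1, ← h2, zero_mul]
  have := abs_integral_sum_pow_le (M := fun j => |m j|) (fun _ => abs_nonneg _)
    (c := fun b => |x b|) (fun _ => abs_nonneg _)
    (fun b => by simpa only [mul_comm] using (h.hasAllMoments_weight hμ a b).const_mul (x b))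
    (h.indepOfSums_row a x) h0 (fun b r => by
      simp_rw [mul_pow]
      rw [integral_mul_const, h.integral_weight_pow hm, abs_mul, abs_pow]) Finset.univ (2 * r)
  have e : ∑ b, |x b| ^ 2 = 1 := by simpa [sumSq] using hx
  rw [e, Real.sqrt_one, one_pow, mul_one] at this
  exact (le_abs_self _).trans this

lemma integral_row_pow_two (h : IsLayer P μ p w z) (hμ : IsEntryLaw μ)
    (a : Fin N') {x : Fin N → ℝ} (hx : sumSq x = 1) :
    ∫ ω, (∑ b, w ω a b * x b) ^ 2 ∂P = 1 := by
  have hw := fun b r => h.integral_weight_pow (m := fun j => ∫ x, x ^ j ∂μ) (fun _ => rfl) a b r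
  have h0 : ∀ b, ∫ ω, w ω a b * x b ∂P = 0 := fun b => by
    have h1 := hw b 1
    simp only [pow_one, hμ.mean_eq_zero] at h1
    rw [integral_mul_const, h1, zero_mul]
  rw [integral_sum_pow_two
    (fun b => by simpa only [mul_comm] using (h.hasAllMoments_weight hμ a b).const_mul (x b))
    (h.indepOfSums_row a x) h0]
  simp_rw [mul_pow, integral_mul_const, hw, hμ.variance_eq_one, one_mul]
  exact hx

lemma integral_row_pow_four (h : IsLayer P μ p w z) (hμ : IsEntryLaw μ)
    (hm : ∀ j : ℕ, ∫ x, x ^ j ∂μ = m j)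
    (a : Fin N') {x : Fin N → ℝ} (hx : sumSq x = 1) :
    ∫ ω, (∑ b, w ω a b * x b) ^ 4 ∂P = 3 + (m 4 - 3) * sumFourth x := by
  have hw := h.integral_weight_pow hm a
  have h0 : ∀ b, ∫ ω, w ω a b * x b ∂P = 0 := fun b => by
    have h1 := hw b 1
    have h2 := hm 1
    simp only [pow_one, hμ.mean_eq_zero] at h1 h2
    rw [integral_mul_const, h1, ← h2, zero_mul]
  rw [integral_sum_pow_four
    (fun b => by simpa only [mul_comm] using (h.hasAllMoments_weight hμ a b).const_mul (x b))
    (h.indepOfSums_row a x) h0]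
  have h2 : m 2 = 1 := by rw [← hm 2, hμ.variance_eq_one]
  simp_rw [mul_pow, integral_mul_const, hw, h2, one_mul, ← pow_mul, ← Finset.mul_sum]
  norm_num
  change m 4 * sumFourth x + 3 * (sumSq x ^ 2 - sumFourth x) = _
  rw [hx]; ring

/-- The summands of the squared norm of the output of a layer, normalised to have mean one on unit
vectors. -/
noncomputable def _root_.RandomMatrixProduct.summand (p : unitInterval)
    (w : Ω → Fin N' → Fin N → ℝ) (z : Ω → Fin N' → ℝ) (x : Fin N → ℝ) (a : Fin N') (ω : Ω) : ℝ :=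
  (p : ℝ)⁻¹ * (z ω a ^ 2 * (∑ b, w ω a b * x b) ^ 2)

lemma hasAllMoments_summand (h : IsLayer P μ p w z) (hμ : IsEntryLaw μ) (x : Fin N → ℝ)
    (a : Fin N') : HasAllMoments (summand p w z x a) P :=
  (((h.hasAllMoments_bernoulli a).pow 2).mul ((h.hasAllMoments_row hμ a x).pow 2)).const_mul _

lemma integral_summand_pow (h : IsLayer P μ p w z) (hμ : IsEntryLaw μ) (x : Fin N → ℝ)
    (a : Fin N') {r : ℕ} (hr : r ≠ 0) :
    ∫ ω, summand p w z x a ω ^ r ∂P =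
      ((p : ℝ)⁻¹) ^ r * (p * ∫ ω, (∑ b, w ω a b * x b) ^ (2 * r) ∂P) := by
  classical
  have hi : IndepFun (fun ω => z ω a ^ (2 * r)) (fun ω => (∑ b, w ω a b * x b) ^ (2 * r)) P :=
    indepFun_of_disjoint h.independent h.aemeasurable_layerEntries
      (S := {Sum.inr a}) (T := Finset.univ.image fun b => Sum.inl (a, b))
      (φ := fun e => e (Sum.inr a) ^ (2 * r))
      (ψ := fun e => (∑ b, e (Sum.inl (a, b)) * x b) ^ (2 * r))
      (by simp) (by fun_prop) (by fun_prop) (fun e e' he => by simp [he])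
      (fun e e' he => by
        congr 1
        refine Finset.sum_congr rfl fun b _ => ?_
        rw [he _ (Finset.mem_image_of_mem _ (Finset.mem_univ b))])
  simp_rw [summand, mul_pow, ← pow_mul]
  rw [integral_const_mul, hi.integral_fun_mul_eq_mul_integral
    ((h.hasAllMoments_bernoulli a).pow _).aemeasurable.aestronglyMeasurable
    ((h.hasAllMoments_row hμ a x).pow _).aemeasurable.aestronglyMeasurable,
    h.integral_bernoulli_pow a (by omega)]

lemma integral_summand_pow_le (h : IsLayer P μ p w z) (hμ : IsEntryLaw μ)
    (hm : ∀ j : ℕ, ∫ x, x ^ j ∂μ = m j) {p₀ : ℝ} (hp₀ : 0 < p₀) (hp : p₀ ≤ p)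
    {x : Fin N → ℝ} (hx : sumSq x = 1) (a : Fin N') {r : ℕ} (hr : r ≠ 0) :
    ∫ ω, summand p w z x a ω ^ r ∂P ≤ (p₀⁻¹) ^ r * rowConst m r := by
  rw [h.integral_summand_pow hμ x a hr]
  have hp1 : (p : ℝ) ≤ 1 := p.2.2
  have hpp : 0 < (p : ℝ) := hp₀.trans_le hp
  have h1 := h.integral_row_pow_le hμ hm a hx r
  have h2 : 0 ≤ ∫ ω, (∑ b, w ω a b * x b) ^ (2 * r) ∂P :=
    integral_nonneg fun ω => by simp only [pow_mul]; positivity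
  have h3 : (p : ℝ)⁻¹ ≤ p₀⁻¹ := inv_anti₀ hp₀ hp
  have h4 : (p : ℝ) * ∫ ω, (∑ b, w ω a b * x b) ^ (2 * r) ∂P ≤ rowConst m r := by
    nlinarith
  gcongr

lemma integral_summand (h : IsLayer P μ p w z) (hμ : IsEntryLaw μ)
    (hp : 0 < (p : ℝ)) {x : Fin N → ℝ} (hx : sumSq x = 1) (a : Fin N') :
    ∫ ω, summand p w z x a ω ∂P = 1 := by
  have := h.integral_summand_pow hμ x a one_ne_zero
  simp only [pow_one, mul_one] at this
  rw [this, h.integral_row_pow_two hμ a hx]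
  field_simp

lemma integral_summand_sq (h : IsLayer P μ p w z) (hμ : IsEntryLaw μ)
    (hm : ∀ j : ℕ, ∫ x, x ^ j ∂μ = m j)
    (hp : 0 < (p : ℝ)) {x : Fin N → ℝ} (hx : sumSq x = 1) (a : Fin N') :
    ∫ ω, summand p w z x a ω ^ 2 ∂P = (3 + (m 4 - 3) * sumFourth x) / p := by
  rw [h.integral_summand_pow hμ x a two_ne_zero, h.integral_row_pow_four hμ hm a hx]
  field_simp

lemma layerStep_sq (hp : 0 < (p : ℝ)) (x : Fin N → ℝ) (a : Fin N') (ω : Ω) :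
    layerStep p (w ω) (z ω) x a ^ 2 = (N' : ℝ)⁻¹ * summand p w z x a ω := by
  rw [layerStep, summand, mul_pow, inv_pow, Real.sq_sqrt (by positivity), mul_pow, mul_inv]
  ring

lemma sumSq_layerStep (hp : 0 < (p : ℝ)) (x : Fin N → ℝ) (ω : Ω) :
    sumSq (layerStep p (w ω) (z ω) x) = ∑ a, (N' : ℝ)⁻¹ * summand p w z x a ω :=
  Finset.sum_congr rfl fun a _ => layerStep_sq hp x a ω

lemma sumFourth_layerStep (hp : 0 < (p : ℝ)) (x : Fin N → ℝ) (ω : Ω) :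
    sumFourth (layerStep p (w ω) (z ω) x) =
      ((N' : ℝ)⁻¹) ^ 2 * ∑ a, summand p w z x a ω ^ 2 := by
  rw [sumFourth, Finset.mul_sum]
  refine Finset.sum_congr rfl fun a _ => ?_
  rw [← mul_pow, ← layerStep_sq hp]
  ring

lemma hasAllMoments_layerStep (h : IsLayer P μ p w z) (hμ : IsEntryLaw μ) (x : Fin N → ℝ)
    (a : Fin N') : HasAllMoments (fun ω => layerStep p (w ω) (z ω) x a) P :=
  ((h.hasAllMoments_bernoulli a).mul (h.hasAllMoments_row hμ a x)).const_mul _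

lemma hasAllMoments_sumSq (h : IsLayer P μ p w z) (hμ : IsEntryLaw μ) (x : Fin N → ℝ) :
    HasAllMoments (fun ω => sumSq (layerStep p (w ω) (z ω) x)) P :=
  HasAllMoments.sum _ fun a _ => (h.hasAllMoments_layerStep hμ x a).pow 2

lemma hasAllMoments_sumFourth (h : IsLayer P μ p w z) (hμ : IsEntryLaw μ) (x : Fin N → ℝ) :
    HasAllMoments (fun ω => sumFourth (layerStep p (w ω) (z ω) x)) P :=
  HasAllMoments.sum _ fun a _ => (h.hasAllMoments_layerStep hμ x a).pow 4

lemma sumSq_layerStep_sub_one (hN : 0 < N') (hp : 0 < (p : ℝ)) (x : Fin N → ℝ) (ω : Ω) :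
    sumSq (layerStep p (w ω) (z ω) x) - 1 = ∑ a, (N' : ℝ)⁻¹ * (summand p w z x a ω - 1) := by
  have : (N' : ℝ) ≠ 0 := by positivity
  rw [sumSq_layerStep hp]
  simp [mul_sub, this]

lemma indepOfSums_summand (h : IsLayer P μ p w z) (x : Fin N → ℝ) :
    IndepOfSums (fun a ω => (N' : ℝ)⁻¹ * (summand p w z x a ω - 1)) P := by
  classical
  intro s a ha
  have := indepFun_of_disjoint h.independent h.aemeasurable_layerEntries
    (S := Finset.univ.filter fun k => Sum.elim Prod.fst id k ∈ s)
    (T := Finset.univ.filter fun k => Sum.elim Prod.fst id k = a)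
    (φ := fun e => ∑ a ∈ s, (N' : ℝ)⁻¹ *
      ((p : ℝ)⁻¹ * (e (Sum.inr a) ^ 2 * (∑ b, e (Sum.inl (a, b)) * x b) ^ 2) - 1))
    (ψ := fun e => (N' : ℝ)⁻¹ *
      ((p : ℝ)⁻¹ * (e (Sum.inr a) ^ 2 * (∑ b, e (Sum.inl (a, b)) * x b) ^ 2) - 1))
    (by
      rw [Finset.disjoint_filter]
      rintro k - hk rfl
      exact ha hk) (by fun_prop) (by fun_prop)
    (fun e e' he => Finset.sum_congr rfl fun a ha => by
      have h1 : ∀ b, e (Sum.inl (a, b)) = e' (Sum.inl (a, b)) := fun b => he _ (by simpa using ha)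
      have h2 : e (Sum.inr a) = e' (Sum.inr a) := he _ (by simpa using ha)
      simp only [h1, h2])
    (fun e e' he => by
      have h1 : ∀ b, e (Sum.inl (a, b)) = e' (Sum.inl (a, b)) := fun b => he _ (by simp)
      have h2 : e (Sum.inr a) = e' (Sum.inr a) := he _ (by simp)
      simp only [h1, h2])
  exact this

lemma hasAllMoments_centred (h : IsLayer P μ p w z) (hμ : IsEntryLaw μ) (x : Fin N → ℝ)
    (a : Fin N') : HasAllMoments (fun ω => (N' : ℝ)⁻¹ * (summand p w z x a ω - 1)) P :=
  ((h.hasAllMoments_summand hμ x a).sub (HasAllMoments.const 1)).const_mul _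

lemma integral_centred (h : IsLayer P μ p w z) (hμ : IsEntryLaw μ)
    (hp : 0 < (p : ℝ)) {x : Fin N → ℝ} (hx : sumSq x = 1) (a : Fin N') :
    ∫ ω, (N' : ℝ)⁻¹ * (summand p w z x a ω - 1) ∂P = 0 := by
  rw [integral_const_mul, integral_sub (h.hasAllMoments_summand hμ x a).integrable
    (integrable_const 1), h.integral_summand hμ hp hx]
  simp

lemma abs_integral_centred_pow_le (h : IsLayer P μ p w z) (hμ : IsEntryLaw μ)
    (hm : ∀ j : ℕ, ∫ x, x ^ j ∂μ = m j) {p₀ : ℝ} (hp₀ : 0 < p₀) (hp : p₀ ≤ p)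
    {x : Fin N → ℝ} (hx : sumSq x = 1) (a : Fin N') (r : ℕ) :
    |∫ ω, ((N' : ℝ)⁻¹ * (summand p w z x a ω - 1)) ^ r ∂P| ≤
      summandConst m p₀ r * ((N' : ℝ)⁻¹) ^ r := by
  have hpp : 0 < (p : ℝ) := hp₀.trans_le hp
  rcases eq_or_ne r 0 with rfl | hr
  · have := rowConst_nonneg m 0
    simp [summandConst, this]
  simp_rw [mul_pow]
  rw [integral_const_mul, abs_mul, abs_of_nonneg (by positivity), mul_comm]
  gcongr
  have hU := h.hasAllMoments_summand hμ x a
  calc |∫ ω, (summand p w z x a ω - 1) ^ r ∂P|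
      ≤ ∫ ω, |(summand p w z x a ω - 1) ^ r| ∂P := abs_integral_le_integral_abs
    _ ≤ ∫ ω, 2 ^ r * (summand p w z x a ω ^ r + 1) ∂P := by
        refine integral_mono ((hU.sub (HasAllMoments.const 1)).pow r).integrable.abs
          (((hU.pow r).add (HasAllMoments.const 1)).const_mul _).integrable fun ω => ?_
        have h0 : 0 ≤ summand p w z x a ω := by unfold summand; positivity
        have h1 : |summand p w z x a ω - 1| ≤ 2 * max (summand p w z x a ω) 1 := by
          rw [abs_le]; constructor <;> rcases le_total (summand p w z x a ω) 1 with h | h <;>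
            simp [h] <;> linarith
        simp only
        rw [abs_pow]
        refine (pow_le_pow_left₀ (abs_nonneg _) h1 r).trans ?_
        rw [mul_pow]
        gcongr
        rcases le_total (summand p w z x a ω) 1 with h | h
        · simp [h]; positivity
        · simp [h]
    _ = 2 ^ r * (∫ ω, summand p w z x a ω ^ r ∂P + 1) := by
        rw [integral_const_mul, integral_add (hU.pow r).integrable (integrable_const 1)]
        simp
    _ ≤ summandConst m p₀ r := by
        rw [summandConst]
        gcongr
        exact h.integral_summand_pow_le hμ hm hp₀ hp hx a hr

lemma _root_.RandomMatrixProduct.summandConst_nonneg (m : ℕ → ℝ) {p₀ : ℝ} (hp₀ : 0 < p₀) (r : ℕ) :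
    0 ≤ summandConst m p₀ r := by
  have := rowConst_nonneg m r
  unfold summandConst; positivity

lemma _root_.RandomMatrixProduct.stepConst_nonneg (m : ℕ → ℝ) {p₀ : ℝ} (hp₀ : 0 < p₀) (r : ℕ) :
    0 ≤ stepConst m p₀ r :=
  add_nonneg (momentConst_nonneg (summandConst_nonneg m hp₀) r) (summandConst_nonneg m hp₀ r)

/-- On unit vectors, a layer preserves the mean of the squared norm. -/
lemma integral_sumSq_sub_one (h : IsLayer P μ p w z) (hμ : IsEntryLaw μ) (hN : 0 < N')
    (hp : 0 < (p : ℝ)) {x : Fin N → ℝ} (hx : sumSq x = 1) :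
    ∫ ω, (sumSq (layerStep p (w ω) (z ω) x) - 1) ∂P = 0 := by
  simp_rw [sumSq_layerStep_sub_one hN hp]
  exact integral_sum_eq_zero (h.hasAllMoments_centred hμ x) (h.integral_centred hμ hp hx) _

/-- On unit vectors, the exact variance of the squared norm of the output of a layer. -/
lemma integral_sumSq_sub_one_sq (h : IsLayer P μ p w z) (hμ : IsEntryLaw μ)
    (hm : ∀ j : ℕ, ∫ x, x ^ j ∂μ = m j) (hN : 0 < N')
    (hp : 0 < (p : ℝ)) {x : Fin N → ℝ} (hx : sumSq x = 1) :
    ∫ ω, (sumSq (layerStep p (w ω) (z ω) x) - 1) ^ 2 ∂P =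
      ((3 / p - 1) + (m 4 - 3) / p * sumFourth x) / N' := by
  have hN' : (N' : ℝ) ≠ 0 := by positivity
  simp_rw [sumSq_layerStep_sub_one hN hp]
  rw [integral_sum_pow_two (h.hasAllMoments_centred hμ x) (h.indepOfSums_summand x)
    (h.integral_centred hμ hp hx)]
  have : ∀ a, ∫ ω, ((N' : ℝ)⁻¹ * (summand p w z x a ω - 1)) ^ 2 ∂P =
      ((N' : ℝ)⁻¹) ^ 2 * ((3 + (m 4 - 3) * sumFourth x) / p - 1) := fun a => by
    have hU := h.hasAllMoments_summand hμ x a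
    have e : ∀ ω, ((N' : ℝ)⁻¹ * (summand p w z x a ω - 1)) ^ 2 =
      ((N' : ℝ)⁻¹) ^ 2 * (summand p w z x a ω ^ 2 - (2 * summand p w z x a ω - 1)) :=
      fun ω => by ring
    simp_rw [e]
    rw [integral_const_mul, integral_sub (hU.pow 2).integrable
      ((hU.const_mul 2).sub (HasAllMoments.const 1)).integrable,
      integral_sub (hU.const_mul 2).integrable (integrable_const 1), integral_const_mul,
      h.integral_summand hμ hp hx, h.integral_summand_sq hμ hm hp hx]
    simp only [integral_const, probReal_univ, one_smul]
    ring
  simp_rw [this]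
  simp only [Finset.sum_const, Finset.card_univ, Fintype.card_fin, nsmul_eq_mul]
  field_simp
  ring

lemma abs_integral_sumSq_pow_le (h : IsLayer P μ p w z) (hμ : IsEntryLaw μ)
    (hm : ∀ j : ℕ, ∫ x, x ^ j ∂μ = m j) (hN : 0 < N') {p₀ : ℝ} (hp₀ : 0 < p₀) (hp : p₀ ≤ p)
    {x : Fin N → ℝ} (hx : sumSq x = 1) (r : ℕ) :
    |∫ ω, (sumSq (layerStep p (w ω) (z ω) x) - 1) ^ r ∂P| ≤
      momentConst (summandConst m p₀) r * Real.sqrt ((N' : ℝ)⁻¹) ^ r := by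
  have hpp : 0 < (p : ℝ) := hp₀.trans_le hp
  have hN' : (N' : ℝ) ≠ 0 := by positivity
  simp_rw [sumSq_layerStep_sub_one hN hpp]
  have := abs_integral_sum_pow_le (summandConst_nonneg m hp₀) (c := fun _ : Fin N' => (N' : ℝ)⁻¹)
    (fun _ => by positivity) (h.hasAllMoments_centred hμ x) (h.indepOfSums_summand x)
    (h.integral_centred hμ hpp hx) (h.abs_integral_centred_pow_le hμ hm hp₀ hp hx) Finset.univ r
  have e : ∑ _a : Fin N', ((N' : ℝ)⁻¹) ^ 2 = (N' : ℝ)⁻¹ := by simp; field_simp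
  rwa [e] at this

/-- On unit vectors, the centred moments of order at least three of the squared norm of the output
are of second order in the inverse width. For the third moment this uses that third
centred moments of independent variables add up. -/
lemma abs_integral_sumSq_pow_le_div (h : IsLayer P μ p w z) (hμ : IsEntryLaw μ)
    (hm : ∀ j : ℕ, ∫ x, x ^ j ∂μ = m j) (hN : 0 < N') {p₀ : ℝ} (hp₀ : 0 < p₀) (hp : p₀ ≤ p)
    {x : Fin N → ℝ} (hx : sumSq x = 1) {r : ℕ} (hr : 3 ≤ r) :
    |∫ ω, (sumSq (layerStep p (w ω) (z ω) x) - 1) ^ r ∂P| ≤ stepConst m p₀ r / (N' : ℝ) ^ 2 := by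
  have hpp : 0 < (p : ℝ) := hp₀.trans_le hp
  have hN' : (0 : ℝ) < N' := by positivity
  have hN1 : (1 : ℝ) ≤ N' := by exact_mod_cast hN
  have n1 := momentConst_nonneg (summandConst_nonneg m hp₀) r
  have n2 := summandConst_nonneg m hp₀ r
  rcases hr.eq_or_lt with rfl | hr
  · simp_rw [sumSq_layerStep_sub_one hN hpp]
    rw [integral_sum_pow_three (h.hasAllMoments_centred hμ x) (h.indepOfSums_summand x)
      (h.integral_centred hμ hpp hx)]
    calc _ ≤ ∑ a : Fin N', summandConst m p₀ 3 * ((N' : ℝ)⁻¹) ^ 3 :=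
          (Finset.abs_sum_le_sum_abs _ _).trans (Finset.sum_le_sum fun a _ =>
            h.abs_integral_centred_pow_le hμ hm hp₀ hp hx a 3)
      _ = summandConst m p₀ 3 / (N' : ℝ) ^ 2 := by simp; field_simp
      _ ≤ _ := by
          rw [stepConst]; gcongr; linarith
  · refine (h.abs_integral_sumSq_pow_le hμ hm hN hp₀ hp hx r).trans ?_
    have hs : Real.sqrt ((N' : ℝ)⁻¹) ^ r ≤ ((N' : ℝ) ^ 2)⁻¹ := by
      have h1 : Real.sqrt ((N' : ℝ)⁻¹) ≤ 1 := by
        rw [Real.sqrt_le_one]; exact inv_le_one_of_one_le₀ hN1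
      calc Real.sqrt ((N' : ℝ)⁻¹) ^ r ≤ Real.sqrt ((N' : ℝ)⁻¹) ^ 4 :=
            pow_le_pow_of_le_one (Real.sqrt_nonneg _) h1 hr
        _ = (Real.sqrt ((N' : ℝ)⁻¹) ^ 2) ^ 2 := by ring
        _ = _ := by rw [Real.sq_sqrt (by positivity), inv_pow]
    rw [div_eq_mul_inv, stepConst]
    gcongr
    linarith

end IsLayer

end Layer

/-! ### Powers of the squared norm after one layer -/

section LayerPowers

variable {Ω : Type*} [MeasurableSpace Ω] {P : Measure Ω}
variable {N' N : ℕ} {μ : Measure ℝ} {p : unitInterval}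
  {w : Ω → Fin N' → Fin N → ℝ} {z : Ω → Fin N' → ℝ} {m : ℕ → ℝ}

/-- The constant in the second order expansion of the `k`-th moment of one layer. -/
noncomputable def powerConst (m : ℕ → ℝ) (p₀ : ℝ) (k : ℕ) : ℝ :=
  ∑ j ∈ Finset.range (k + 1), (k.choose j : ℝ) * stepConst m p₀ j

lemma powerConst_nonneg (m : ℕ → ℝ) {p₀ : ℝ} (hp₀ : 0 < p₀) (k : ℕ) : 0 ≤ powerConst m p₀ k :=
  Finset.sum_nonneg fun j _ => mul_nonneg (by positivity) (stepConst_nonneg m hp₀ j)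

/-- The constant bounding the mixed moments of the squared norm and of the `ℓ⁴` norm. -/
noncomputable def mixedConst (m : ℕ → ℝ) (p₀ : ℝ) (k : ℕ) : ℝ :=
  2 ^ (2 * k) * (1 + momentConst (summandConst m p₀) (2 * k)) + (p₀⁻¹) ^ 4 * rowConst m 4

lemma mixedConst_nonneg (m : ℕ → ℝ) {p₀ : ℝ} (hp₀ : 0 < p₀) (k : ℕ) : 0 ≤ mixedConst m p₀ k := by
  have := momentConst_nonneg (summandConst_nonneg m hp₀) (2 * k)
  have := rowConst_nonneg m 4
  unfold mixedConst; positivity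

namespace IsLayer

variable [IsProbabilityMeasure P]

lemma abs_integral_sumSq_pow_sub_le_of_unit (h : IsLayer P μ p w z) (hμ : IsEntryLaw μ)
    (hm : ∀ j : ℕ, ∫ x, x ^ j ∂μ = m j) (hN : 0 < N') {p₀ : ℝ} (hp₀ : 0 < p₀) (hp : p₀ ≤ p)
    {x : Fin N → ℝ} (hx : sumSq x = 1) (k : ℕ) :
    |∫ ω, sumSq (layerStep p (w ω) (z ω) x) ^ k ∂P -
      (1 + k.choose 2 * (((3 / p - 1) + (m 4 - 3) / p * sumFourth x) / N'))| ≤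
      powerConst m p₀ k / (N' : ℝ) ^ 2 := by
  have hpp : 0 < (p : ℝ) := hp₀.trans_le hp
  have hT : HasAllMoments (fun ω => sumSq (layerStep p (w ω) (z ω) x) - 1) P :=
    (h.hasAllMoments_sumSq hμ x).sub (HasAllMoments.const 1)
  set t : ℕ → ℝ := fun j => ∫ ω, (sumSq (layerStep p (w ω) (z ω) x) - 1) ^ j ∂P with ht
  have t0 : t 0 = 1 := by simp [ht]
  have t1 : t 1 = 0 := by simpa [ht] using h.integral_sumSq_sub_one hμ hN hpp hx
  have t2 : t 2 = ((3 / p - 1) + (m 4 - 3) / p * sumFourth x) / N' :=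
    h.integral_sumSq_sub_one_sq hμ hm hN hpp hx
  have hexp : ∫ ω, sumSq (layerStep p (w ω) (z ω) x) ^ k ∂P =
      ∑ j ∈ Finset.range (k + 1), t j * (k.choose j : ℝ) := by
    have e : ∀ ω, sumSq (layerStep p (w ω) (z ω) x) ^ k = ∑ j ∈ Finset.range (k + 1),
        (sumSq (layerStep p (w ω) (z ω) x) - 1) ^ j * (k.choose j : ℝ) := fun ω => by
      have := add_pow (sumSq (layerStep p (w ω) (z ω) x) - 1) 1 k
      simpa using this
    simp_rw [e]
    rw [integral_finsetSum _ fun j _ => ((hT.pow j).integrable.mul_const _)]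
    simp_rw [integral_mul_const, ht]
  have hmain : (1 + k.choose 2 * t 2) =
      ∑ j ∈ Finset.range (k + 1), (if j ≤ 2 then t j else 0) * (k.choose j : ℝ) := by
    have h3 : ∑ j ∈ Finset.range (k + 1), (if j ≤ 2 then t j else 0) * (k.choose j : ℝ) =
        ∑ j ∈ Finset.range (k + 1 + 3), (if j ≤ 2 then t j else 0) * (k.choose j : ℝ) := by
      refine Finset.sum_subset (Finset.range_mono (by omega)) fun j _ hj => ?_
      rw [Nat.choose_eq_zero_of_lt (by simpa using hj)]; simp
    rw [h3, add_comm (k + 1) 3, Finset.sum_range_add]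
    have h4 : ∀ j, ¬ 3 + j ≤ 2 := by omega
    simp [Finset.sum_range_succ, t0, t1, h4, mul_comm]
  rw [← t2, hexp, hmain, ← Finset.sum_sub_distrib, powerConst, Finset.sum_div]
  refine (Finset.abs_sum_le_sum_abs _ _).trans (Finset.sum_le_sum fun j _ => ?_)
  have hs := stepConst_nonneg m hp₀ j
  split_ifs with hj
  · simp only [sub_self, abs_zero]; positivity
  · rw [zero_mul, sub_zero, abs_mul, Nat.abs_cast, mul_comm, mul_div_assoc]
    gcongr
    exact h.abs_integral_sumSq_pow_le_div hμ hm hN hp₀ hp hx (by omega)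

/-- Bernoulli's inequality together with the mean one of the squared norm. -/
lemma one_le_integral_sumSq_pow_of_unit (h : IsLayer P μ p w z) (hμ : IsEntryLaw μ) (hN : 0 < N')
    (hp : 0 < (p : ℝ)) {x : Fin N → ℝ} (hx : sumSq x = 1) (k : ℕ) :
    1 ≤ ∫ ω, sumSq (layerStep p (w ω) (z ω) x) ^ k ∂P := by
  have hT : HasAllMoments (fun ω => sumSq (layerStep p (w ω) (z ω) x) - 1) P :=
    (h.hasAllMoments_sumSq hμ x).sub (HasAllMoments.const 1)
  calc (1 : ℝ) = ∫ ω, 1 + (k : ℝ) * (sumSq (layerStep p (w ω) (z ω) x) - 1) ∂P := by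
        rw [integral_add (integrable_const 1) (hT.const_mul _).integrable, integral_const_mul,
          h.integral_sumSq_sub_one hμ hN hp hx]
        simp
    _ ≤ _ := by
        refine integral_mono ((HasAllMoments.const 1).add (hT.const_mul _)).integrable
          ((h.hasAllMoments_sumSq hμ x).pow k).integrable fun ω => ?_
        have h0 := sumSq_nonneg (layerStep p (w ω) (z ω) x)
        have := one_add_mul_le_pow (a := sumSq (layerStep p (w ω) (z ω) x) - 1) (by linarith) k
        simpa using this

lemma integral_sumFourth_sq_le_of_unit (h : IsLayer P μ p w z) (hμ : IsEntryLaw μ)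
    (hm : ∀ j : ℕ, ∫ x, x ^ j ∂μ = m j) (hN : 0 < N') {p₀ : ℝ} (hp₀ : 0 < p₀) (hp : p₀ ≤ p)
    {x : Fin N → ℝ} (hx : sumSq x = 1) :
    ∫ ω, sumFourth (layerStep p (w ω) (z ω) x) ^ 2 ∂P ≤
      (p₀⁻¹) ^ 4 * rowConst m 4 / (N' : ℝ) ^ 2 := by
  have hpp : 0 < (p : ℝ) := hp₀.trans_le hp
  have hN' : (N' : ℝ) ≠ 0 := by positivity
  have hU := h.hasAllMoments_summand hμ x
  calc ∫ ω, sumFourth (layerStep p (w ω) (z ω) x) ^ 2 ∂P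
      ≤ ∫ ω, ((N' : ℝ)⁻¹) ^ 3 * ∑ a, summand p w z x a ω ^ 4 ∂P := by
        refine integral_mono ((h.hasAllMoments_sumFourth hμ x).pow 2).integrable
          ((HasAllMoments.sum _ fun a _ => (hU a).pow 4).const_mul _).integrable fun ω => ?_
        simp only
        rw [sumFourth_layerStep hpp, mul_pow]
        have := sq_sum_le_card_mul_sum_sq (s := Finset.univ)
          (f := fun a => summand p w z x a ω ^ 2)
        simp only [Finset.card_univ, Fintype.card_fin, ← pow_mul] at this
        calc _ ≤ (((N' : ℝ)⁻¹) ^ 2) ^ 2 * (N' * ∑ a, summand p w z x a ω ^ (2 * 2)) := by gcongr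
          _ = _ := by norm_num; field_simp
    _ = ((N' : ℝ)⁻¹) ^ 3 * ∑ a, ∫ ω, summand p w z x a ω ^ 4 ∂P := by
        rw [integral_const_mul, integral_finsetSum _ fun a _ => ((hU a).pow 4).integrable]
    _ ≤ ((N' : ℝ)⁻¹) ^ 3 * ∑ a : Fin N', (p₀⁻¹) ^ 4 * rowConst m 4 := by
        gcongr with a
        exact h.integral_summand_pow_le hμ hm hp₀ hp hx a (by norm_num)
    _ = _ := by simp; field_simp

/-- The output of a layer is spread out: its `ℓ⁴` norm is small. -/
lemma integral_sumFourth_le_of_unit (h : IsLayer P μ p w z) (hμ : IsEntryLaw μ)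
    (hm : ∀ j : ℕ, ∫ x, x ^ j ∂μ = m j) (hN : 0 < N') {p₀ : ℝ} (hp₀ : 0 < p₀) (hp : p₀ ≤ p)
    {x : Fin N → ℝ} (hx : sumSq x = 1) :
    ∫ ω, sumFourth (layerStep p (w ω) (z ω) x) ∂P ≤ (p₀⁻¹) ^ 2 * rowConst m 2 / N' := by
  have hpp : 0 < (p : ℝ) := hp₀.trans_le hp
  have hN' : (N' : ℝ) ≠ 0 := by positivity
  have hU := h.hasAllMoments_summand hμ x
  simp_rw [sumFourth_layerStep hpp]
  rw [integral_const_mul, integral_finsetSum _ fun a _ => ((hU a).pow 2).integrable]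
  calc _ ≤ ((N' : ℝ)⁻¹) ^ 2 * ∑ a : Fin N', (p₀⁻¹) ^ 2 * rowConst m 2 := by
        gcongr with a
        exact h.integral_summand_pow_le hμ hm hp₀ hp hx a (by norm_num)
    _ = _ := by simp; field_simp

lemma integral_sumSq_pow_mul_sumFourth_le_of_unit (h : IsLayer P μ p w z) (hμ : IsEntryLaw μ)
    (hm : ∀ j : ℕ, ∫ x, x ^ j ∂μ = m j) (hN : 0 < N') {p₀ : ℝ} (hp₀ : 0 < p₀) (hp : p₀ ≤ p)
    {x : Fin N → ℝ} (hx : sumSq x = 1) (k : ℕ) :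
    ∫ ω, sumSq (layerStep p (w ω) (z ω) x) ^ k * sumFourth (layerStep p (w ω) (z ω) x) ∂P ≤
      mixedConst m p₀ k / N' := by
  have hpp : 0 < (p : ℝ) := hp₀.trans_le hp
  have hN' : (0 : ℝ) < N' := by positivity
  have hN1 : (1 : ℝ) ≤ N' := by exact_mod_cast hN
  have hS := h.hasAllMoments_sumSq hμ x
  have hF := h.hasAllMoments_sumFourth hμ x
  have hT : HasAllMoments (fun ω => sumSq (layerStep p (w ω) (z ω) x) - 1) P :=
    hS.sub (HasAllMoments.const 1)
  have h1 : ∫ ω, sumSq (layerStep p (w ω) (z ω) x) ^ (2 * k) ∂P ≤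
      2 ^ (2 * k) * (1 + momentConst (summandConst m p₀) (2 * k)) := by
    calc _ ≤ ∫ ω, 2 ^ (2 * k) * (1 + (sumSq (layerStep p (w ω) (z ω) x) - 1) ^ (2 * k)) ∂P := by
          refine integral_mono (hS.pow _).integrable
            (((HasAllMoments.const 1).add (hT.pow (2 * k))).const_mul _).integrable fun ω => ?_
          simp only
          set s := sumSq (layerStep p (w ω) (z ω) x)
          have hs : 0 ≤ s := sumSq_nonneg _
          have he : 0 ≤ (s - 1) ^ (2 * k) := by rw [pow_mul]; positivity
          rcases le_total s 2 with h2 | h2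
          · calc s ^ (2 * k) ≤ 2 ^ (2 * k) := pow_le_pow_left₀ hs h2 _
              _ ≤ _ := le_mul_of_one_le_right (by positivity) (by linarith)
          · calc s ^ (2 * k) ≤ (2 * (s - 1)) ^ (2 * k) := pow_le_pow_left₀ hs (by linarith) _
              _ = 2 ^ (2 * k) * (s - 1) ^ (2 * k) := mul_pow _ _ _
              _ ≤ _ := by gcongr; linarith
      _ = 2 ^ (2 * k) * (1 + ∫ ω, (sumSq (layerStep p (w ω) (z ω) x) - 1) ^ (2 * k) ∂P) := by
          rw [integral_const_mul, integral_add (integrable_const 1) (hT.pow _).integrable]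
          simp
      _ ≤ _ := by
          gcongr
          refine ((le_abs_self _).trans (h.abs_integral_sumSq_pow_le hμ hm hN hp₀ hp hx _)).trans ?_
          refine mul_le_of_le_one_right (momentConst_nonneg (summandConst_nonneg m hp₀) _) ?_
          refine pow_le_one₀ (Real.sqrt_nonneg _) ?_
          rw [Real.sqrt_le_one]
          exact inv_le_one_of_one_le₀ hN1
  have h2 := h.integral_sumFourth_sq_le_of_unit hμ hm hN hp₀ hp hx
  -- The inequality of arithmetic and geometric means, weighted so that both terms are of order
  -- `1 / N'`.
  calc _ ≤ ∫ ω, (N' : ℝ)⁻¹ * sumSq (layerStep p (w ω) (z ω) x) ^ (2 * k) +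
        N' * sumFourth (layerStep p (w ω) (z ω) x) ^ 2 ∂P := by
        refine integral_mono ((hS.pow k).mul hF).integrable
          (((hS.pow (2 * k)).const_mul _).add ((hF.pow 2).const_mul _)).integrable fun ω => ?_
        simp only
        set s := sumSq (layerStep p (w ω) (z ω) x) ^ k with hs
        set f := sumFourth (layerStep p (w ω) (z ω) x)
        have e : sumSq (layerStep p (w ω) (z ω) x) ^ (2 * k) = s ^ 2 := by rw [hs]; ring
        rw [e, ← sub_nonneg]
        have : (N' : ℝ)⁻¹ * s ^ 2 + N' * f ^ 2 - s * f =
            (N' : ℝ)⁻¹ * ((s - N' * f / 2) ^ 2 + 3 / 4 * (N' * f) ^ 2) := by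
          field_simp; ring
        rw [this]; positivity
    _ = (N' : ℝ)⁻¹ * ∫ ω, sumSq (layerStep p (w ω) (z ω) x) ^ (2 * k) ∂P +
        N' * ∫ ω, sumFourth (layerStep p (w ω) (z ω) x) ^ 2 ∂P := by
        rw [integral_add ((hS.pow _).const_mul _).integrable ((hF.pow _).const_mul _).integrable,
          integral_const_mul, integral_const_mul]
    _ ≤ (N' : ℝ)⁻¹ * (2 ^ (2 * k) * (1 + momentConst (summandConst m p₀) (2 * k))) +
        N' * ((p₀⁻¹) ^ 4 * rowConst m 4 / (N' : ℝ) ^ 2) := by gcongr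
    _ = _ := by rw [mixedConst]; field_simp

/-- Reduction of homogeneous statements about one layer to unit vectors. -/
lemma _root_.RandomMatrixProduct.exists_unit_smul {x : Fin N → ℝ} (hx : x ≠ 0) :
    ∃ (c : ℝ) (y : Fin N → ℝ), 0 < c ∧ sumSq y = 1 ∧ x = c • y := by
  have hq : 0 < sumSq x := lt_of_le_of_ne (sumSq_nonneg x) fun h0 => hx (eq_zero_of_sumSq h0.symm)
  have hs : 0 < Real.sqrt (sumSq x) := Real.sqrt_pos.2 hq
  refine ⟨Real.sqrt (sumSq x), (Real.sqrt (sumSq x))⁻¹ • x, hs, ?_, ?_⟩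
  · rw [sumSq_smul, inv_pow, Real.sq_sqrt hq.le, inv_mul_cancel₀ hq.ne']
  · rw [smul_smul, mul_inv_cancel₀ hs.ne', one_smul]

lemma _root_.RandomMatrixProduct.layerStep_zero (w : Fin N' → Fin N → ℝ) (z : Fin N' → ℝ) :
    layerStep p w z 0 = 0 := by
  funext a; simp [layerStep]

lemma _root_.RandomMatrixProduct.sumSq_zero : sumSq (0 : Fin N → ℝ) = 0 := by simp [sumSq]

lemma _root_.RandomMatrixProduct.sumFourth_zero : sumFourth (0 : Fin N → ℝ) = 0 := by
  simp [sumFourth]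

/-- The second order expansion of the moments of the squared norm of the output of a layer. -/
lemma abs_integral_sumSq_pow_sub_le (h : IsLayer P μ p w z) (hμ : IsEntryLaw μ)
    (hm : ∀ j : ℕ, ∫ x, x ^ j ∂μ = m j) (hN : 0 < N') {p₀ : ℝ} (hp₀ : 0 < p₀) (hp : p₀ ≤ p)
    (x : Fin N → ℝ) (k : ℕ) :
    |∫ ω, sumSq (layerStep p (w ω) (z ω) x) ^ (k + 2) ∂P -
      (sumSq x ^ (k + 2) + (k + 2).choose 2 * (((3 / p - 1) * sumSq x ^ (k + 2) +
        (m 4 - 3) / p * (sumSq x ^ k * sumFourth x)) / N'))| ≤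
      powerConst m p₀ (k + 2) / (N' : ℝ) ^ 2 * sumSq x ^ (k + 2) := by
  rcases eq_or_ne x 0 with rfl | hx
  · simp [layerStep_zero, sumSq_zero, sumFourth_zero]
  obtain ⟨c, y, hc, hy, rfl⟩ := exists_unit_smul hx
  have := h.abs_integral_sumSq_pow_sub_le_of_unit hμ hm hN hp₀ hp hy (k + 2)
  simp_rw [layerStep_smul, sumSq_smul, sumFourth_smul, mul_pow, hy, one_pow, mul_one]
  rw [integral_const_mul]
  have e : (c ^ 2) ^ (k + 2) * ∫ ω, sumSq (layerStep p (w ω) (z ω) y) ^ (k + 2) ∂P -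
      ((c ^ 2) ^ (k + 2) + (k + 2).choose 2 * (((3 / p - 1) * (c ^ 2) ^ (k + 2) +
        (m 4 - 3) / p * ((c ^ 2) ^ k * (c ^ 4 * sumFourth y))) / N')) =
      (c ^ 2) ^ (k + 2) * (∫ ω, sumSq (layerStep p (w ω) (z ω) y) ^ (k + 2) ∂P -
      (1 + (k + 2).choose 2 * (((3 / p - 1) + (m 4 - 3) / p * sumFourth y) / N'))) := by ring
  rw [e, abs_mul, abs_of_nonneg (by positivity), mul_comm]
  gcongr

lemma sumSq_pow_le_integral (h : IsLayer P μ p w z) (hμ : IsEntryLaw μ) (hN : 0 < N')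
    (hp : 0 < (p : ℝ)) (x : Fin N → ℝ) (k : ℕ) :
    sumSq x ^ k ≤ ∫ ω, sumSq (layerStep p (w ω) (z ω) x) ^ k ∂P := by
  rcases eq_or_ne x 0 with rfl | hx
  · simp [layerStep_zero, sumSq_zero]
  obtain ⟨c, y, hc, hy, rfl⟩ := exists_unit_smul hx
  simp_rw [layerStep_smul, sumSq_smul, mul_pow, hy, one_pow, mul_one]
  rw [integral_const_mul]
  exact le_mul_of_one_le_right (by positivity)
    (h.one_le_integral_sumSq_pow_of_unit hμ hN hp hy k)

lemma integral_sumSq_pow_mul_sumFourth_le (h : IsLayer P μ p w z) (hμ : IsEntryLaw μ)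
    (hm : ∀ j : ℕ, ∫ x, x ^ j ∂μ = m j) (hN : 0 < N') {p₀ : ℝ} (hp₀ : 0 < p₀) (hp : p₀ ≤ p)
    (x : Fin N → ℝ) (k : ℕ) :
    ∫ ω, sumSq (layerStep p (w ω) (z ω) x) ^ k * sumFourth (layerStep p (w ω) (z ω) x) ∂P ≤
      mixedConst m p₀ k / N' * sumSq x ^ (k + 2) := by
  rcases eq_or_ne x 0 with rfl | hx
  · simp [layerStep_zero, sumSq_zero, sumFourth_zero]
  obtain ⟨c, y, hc, hy, rfl⟩ := exists_unit_smul hx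
  have := h.integral_sumSq_pow_mul_sumFourth_le_of_unit hμ hm hN hp₀ hp hy k
  simp_rw [layerStep_smul, sumSq_smul, sumFourth_smul, mul_pow, hy, one_pow, mul_one]
  have e : ∀ ω, (c ^ 2) ^ k * sumSq (layerStep p (w ω) (z ω) y) ^ k *
      (c ^ 4 * sumFourth (layerStep p (w ω) (z ω) y)) = (c ^ 2) ^ (k + 2) *
      (sumSq (layerStep p (w ω) (z ω) y) ^ k * sumFourth (layerStep p (w ω) (z ω) y)) :=
    fun ω => by ring
  simp_rw [e]
  rw [integral_const_mul, mul_comm]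
  gcongr

end IsLayer

end LayerPowers

/-! ### The sequence of images of the vector as a Markov chain -/

section Chain

variable {Ω : Type*} {n : ℕ → ℕ} {d : ℕ} {p : unitInterval}
  {W : (i : ℕ) → Ω → Matrix (Fin (n (i + 1))) (Fin (n i)) ℝ}
  {ξ : (i : ℕ) → Ω → Fin (n (i + 1)) → ℝ}

/-- The images of `u` under the first layers, normalised such that the expected squared norm does
not change: `state i` is `(n 0 / n i) ^ (1/2)` times the product of the first `i` layers applied to
`u`. Each layer is therefore normalised by its output dimension. -/
noncomputable def state (p : unitInterval) (n : ℕ → ℕ)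
    (W : (i : ℕ) → Ω → Matrix (Fin (n (i + 1))) (Fin (n i)) ℝ)
    (ξ : (i : ℕ) → Ω → Fin (n (i + 1)) → ℝ) (u : Fin (n 0) → ℝ) :
    (i : ℕ) → Ω → Fin (n i) → ℝ
  | 0, _ => u
  | i + 1, ω => layerStep p (fun a b => W i ω a b) (ξ i ω) (state p n W ξ u i ω)

lemma mulVec_matrixProduct (hp : 0 < (p : ℝ)) (hn : ∀ i ≤ d, 0 < n i) (u : Fin (n 0) → ℝ) (ω : Ω) :
    (matrixProduct p n W ξ d ω).mulVec u =
      Real.sqrt ((n d : ℝ) / n 0) • state p n W ξ u d ω := by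
  induction d with
  | zero =>
    have h0 : (n 0 : ℝ) ≠ 0 := by have := hn 0 le_rfl; positivity
    simp [matrixProduct, state, h0]
  | succ d ih =>
    have h0 : (0 : ℝ) < n 0 := by have := hn 0 (by omega); positivity
    have h1 : (0 : ℝ) < n d := by have := hn d (by omega); positivity
    have h2 : (0 : ℝ) < n (d + 1) := by have := hn (d + 1) le_rfl; positivity
    rw [matrixProduct, ← Matrix.mulVec_mulVec, ih fun i hi => hn i (by omega)]
    funext a
    simp only [layer, Matrix.smul_mulVec, Matrix.mulVec_smul, ← Matrix.mulVec_mulVec,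
      Pi.smul_apply, smul_eq_mul, Matrix.mulVec_diagonal, state, layerStep]
    have e : Real.sqrt ((n d : ℝ) / n 0) * (Real.sqrt ((p : ℝ) * n d))⁻¹ =
        Real.sqrt ((n (d + 1) : ℝ) / n 0) * (Real.sqrt ((p : ℝ) * n (d + 1)))⁻¹ := by
      rw [Real.sqrt_div h1.le, Real.sqrt_div h2.le, Real.sqrt_mul hp.le, Real.sqrt_mul hp.le]
      have := Real.sqrt_pos.2 h1
      have := Real.sqrt_pos.2 h2
      field_simp
    rw [← mul_assoc, ← mul_assoc, e]
    simp only [mul_assoc]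
    rfl

lemma normSq_eq_sumSq_state (hp : 0 < (p : ℝ)) (hn : ∀ i ≤ d, 0 < n i)
    (u : EuclideanSpace ℝ (Fin (n 0))) (ω : Ω) :
    normSq p n d W ξ u ω = sumSq (state p n W ξ u.ofLp d ω) := by
  have h0 : (0 : ℝ) < n 0 := by have := hn 0 (by omega); positivity
  have h1 : (0 : ℝ) < n d := by have := hn d le_rfl; positivity
  rw [normSq, mulVec_matrixProduct hp hn, EuclideanSpace.norm_sq_eq]
  have : ∑ i, ‖(WithLp.toLp 2 (Real.sqrt ((n d : ℝ) / n 0) • state p n W ξ u.ofLp d ω) :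
      EuclideanSpace ℝ (Fin (n d))) i‖ ^ 2 =
      sumSq (Real.sqrt ((n d : ℝ) / n 0) • state p n W ξ u.ofLp d ω) := by
    simp only [Real.norm_eq_abs, sq_abs]; rfl
  rw [this, sumSq_smul, Real.sq_sqrt (by positivity)]
  field_simp

lemma state_congr {Ω' : Type*} {W' : (i : ℕ) → Ω' → Matrix (Fin (n (i + 1))) (Fin (n i)) ℝ}
    {ξ' : (i : ℕ) → Ω' → Fin (n (i + 1)) → ℝ} (u : Fin (n 0) → ℝ) {ω : Ω} {ω' : Ω'} (i : ℕ)
    (hW : ∀ j < i, W j ω = W' j ω') (hξ : ∀ j < i, ξ j ω = ξ' j ω') :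
    state p n W ξ u i ω = state p n W' ξ' u i ω' := by
  induction i with
  | zero => rfl
  | succ i ih =>
    rw [state, state, ih (fun j hj => hW j (by omega)) (fun j hj => hξ j (by omega)),
      hW i (by omega), hξ i (by omega)]

/-- The weight matrices as functions on the space of all entries, zero beyond the first `d`
layers. -/
def canonicalWeight (n : ℕ → ℕ) (d : ℕ) (i : ℕ) (e : EntryIndex n d → ℝ) :
    Matrix (Fin (n (i + 1))) (Fin (n i)) ℝ :=
  fun a b => if h : i < d then e ⟨⟨i, h⟩, Sum.inl (a, b)⟩ else 0

/-- The Bernoulli variables as functions on the space of all entries, zero beyond the first `d`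
layers. -/
def canonicalBernoulli (n : ℕ → ℕ) (d : ℕ) (i : ℕ) (e : EntryIndex n d → ℝ) :
    Fin (n (i + 1)) → ℝ :=
  fun a => if h : i < d then e ⟨⟨i, h⟩, Sum.inr a⟩ else 0

lemma measurable_layerStep {N' N : ℕ} :
    Measurable fun q : ((Fin N' → Fin N → ℝ) × (Fin N' → ℝ)) × (Fin N → ℝ) =>
      layerStep p q.1.1 q.1.2 q.2 := by
  unfold layerStep
  fun_prop

lemma measurable_canonicalWeight (i : ℕ) :
    Measurable fun (e : EntryIndex n d → ℝ) (a : Fin (n (i + 1))) (b : Fin (n i)) =>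
      canonicalWeight n d i e a b := by
  unfold canonicalWeight
  by_cases h : i < d
  · simp only [h, dite_true]; fun_prop
  · simp only [h, dite_false]; fun_prop

lemma measurable_canonicalBernoulli (i : ℕ) :
    Measurable (canonicalBernoulli n d i) := by
  unfold canonicalBernoulli
  by_cases h : i < d
  · simp only [h, dite_true]; fun_prop
  · simp only [h, dite_false]; fun_prop

lemma measurable_canonicalState (u : Fin (n 0) → ℝ) (i : ℕ) :
    Measurable (state p n (canonicalWeight n d) (canonicalBernoulli n d) u i) := by
  induction i with
  | zero => exact measurable_const
  | succ i ih =>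
    exact measurable_layerStep.comp
      (((measurable_canonicalWeight i).prodMk (measurable_canonicalBernoulli i)).prodMk ih)

lemma canonicalWeight_entries {i : ℕ} (hi : i < d) (ω : Ω) :
    canonicalWeight n d i (fun k => entries n d W ξ k ω) = W i ω := by
  funext a b; simp [canonicalWeight, hi, entries]

lemma canonicalBernoulli_entries {i : ℕ} (hi : i < d) (ω : Ω) :
    canonicalBernoulli n d i (fun k => entries n d W ξ k ω) = ξ i ω := by
  funext a; simp [canonicalBernoulli, hi, entries]

lemma canonicalState_entries (u : Fin (n 0) → ℝ) {i : ℕ} (hi : i ≤ d) (ω : Ω) :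
    state p n (canonicalWeight n d) (canonicalBernoulli n d) u i
      (fun k => entries n d W ξ k ω) = state p n W ξ u i ω :=
  state_congr u i (fun _ hj => canonicalWeight_entries (hj.trans_le hi) ω)
    (fun _ hj => canonicalBernoulli_entries (hj.trans_le hi) ω)

namespace IsModel

variable [MeasurableSpace Ω] {P : Measure Ω} {μ : Measure ℝ} {m : ℕ → ℝ}

lemma aemeasurable_entries (h : IsModel P μ p n d W ξ) (k : EntryIndex n d) :
    AEMeasurable (entries n d W ξ k) P := by
  rcases k with ⟨i, ⟨a, b⟩ | a⟩
  · exact (h.hasLaw_entry i i.2 a b).aemeasurable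
  · exact (h.hasLaw_bernoulli i i.2 a).aemeasurable

lemma aemeasurable_state (h : IsModel P μ p n d W ξ) (u : Fin (n 0) → ℝ) {i : ℕ} (hi : i ≤ d) :
    AEMeasurable (state p n W ξ u i) P := by
  have := (measurable_canonicalState (p := p) (d := d) u i).comp_aemeasurable
    (aemeasurable_pi_iff.2 h.aemeasurable_entries)
  refine this.congr (ae_of_all _ fun ω => ?_)
  exact canonicalState_entries u hi ω

lemma aemeasurable_layer (h : IsModel P μ p n d W ξ) {i : ℕ} (hi : i < d) :
    AEMeasurable
      (fun ω => ((fun a b => W i ω a b : Fin (n (i + 1)) → Fin (n i) → ℝ), ξ i ω)) P := by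
  refine AEMeasurable.prodMk ?_ ?_
  · exact aemeasurable_pi_iff.2 fun a => aemeasurable_pi_iff.2 fun b =>
      (h.hasLaw_entry i hi a b).aemeasurable
  · exact aemeasurable_pi_iff.2 fun a => (h.hasLaw_bernoulli i hi a).aemeasurable

lemma isLayer (h : IsModel P μ p n d W ξ) {i : ℕ} (hi : i < d) :
    IsLayer P μ p (fun ω a b => W i ω a b) (ξ i) where
  hasLaw_weight := h.hasLaw_entry i hi
  hasLaw_bernoulli := h.hasLaw_bernoulli i hi
  independent := by
    have := h.independent.precomp (g := fun k => (⟨⟨i, hi⟩, k⟩ : EntryIndex n d))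
      (fun k l hkl => by simpa using hkl)
    convert this using 1
    funext k
    rcases k with ⟨a, b⟩ | a <;> rfl

lemma indepFun_state_layer (h : IsModel P μ p n d W ξ) (u : Fin (n 0) → ℝ) {i : ℕ} (hi : i < d) :
    IndepFun (state p n W ξ u i)
      (fun ω => ((fun a b => W i ω a b : Fin (n (i + 1)) → Fin (n i) → ℝ), ξ i ω)) P := by
  classical
  have := indepFun_of_disjoint h.independent h.aemeasurable_entries
    (S := Finset.univ.filter fun k => (k.1 : ℕ) < i)
    (T := Finset.univ.filter fun k => (k.1 : ℕ) = i)
    (φ := state p n (canonicalWeight n d) (canonicalBernoulli n d) u i)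
    (ψ := fun e => ((fun a b => canonicalWeight n d i e a b : Fin (n (i + 1)) → Fin (n i) → ℝ),
      canonicalBernoulli n d i e))
    (by rw [Finset.disjoint_filter]; intro k _ h1 h2; omega)
    (measurable_canonicalState u i)
    ((measurable_canonicalWeight i).prodMk (measurable_canonicalBernoulli i))
    (fun e e' he => by
      refine state_congr u i (fun j hj => ?_) (fun j hj => ?_)
      · funext a b
        simp only [canonicalWeight]
        split_ifs with hjd
        · exact he _ (by simpa using hj)
        · rfl
      · funext a
        simp only [canonicalBernoulli]
        split_ifs with hjd
        · exact he _ (by simpa using hj)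
        · rfl)
    (fun e e' he => by
      have h1 : canonicalWeight n d i e = canonicalWeight n d i e' := by
        funext a b
        simp only [canonicalWeight, hi, dite_true]
        exact he _ (by simp)
      have h2 : canonicalBernoulli n d i e = canonicalBernoulli n d i e' := by
        funext a
        simp only [canonicalBernoulli, hi, dite_true]
        exact he _ (by simp)
      simp only [h1, h2])
  convert this using 1
  · funext ω
    exact (canonicalState_entries u hi.le ω).symm
  · funext ω
    rw [canonicalWeight_entries hi, canonicalBernoulli_entries hi]

variable [IsProbabilityMeasure P]

/-- The Markov property: an expectation over the state after layer `i` is the expectation over the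
state before this layer of the expectation over a fresh copy of the layer. -/
lemma integral_state_succ (h : IsModel P μ p n d W ξ) (u : Fin (n 0) → ℝ) {i : ℕ} (hi : i < d)
    {g : (Fin (n (i + 1)) → ℝ) → ℝ} (hg : Measurable g)
    (hint : Integrable (fun ω => g (state p n W ξ u (i + 1) ω)) P) :
    Integrable (fun ω => ∫ ω', g (layerStep p (fun a b => W i ω' a b) (ξ i ω')
        (state p n W ξ u i ω)) ∂P) P ∧
      ∫ ω, g (state p n W ξ u (i + 1) ω) ∂P =
      ∫ ω, ∫ ω', g (layerStep p (fun a b => W i ω' a b) (ξ i ω') (state p n W ξ u i ω)) ∂P ∂P := by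
  have hs := h.aemeasurable_state u hi.le
  have hl := h.aemeasurable_layer hi
  have hmap := (indepFun_iff_map_prod_eq_prod_map_map hs hl).1 (h.indepFun_state_layer u hi)
  set L := fun ω => ((fun a b => W i ω a b : Fin (n (i + 1)) → Fin (n i) → ℝ), ξ i ω) with hL
  set G : (Fin (n i) → ℝ) × ((Fin (n (i + 1)) → Fin (n i) → ℝ) × (Fin (n (i + 1)) → ℝ)) → ℝ :=
    fun q => g (layerStep p q.2.1 q.2.2 q.1) with hG
  have hGm : Measurable G := hg.comp (measurable_layerStep.comp measurable_swap)
  have : IsProbabilityMeasure (P.map (state p n W ξ u i)) := Measure.isProbabilityMeasure_map hs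
  have : IsProbabilityMeasure (P.map L) := Measure.isProbabilityMeasure_map hl
  have hGi : Integrable G ((P.map (state p n W ξ u i)).prod (P.map L)) := by
    rw [← hmap, integrable_map_measure hGm.aestronglyMeasurable (hs.prodMk hl)]
    exact hint
  have hin : ∀ x, ∫ l, G (x, l) ∂(P.map L) = ∫ ω', G (x, L ω') ∂P := fun x =>
    integral_map hl (hGm.comp measurable_prodMk_left).aestronglyMeasurable
  have h1 := hGi.integral_prod_left
  have h2 := integral_prod _ hGi
  rw [← hmap, integral_map (hs.prodMk hl) hGm.aestronglyMeasurable] at h2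
  simp_rw [hin] at h1 h2
  have h3 := (integrable_map_measure h1.aestronglyMeasurable hs).1 h1
  refine ⟨h3, ?_⟩
  rw [integral_map hs h1.aestronglyMeasurable] at h2
  exact h2

lemma hasAllMoments_state (h : IsModel P μ p n d W ξ) (hμ : IsEntryLaw μ) (u : Fin (n 0) → ℝ)
    {i : ℕ} (hi : i ≤ d) (a : Fin (n i)) : HasAllMoments (fun ω => state p n W ξ u i ω a) P := by
  induction i with
  | zero => exact HasAllMoments.const _
  | succ i ih =>
    have hl := h.isLayer (show i < d by omega)
    exact ((hl.hasAllMoments_bernoulli a).mul (HasAllMoments.sum _ fun b _ =>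
      (hl.hasAllMoments_weight hμ a b).mul (ih (by omega) b))).const_mul _

lemma hasAllMoments_sumSq_state (h : IsModel P μ p n d W ξ) (hμ : IsEntryLaw μ)
    (u : Fin (n 0) → ℝ) {i : ℕ} (hi : i ≤ d) :
    HasAllMoments (fun ω => sumSq (state p n W ξ u i ω)) P :=
  HasAllMoments.sum _ fun a _ => (h.hasAllMoments_state hμ u hi a).pow 2

lemma hasAllMoments_sumFourth_state (h : IsModel P μ p n d W ξ) (hμ : IsEntryLaw μ)
    (u : Fin (n 0) → ℝ) {i : ℕ} (hi : i ≤ d) :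
    HasAllMoments (fun ω => sumFourth (state p n W ξ u i ω)) P :=
  HasAllMoments.sum _ fun a _ => (h.hasAllMoments_state hμ u hi a).pow 4

end IsModel

lemma measurable_sumSq {N : ℕ} : Measurable (sumSq : (Fin N → ℝ) → ℝ) := by
  unfold sumSq; fun_prop

lemma measurable_sumFourth {N : ℕ} : Measurable (sumFourth : (Fin N → ℝ) → ℝ) := by
  unfold sumFourth; fun_prop

end Chain

/-! ### The variance parameter -/

section Beta

variable {n : ℕ → ℕ} {d : ℕ} {p : unitInterval} {m : ℕ → ℝ}

/-- The contribution of the layer `i` (counted from `0`) to `β`. Only the first layer sees the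
`ℓ⁴` norm `q` of the initial vector. -/
noncomputable def betaStep (m : ℕ → ℝ) (p : unitInterval) (n : ℕ → ℕ) (q : ℝ) (i : ℕ) : ℝ :=
  ((3 / p - 1) + (m 4 - 3) / p * (if i = 0 then q else 0)) / n (i + 1)

/-- The contribution of the layer `i` (counted from `0`) to the error terms. The second summand, the
inverse square of the input width, comes from the `ℓ⁴` norm of the input. -/
noncomputable def errorStep (n : ℕ → ℕ) (i : ℕ) : ℝ :=
  1 / (n (i + 1) : ℝ) ^ 2 + if i = 0 then 0 else 1 / (n i : ℝ) ^ 2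

lemma sum_betaStep {μ : Measure ℝ} (hm : ∀ j : ℕ, ∫ x, x ^ j ∂μ = m j)
    (u : EuclideanSpace ℝ (Fin (n 0))) (hd : 1 ≤ d) :
    ∑ i ∈ Finset.range d, betaStep m p n (sumFourth u.ofLp) i = beta μ p n d u := by
  have e : ∑ j, |u j| ^ 4 = sumFourth u.ofLp :=
    Finset.sum_congr rfl fun j _ => by rw [← abs_pow, abs_of_nonneg (by positivity)]
  obtain ⟨d, rfl⟩ := Nat.exists_eq_add_of_le' hd
  rw [beta, hm, e]
  clear hd
  induction d with
  | zero => simp [betaStep]; ring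
  | succ d ih =>
    rw [Finset.sum_range_succ, ih, Finset.sum_Icc_succ_top (b := d + 1) (by omega)]
    simp only [betaStep, Nat.add_eq_zero_iff, one_ne_zero, and_false, if_false]
    ring

lemma errorStep_nonneg (i : ℕ) : 0 ≤ errorStep n i := by
  unfold errorStep; split_ifs <;> positivity

lemma one_div_sq_le_errorStep (i : ℕ) : 1 / (n (i + 1) : ℝ) ^ 2 ≤ errorStep n i := by
  unfold errorStep; split_ifs <;> simp

lemma sum_errorStep_le : ∑ i ∈ Finset.range d, errorStep n i ≤ 2 * sumInvSq n d := by
  -- The second summands of `errorStep` sum to `sumInvSq n (d - 1)`.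
  have key : ∑ i ∈ Finset.range d, errorStep n i ≤
      2 * sumInvSq n d - (if d = 0 then 0 else 1 / (n d : ℝ) ^ 2) := by
    induction d with
    | zero => simp [sumInvSq]
    | succ d ih =>
      rw [Finset.sum_range_succ, sumInvSq, Finset.sum_Icc_succ_top (by omega)]
      unfold sumInvSq at ih
      rw [if_neg d.succ_ne_zero, errorStep]
      split_ifs at ih ⊢ <;> linarith
  refine key.trans ?_
  split_ifs
  · simp
  · have : 0 ≤ 1 / (n d : ℝ) ^ 2 := by positivity
    linarith

lemma sumInvSq_nonneg : 0 ≤ sumInvSq n d := Finset.sum_nonneg fun _ _ => by positivity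

lemma sumInvSq_le (hn : ∀ i ≤ d, 0 < n i) :
    sumInvSq n d ≤ ∑ i ∈ Finset.Icc 1 d, 1 / (n i : ℝ) := by
  refine Finset.sum_le_sum fun i hi => ?_
  have h1 : (1 : ℝ) ≤ n i := by exact_mod_cast hn i (Finset.mem_Icc.1 hi).2
  exact one_div_le_one_div_of_le (by linarith) (le_self_pow₀ h1 two_ne_zero)

lemma sumInvSq_pos (hd : 1 ≤ d) (hn : ∀ i ≤ d, 0 < n i) : 0 < sumInvSq n d := by
  refine Finset.sum_pos (fun i hi => ?_) ⟨1, by simpa using hd⟩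
  have : 0 < n i := hn i (Finset.mem_Icc.1 hi).2
  positivity

/-- The fourth moment exceeds one: otherwise the law would be carried by the atoms `1` and `-1`. -/
lemma IsEntryLaw.one_lt_moment_four {μ : Measure ℝ} (hμ : IsEntryLaw μ)
    (hm : ∀ j : ℕ, ∫ x, x ^ j ∂μ = m j) : 1 < m 4 := by
  have := hμ.isProbabilityMeasure
  have hi : Integrable (fun x : ℝ => (x ^ 2 - 1) ^ 2) μ :=
    ((((hμ.hasAllMoments.pow 2).sub (HasAllMoments.const 1)).pow 2)).integrable
  have h1 : ∫ x, (x ^ 2 - 1) ^ 2 ∂μ = m 4 - 1 := by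
    have e : ∀ x : ℝ, (x ^ 2 - 1) ^ 2 = x ^ 4 - (2 * x ^ 2 - 1) := fun x => by ring
    simp_rw [e]
    have hi2 : Integrable (fun x : ℝ => 2 * x ^ 2 - 1) μ :=
      ((hμ.integrable_pow 2).const_mul 2).sub (integrable_const 1)
    rw [integral_sub (hμ.integrable_pow 4) hi2, integral_sub ((hμ.integrable_pow 2).const_mul 2)
      (integrable_const 1), integral_const_mul, hμ.variance_eq_one, hm]
    simp; ring
  have h2 : 0 ≤ ∫ x, (x ^ 2 - 1) ^ 2 ∂μ := integral_nonneg fun x => sq_nonneg _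
  rcases h2.lt_or_eq with h2 | h2
  · linarith
  exfalso
  have h3 := (integral_eq_zero_iff_of_nonneg (fun x => sq_nonneg (x ^ 2 - 1)) hi).1 h2.symm
  have h4 : μ ({1} ∪ {-1})ᶜ = 0 := by
    refine measure_mono_null (fun x hx => ?_) h3
    simp only [Set.mem_compl_iff, Set.mem_union, Set.mem_singleton_iff, not_or] at hx
    intro h5
    have h6 : x ^ 2 = 1 := by
      have : (x ^ 2 - 1) ^ 2 = 0 := h5
      have := pow_eq_zero_iff (two_ne_zero) |>.1 this
      linarith
    rcases (mul_self_eq_one_iff.1 (by rwa [← sq]) : x = 1 ∨ x = -1) with h | h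
    · exact hx.1 h
    · exact hx.2 h
  have h5 : μ ({1} ∪ {-1}) = 0 :=
    measure_union_null (hμ.no_atoms 1) (hμ.no_atoms (-1))
  have h6 : μ Set.univ = 0 := by
    rw [← Set.union_compl_self ({1} ∪ {-1} : Set ℝ)]
    exact measure_union_null h5 h4
  simp at h6

lemma sumSq_ofLp {N : ℕ} {u : EuclideanSpace ℝ (Fin N)} (hu : ‖u‖ = 1) : sumSq u.ofLp = 1 := by
  have := EuclideanSpace.norm_sq_eq u
  rw [hu] at this
  simpa [sumSq] using this.symm

lemma le_three_div (hp : 0 < (p : ℝ)) : 2 ≤ 3 / (p : ℝ) - 1 := by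
  have hp1 : (p : ℝ) ≤ 1 := p.2.2
  have : 3 ≤ 3 / (p : ℝ) := by rw [le_div_iff₀ hp]; linarith
  linarith

/-- Each layer contributes to `β` at least a fixed multiple of its inverse width. -/
lemma min_mul_le_betaStep {μ : Measure ℝ} (hμ : IsEntryLaw μ)
    (hm : ∀ j : ℕ, ∫ x, x ^ j ∂μ = m j) (hp : 0 < (p : ℝ)) {q : ℝ} (hq0 : 0 ≤ q) (hq1 : q ≤ 1)
    (i : ℕ) : min 2 (m 4 - 1) * (1 / (n (i + 1) : ℝ)) ≤ betaStep m p n q i := by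
  have h4 := hμ.one_lt_moment_four hm
  have h3 := le_three_div hp
  have hp1 : (p : ℝ) ≤ 1 := p.2.2
  rw [betaStep, mul_one_div]
  gcongr
  rcases le_total 3 (m 4) with h | h
  · have : 0 ≤ (m 4 - 3) / p * (if i = 0 then q else 0) := by
      have : 0 ≤ (m 4 - 3) / (p : ℝ) := div_nonneg (by linarith) hp.le
      split_ifs
      · positivity
      · simp
    exact (min_le_left _ _).trans (by linarith)
  · refine (min_le_right _ _).trans ?_
    have h5 : m 4 ≤ m 4 / p := by rw [le_div_iff₀ hp]; nlinarith
    have h6 : (m 4 - 3) / p ≤ 0 := div_nonpos_of_nonpos_of_nonneg (by linarith) hp.le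
    have h7 : (if i = 0 then q else 0) ≤ 1 := by split_ifs <;> linarith
    have h8 : (m 4 - 3) / p * 1 ≤ (m 4 - 3) / p * (if i = 0 then q else 0) :=
      mul_le_mul_of_nonpos_left h7 h6
    have h9 : (m 4 - 3) / (p : ℝ) = m 4 / p - 3 / p := sub_div _ _ _
    linarith

lemma sum_range_eq_sum_Icc (f : ℕ → ℝ) (d : ℕ) :
    ∑ i ∈ Finset.range d, f (i + 1) = ∑ i ∈ Finset.Icc 1 d, f i := by
  induction d with
  | zero => simp
  | succ d ih => rw [Finset.sum_range_succ, ih, Finset.sum_Icc_succ_top (by omega)]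

lemma sumFourth_ofLp_le {N : ℕ} {u : EuclideanSpace ℝ (Fin N)} (hu : ‖u‖ = 1) :
    sumFourth u.ofLp ≤ 1 := by
  have := sumFourth_le u.ofLp
  rwa [sumSq_ofLp hu, one_pow] at this

lemma min_mul_le_beta {μ : Measure ℝ} (hμ : IsEntryLaw μ)
    (hm : ∀ j : ℕ, ∫ x, x ^ j ∂μ = m j) (hp : 0 < (p : ℝ)) (hd : 1 ≤ d)
    {u : EuclideanSpace ℝ (Fin (n 0))} (hu : ‖u‖ = 1) :
    min 2 (m 4 - 1) * ∑ i ∈ Finset.Icc 1 d, 1 / (n i : ℝ) ≤ beta μ p n d u := by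
  rw [← sum_betaStep hm u hd, ← sum_range_eq_sum_Icc (fun i => 1 / (n i : ℝ)), Finset.mul_sum]
  exact Finset.sum_le_sum fun i _ =>
    min_mul_le_betaStep hμ hm hp (sumFourth_nonneg _) (sumFourth_ofLp_le hu) i

lemma beta_pos {μ : Measure ℝ} (hμ : IsEntryLaw μ)
    (hm : ∀ j : ℕ, ∫ x, x ^ j ∂μ = m j) (hp : 0 < (p : ℝ)) (hd : 1 ≤ d) (hn : ∀ i ≤ d, 0 < n i)
    {u : EuclideanSpace ℝ (Fin (n 0))} (hu : ‖u‖ = 1) : 0 < beta μ p n d u := by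
  refine lt_of_lt_of_le ?_ (min_mul_le_beta hμ hm hp hd hu)
  have h4 := hμ.one_lt_moment_four hm
  have h5 : 0 < min 2 (m 4 - 1) := lt_min (by norm_num) (by linarith)
  exact mul_pos h5 ((sumInvSq_pos hd hn).trans_le (sumInvSq_le hn))

end Beta

/-! ### Moments of the product -/

section ProductMoments

/-- One step of the comparison of the logarithm of a moment with a multiple of `β`. Here `a` and
`a'` stand for the moment before and after the step, `b` for the mixed moment with the `ℓ⁴` norm,
`N` for the width, `K` for the binomial coefficient and `t` for the contribution of the step to
`β`. -/
lemma abs_log_sub_log_le {a a' b N K γ δ c t e : ℝ} (ha : 0 < a) (haa : a ≤ a') (hb : 0 ≤ b)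
    (hba : b ≤ a) (hN : 1 ≤ N) (hK : 0 ≤ K) (hc : 0 ≤ c)
    (h : |a' - (a + K * ((γ * a + δ * b) / N))| ≤ c / N ^ 2 * a)
    (ht : |K * ((γ + δ * (b / a)) / N) - K * t| ≤ e) :
    |Real.log a' - Real.log a - K * t| ≤ e + (c + (K * (γ + |δ|) + c) ^ 2) / N ^ 2 := by
  set y := a' / a - 1 with hy
  have hN0 : 0 < N := by linarith
  have hy0 : 0 ≤ y := by rw [hy, sub_nonneg, le_div_iff₀ ha]; linarith
  have hlog : Real.log a' - Real.log a = Real.log (1 + y) := by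
    rw [← Real.log_div (by linarith) ha.ne', hy]; congr 1; ring
  have h1 : |y - K * ((γ + δ * (b / a)) / N)| ≤ c / N ^ 2 := by
    have e1 : y - K * ((γ + δ * (b / a)) / N) = (a' - (a + K * ((γ * a + δ * b) / N))) / a := by
      rw [hy]; field_simp; ring
    rw [e1, abs_div, abs_of_pos ha, div_le_iff₀ ha]
    exact h
  have hba' : |δ * (b / a)| ≤ |δ| := by
    rw [abs_mul, abs_of_nonneg (div_nonneg hb ha.le)]
    exact mul_le_of_le_one_right (abs_nonneg _) ((div_le_one ha).2 hba)
  have h2 : y ≤ (K * (γ + |δ|) + c) / N := by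
    have h3 : c / N ^ 2 ≤ c / N := by
      gcongr; exact le_self_pow₀ hN two_ne_zero
    have h4 : K * ((γ + δ * (b / a)) / N) ≤ K * ((γ + |δ|) / N) := by
      gcongr; exact (le_abs_self _).trans hba'
    have h5 := (le_abs_self _).trans h1
    calc y ≤ K * ((γ + |δ|) / N) + c / N := by linarith
      _ = _ := by ring
  have h6 : |Real.log (1 + y) - y| ≤ (K * (γ + |δ|) + c) ^ 2 / N ^ 2 := by
    have l1 := Real.log_le_sub_one_of_pos (show 0 < 1 + y by linarith)
    have l2 := Real.one_sub_inv_le_log_of_pos (show 0 < 1 + y by linarith)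
    have l3 : y - y ^ 2 ≤ 1 - (1 + y)⁻¹ := by
      have : 1 - (1 + y)⁻¹ - (y - y ^ 2) = y ^ 3 / (1 + y) := by field_simp; ring
      have h0 : 0 ≤ y ^ 3 / (1 + y) := by positivity
      linarith
    have l4 : y ^ 2 ≤ (K * (γ + |δ|) + c) ^ 2 / N ^ 2 := by
      rw [← div_pow]; exact pow_le_pow_left₀ hy0 h2 2
    rw [abs_le]; constructor <;> nlinarith
  rw [hlog]
  have e2 : Real.log (1 + y) - K * t = (Real.log (1 + y) - y) +
      (y - K * ((γ + δ * (b / a)) / N)) + (K * ((γ + δ * (b / a)) / N) - K * t) := by ring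
  rw [e2]
  refine (abs_add_le _ _).trans ?_
  have h7 := abs_add_le (Real.log (1 + y) - y) (y - K * ((γ + δ * (b / a)) / N))
  have h8 : (c + (K * (γ + |δ|) + c) ^ 2) / N ^ 2 =
    c / N ^ 2 + (K * (γ + |δ|) + c) ^ 2 / N ^ 2 := add_div _ _ _
  linarith

/-- The constant in the expansion of the logarithm of the moments of the product. -/
noncomputable def logMomentConst (m : ℕ → ℝ) (p₀ : ℝ) (k : ℕ) : ℝ :=
  (k + 2).choose 2 * (|m 4 - 3| / p₀) * mixedConst m p₀ k + (powerConst m p₀ (k + 2) +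
    ((k + 2).choose 2 * (3 / p₀ - 1 + |m 4 - 3| / p₀) + powerConst m p₀ (k + 2)) ^ 2)

variable {Ω : Type*} [MeasurableSpace Ω] {P : Measure Ω} [IsProbabilityMeasure P]
  {n : ℕ → ℕ} {d : ℕ} {p : unitInterval}
  {W : (i : ℕ) → Ω → Matrix (Fin (n (i + 1))) (Fin (n i)) ℝ}
  {ξ : (i : ℕ) → Ω → Fin (n (i + 1)) → ℝ} {μ : Measure ℝ} {m : ℕ → ℝ}

namespace IsModel

lemma integral_sumSq_state_pow_le (h : IsModel P μ p n d W ξ) (hμ : IsEntryLaw μ)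
    (hn : ∀ i ≤ d, 0 < n i) (hp : 0 < (p : ℝ)) (u : Fin (n 0) → ℝ) (k : ℕ) {i : ℕ} (hi : i < d) :
    ∫ ω, sumSq (state p n W ξ u i ω) ^ k ∂P ≤ ∫ ω, sumSq (state p n W ξ u (i + 1) ω) ^ k ∂P := by
  obtain ⟨h1, h2⟩ := h.integral_state_succ u hi (g := fun x => sumSq x ^ k)
    (measurable_sumSq.pow_const k) ((h.hasAllMoments_sumSq_state hμ u hi).pow k).integrable
  rw [h2]
  exact integral_mono ((h.hasAllMoments_sumSq_state hμ u hi.le).pow k).integrable h1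
    fun ω => (h.isLayer hi).sumSq_pow_le_integral hμ (hn _ hi) hp _ k

lemma integral_mixed_state_le (h : IsModel P μ p n d W ξ) (hμ : IsEntryLaw μ)
    (hm : ∀ j : ℕ, ∫ x, x ^ j ∂μ = m j)
    (hn : ∀ i ≤ d, 0 < n i) {p₀ : ℝ} (hp₀ : 0 < p₀) (hp : p₀ ≤ p)
    (u : Fin (n 0) → ℝ) (k : ℕ) {i : ℕ} (hi : i < d) :
    ∫ ω, sumSq (state p n W ξ u (i + 1) ω) ^ k * sumFourth (state p n W ξ u (i + 1) ω) ∂P ≤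
      mixedConst m p₀ k / n (i + 1) * ∫ ω, sumSq (state p n W ξ u i ω) ^ (k + 2) ∂P := by
  obtain ⟨h1, h2⟩ := h.integral_state_succ u hi (g := fun x => sumSq x ^ k * sumFourth x)
    ((measurable_sumSq.pow_const k).mul measurable_sumFourth)
    (((h.hasAllMoments_sumSq_state hμ u hi).pow k).mul
      (h.hasAllMoments_sumFourth_state hμ u hi)).integrable
  rw [h2, ← integral_const_mul]
  exact integral_mono h1
    (((h.hasAllMoments_sumSq_state hμ u hi.le).pow (k + 2)).const_mul _).integrable
    fun ω => (h.isLayer hi).integral_sumSq_pow_mul_sumFourth_le hμ hm (hn _ hi) hp₀ hp _ k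

lemma abs_integral_state_pow_sub_le (h : IsModel P μ p n d W ξ) (hμ : IsEntryLaw μ)
    (hm : ∀ j : ℕ, ∫ x, x ^ j ∂μ = m j)
    (hn : ∀ i ≤ d, 0 < n i) {p₀ : ℝ} (hp₀ : 0 < p₀) (hp : p₀ ≤ p)
    (u : Fin (n 0) → ℝ) (k : ℕ) {i : ℕ} (hi : i < d) :
    |∫ ω, sumSq (state p n W ξ u (i + 1) ω) ^ (k + 2) ∂P -
      (∫ ω, sumSq (state p n W ξ u i ω) ^ (k + 2) ∂P + (k + 2).choose 2 *
        (((3 / p - 1) * ∫ ω, sumSq (state p n W ξ u i ω) ^ (k + 2) ∂P +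
        (m 4 - 3) / p * ∫ ω, sumSq (state p n W ξ u i ω) ^ k * sumFourth (state p n W ξ u i ω) ∂P)
          / n (i + 1)))| ≤
      powerConst m p₀ (k + 2) / (n (i + 1) : ℝ) ^ 2 *
        ∫ ω, sumSq (state p n W ξ u i ω) ^ (k + 2) ∂P := by
  have hS := h.hasAllMoments_sumSq_state hμ u hi.le
  have hF := h.hasAllMoments_sumFourth_state hμ u hi.le
  obtain ⟨h1, h2⟩ := h.integral_state_succ u hi (g := fun x => sumSq x ^ (k + 2))
    (measurable_sumSq.pow_const _) ((h.hasAllMoments_sumSq_state hμ u hi).pow _).integrable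
  have hA : Integrable (fun ω => (3 / p - 1) * sumSq (state p n W ξ u i ω) ^ (k + 2)) P :=
    ((hS.pow _).const_mul _).integrable
  have hB : Integrable (fun ω => (m 4 - 3) / p *
      (sumSq (state p n W ξ u i ω) ^ k * sumFourth (state p n W ξ u i ω))) P :=
    (((hS.pow _).mul hF).const_mul _).integrable
  have hC : Integrable (fun ω => ((k + 2).choose 2 : ℝ) *
      (((3 / (p : ℝ) - 1) * sumSq (state p n W ξ u i ω) ^ (k + 2) + (m 4 - 3) / (p : ℝ) *
        (sumSq (state p n W ξ u i ω) ^ k * sumFourth (state p n W ξ u i ω))) /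
        (n (i + 1) : ℝ))) P :=
    ((hA.add hB).div_const _).const_mul _
  have e : ∫ ω, sumSq (state p n W ξ u i ω) ^ (k + 2) ∂P + (k + 2).choose 2 *
        (((3 / p - 1) * ∫ ω, sumSq (state p n W ξ u i ω) ^ (k + 2) ∂P +
        (m 4 - 3) / p * ∫ ω, sumSq (state p n W ξ u i ω) ^ k * sumFourth (state p n W ξ u i ω) ∂P)
          / n (i + 1)) = ∫ ω, (sumSq (state p n W ξ u i ω) ^ (k + 2) + (k + 2).choose 2 *
      (((3 / p - 1) * sumSq (state p n W ξ u i ω) ^ (k + 2) + (m 4 - 3) / p *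
        (sumSq (state p n W ξ u i ω) ^ k * sumFourth (state p n W ξ u i ω))) / n (i + 1))) ∂P := by
    rw [integral_add (hS.pow _).integrable hC, integral_const_mul, integral_div,
      integral_add hA hB, integral_const_mul, integral_const_mul]
  have hD := (hS.pow (k + 2)).integrable.add hC
  rw [h2, e, ← integral_const_mul]
  refine (congrArg abs (integral_sub h1 hD).symm).le.trans ?_
  refine (abs_integral_le_integral_abs).trans ?_
  exact integral_mono (h1.sub hD).abs
    ((hS.pow (k + 2)).const_mul _).integrable
    fun ω => (h.isLayer hi).abs_integral_sumSq_pow_sub_le hμ hm (hn _ hi) hp₀ hp _ k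

lemma integral_sumSq_state_pow_ge_one (h : IsModel P μ p n d W ξ) (hμ : IsEntryLaw μ)
    (hn : ∀ i ≤ d, 0 < n i) (hp : 0 < (p : ℝ)) {u : Fin (n 0) → ℝ} (hu : sumSq u = 1) (k : ℕ)
    {i : ℕ} (hi : i ≤ d) : 1 ≤ ∫ ω, sumSq (state p n W ξ u i ω) ^ k ∂P := by
  induction i with
  | zero => simp [state, hu]
  | succ i ih =>
    exact (ih (by omega)).trans (h.integral_sumSq_state_pow_le hμ hn hp u k (by omega))

lemma integral_sumSq_state (h : IsModel P μ p n d W ξ) (hμ : IsEntryLaw μ)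
    (hn : ∀ i ≤ d, 0 < n i) (hp : 0 < (p : ℝ)) {u : Fin (n 0) → ℝ} (hu : sumSq u = 1)
    {i : ℕ} (hi : i ≤ d) : ∫ ω, sumSq (state p n W ξ u i ω) ∂P = 1 := by
  induction i with
  | zero => simp [state, hu]
  | succ i ih =>
    have hi' : i < d := by omega
    obtain ⟨-, h2⟩ := h.integral_state_succ u hi' (g := sumSq) measurable_sumSq
      (h.hasAllMoments_sumSq_state hμ u hi).integrable
    rw [h2, ← ih (by omega)]
    congr 1
    funext ω
    generalize state p n W ξ u i ω = x
    rcases eq_or_ne x 0 with rfl | hx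
    · simp [layerStep_zero, sumSq_zero]
    obtain ⟨c, y, hc, hy, rfl⟩ := exists_unit_smul hx
    have hl := h.isLayer hi'
    have h3 := hl.integral_sumSq_sub_one hμ (hn _ hi) hp hy
    rw [integral_sub (hl.hasAllMoments_sumSq hμ y).integrable (integrable_const 1)] at h3
    simp_rw [layerStep_smul, sumSq_smul, hy]
    rw [integral_const_mul]
    simp only [integral_const, probReal_univ, one_smul] at h3
    rw [sub_eq_zero.1 h3]

/-- The logarithm of the `k`-th moment increases by `(k choose 2) * betaStep` in each layer. For
the layers after the first, the `ℓ⁴` norm of the input is negligible because the input is spread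
out by the preceding layer. -/
lemma abs_log_moment_step_le (h : IsModel P μ p n d W ξ) (hμ : IsEntryLaw μ)
    (hm : ∀ j : ℕ, ∫ x, x ^ j ∂μ = m j) (hn : ∀ i ≤ d, 0 < n i) (hp : 0 < (p : ℝ))
    {u : Fin (n 0) → ℝ} (hu : sumSq u = 1) (k : ℕ) {i : ℕ} (hi : i < d) :
    |Real.log (∫ ω, sumSq (state p n W ξ u (i + 1) ω) ^ (k + 2) ∂P) -
      Real.log (∫ ω, sumSq (state p n W ξ u i ω) ^ (k + 2) ∂P) -
      (k + 2).choose 2 * betaStep m p n (sumFourth u) i| ≤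
      logMomentConst m p k * errorStep n i := by
  set a : ℕ → ℝ := fun i => ∫ ω, sumSq (state p n W ξ u i ω) ^ (k + 2) ∂P with ha
  set b : ℕ → ℝ := fun i =>
    ∫ ω, sumSq (state p n W ξ u i ω) ^ k * sumFourth (state p n W ξ u i ω) ∂P with hb
  have hS := h.hasAllMoments_sumSq_state hμ u hi.le
  have hF := h.hasAllMoments_sumFourth_state hμ u hi.le
  have ha0 : 0 < a i := by
    have := h.integral_sumSq_state_pow_ge_one hμ hn hp hu (k + 2) hi.le; simp only [ha]; linarith
  have hb0 : 0 ≤ b i :=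
    integral_nonneg fun ω => mul_nonneg (pow_nonneg (sumSq_nonneg _) _) (sumFourth_nonneg _)
  have hba : b i ≤ a i := by
    refine integral_mono ((hS.pow k).mul hF).integrable (hS.pow _).integrable fun ω => ?_
    simp only [pow_add _ k 2]
    exact mul_le_mul_of_nonneg_left (sumFourth_le _) (pow_nonneg (sumSq_nonneg _) _)
  have hN : (1 : ℝ) ≤ n (i + 1) := by exact_mod_cast hn (i + 1) hi
  have hN0 : (0 : ℝ) < n (i + 1) := by linarith
  have hpc := powerConst_nonneg m hp (k + 2)
  have hmc := mixedConst_nonneg m hp k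
  have h3 := le_three_div hp
  have hδ : |(m 4 - 3) / (p : ℝ)| = |m 4 - 3| / p := by rw [abs_div, abs_of_pos hp]
  set c := powerConst m p (k + 2) + ((k + 2).choose 2 * (3 / (p : ℝ) - 1 + |m 4 - 3| / p) +
    powerConst m p (k + 2)) ^ 2 with hc
  have hc0 : 0 ≤ c := by positivity
  have hmain : ∀ e : ℝ,
      |((k + 2).choose 2 : ℝ) * (((3 / (p : ℝ) - 1) + (m 4 - 3) / (p : ℝ) * (b i / a i)) /
      (n (i + 1) : ℝ)) - (k + 2).choose 2 * betaStep m p n (sumFourth u) i| ≤ e →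
      |Real.log (a (i + 1)) - Real.log (a i) - (k + 2).choose 2 *
        betaStep m p n (sumFourth u) i| ≤ e + c / (n (i + 1) : ℝ) ^ 2 := fun e he => by
    have := abs_log_sub_log_le ha0 (h.integral_sumSq_state_pow_le hμ hn hp u (k + 2) hi) hb0 hba hN
      (Nat.cast_nonneg ((k + 2).choose 2)) hpc
      (h.abs_integral_state_pow_sub_le hμ hm hn hp le_rfl u k hi) he
    rwa [hδ] at this
  rcases i with _ | i
  · have h0 : a 0 = 1 := by simp [ha, state, hu]
    have h1 : b 0 = sumFourth u := by simp [hb, state, hu]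
    refine (hmain 0 (by simp [betaStep, h0, h1])).trans ?_
    have hM : 0 ≤ (k + 2).choose 2 * (|m 4 - 3| / p) * mixedConst m p k := by positivity
    rw [zero_add, logMomentConst, ← hc, errorStep, if_pos rfl, add_zero, mul_one_div]
    gcongr
    linarith
  · have hni : (0 : ℝ) < n (i + 1) := by
      have := hn (i + 1) hi.le
      positivity
    have hb1 : b (i + 1) / a (i + 1) ≤ mixedConst m p k / n (i + 1) := by
      rw [div_le_iff₀ ha0]
      refine (h.integral_mixed_state_le hμ hm hn hp le_rfl u k (by omega)).trans ?_
      gcongr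
      exact h.integral_sumSq_state_pow_le hμ hn hp u (k + 2) (by omega)
    refine (hmain ((k + 2).choose 2 * (|m 4 - 3| / p) * mixedConst m p k *
      (1 / (n (i + 1) : ℝ) ^ 2 + 1 / (n (i + 1 + 1) : ℝ) ^ 2)) ?_).trans ?_
    · have e1 : ((k + 2).choose 2 : ℝ) *
          (((3 / (p : ℝ) - 1) + (m 4 - 3) / (p : ℝ) * (b (i + 1) / a (i + 1))) /
          (n (i + 1 + 1) : ℝ)) - (k + 2).choose 2 * betaStep m p n (sumFourth u) (i + 1) =
          (k + 2).choose 2 * ((m 4 - 3) / p) * (b (i + 1) / a (i + 1)) * (1 / n (i + 1 + 1)) := by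
        simp only [betaStep, Nat.add_eq_zero_iff, one_ne_zero, and_false, if_false]; ring
      rw [e1, abs_mul, abs_mul, abs_mul, hδ, Nat.abs_cast,
        abs_of_nonneg (div_nonneg hb0 ha0.le),
          abs_of_nonneg (show (0 : ℝ) ≤ 1 / (n (i + 1 + 1) : ℝ) by positivity)]
      calc _ ≤ (k + 2).choose 2 * (|m 4 - 3| / p) * (mixedConst m p k / n (i + 1)) *
            (1 / n (i + 1 + 1)) := by gcongr
        _ = (k + 2).choose 2 * (|m 4 - 3| / p) * mixedConst m p k *
            ((1 / (n (i + 1) : ℝ)) * (1 / n (i + 1 + 1))) := by ring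
        _ ≤ _ := by
          gcongr
          rw [← one_div_pow, ← one_div_pow]
          nlinarith [sq_nonneg (1 / (n (i + 1) : ℝ) - 1 / n (i + 1 + 1)),
            sq_nonneg (1 / (n (i + 1) : ℝ)), sq_nonneg (1 / (n (i + 1 + 1) : ℝ))]
    · rw [logMomentConst, ← hc]
      simp only [errorStep, Nat.add_eq_zero_iff, one_ne_zero, and_false, if_false]
      have h5 : 0 ≤ c * (1 / (n (i + 1) : ℝ) ^ 2) := by positivity
      have h6 : c / (n (i + 1 + 1) : ℝ) ^ 2 = c * (1 / (n (i + 1 + 1) : ℝ) ^ 2) := by ring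
      rw [h6]
      nlinarith

lemma logMomentConst_nonneg (hp : 0 < (p : ℝ)) (k : ℕ) : 0 ≤ logMomentConst m p k := by
  have hpc := powerConst_nonneg m hp (k + 2)
  have hmc := mixedConst_nonneg m hp k
  unfold logMomentConst
  positivity

lemma exists_moment_eq (h : IsModel P μ p n d W ξ) (hμ : IsEntryLaw μ)
    (hm : ∀ j : ℕ, ∫ x, x ^ j ∂μ = m j) (hn : ∀ i ≤ d, 0 < n i) (hd : 1 ≤ d) (hp : 0 < (p : ℝ))
    {u : EuclideanSpace ℝ (Fin (n 0))} (hu : ‖u‖ = 1) (k : ℕ) :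
    ∃ ε : ℝ, |ε| ≤ 2 * logMomentConst m p (k - 2) * sumInvSq n d ∧
      ∫ ω, normSq p n d W ξ u ω ^ k ∂P =
        Real.exp ((k.choose 2 : ℝ) * beta μ p n d u + ε) := by
  have hu' := sumSq_ofLp hu
  simp_rw [normSq_eq_sumSq_state hp hn]
  have hC := logMomentConst_nonneg (m := m) hp (k - 2)
  have hS := sumInvSq_nonneg (n := n) (d := d)
  rcases k with _ | _ | k
  · exact ⟨0, by simp; positivity, by simp⟩
  · refine ⟨0, by simp; positivity, ?_⟩
    simp [h.integral_sumSq_state hμ hn hp hu' le_rfl]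
  · set a : ℕ → ℝ := fun i => ∫ ω, sumSq (state p n W ξ u.ofLp i ω) ^ (k + 2) ∂P with ha
    refine ⟨Real.log (a d) - (k + 2).choose 2 * beta μ p n d u, ?_, ?_⟩
    · have h0 : a 0 = 1 := by simp [ha, state, hu']
      have hsum : Real.log (a d) - (k + 2).choose 2 * beta μ p n d u =
          ∑ i ∈ Finset.range d, (Real.log (a (i + 1)) - Real.log (a i) -
            (k + 2).choose 2 * betaStep m p n (sumFourth u.ofLp) i) := by
        rw [Finset.sum_sub_distrib, ← Finset.mul_sum, sum_betaStep hm u hd,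
          Finset.sum_range_sub (fun i => Real.log (a i)), h0, Real.log_one, sub_zero]
      rw [hsum]
      calc _ ≤ ∑ i ∈ Finset.range d, logMomentConst m p k * errorStep n i :=
            (Finset.abs_sum_le_sum_abs _ _).trans (Finset.sum_le_sum fun i hi =>
              h.abs_log_moment_step_le hμ hm hn hp hu' k (Finset.mem_range.1 hi))
        _ = logMomentConst m p k * ∑ i ∈ Finset.range d, errorStep n i := by
            rw [Finset.mul_sum]
        _ ≤ logMomentConst m p k * (2 * sumInvSq n d) := by
            exact mul_le_mul_of_nonneg_left sum_errorStep_le hC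
        _ = 2 * logMomentConst m p k * sumInvSq n d := by ring
    · have h1 : 1 ≤ a d := h.integral_sumSq_state_pow_ge_one hμ hn hp hu' (k + 2) le_rfl
      rw [add_sub_cancel, Real.exp_log (by linarith)]

lemma integrable_normSq_pow (h : IsModel P μ p n d W ξ) (hμ : IsEntryLaw μ)
    (hn : ∀ i ≤ d, 0 < n i) (hp : 0 < (p : ℝ)) (u : EuclideanSpace ℝ (Fin (n 0))) (k : ℕ) :
    Integrable (fun ω => normSq p n d W ξ u ω ^ k) P := by
  simp_rw [normSq_eq_sumSq_state hp hn]
  exact ((h.hasAllMoments_sumSq_state hμ u.ofLp le_rfl).pow k).integrable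

end IsModel

/-- The moments of the log-normal distribution. -/
lemma integral_exp_pow_limitGaussian {β : ℝ} (hβ : 0 ≤ β) (k : ℕ) :
    ∫ x, Real.exp x ^ k ∂(limitGaussian β) = Real.exp ((k.choose 2 : ℝ) * β) := by
  have h := congrFun (mgf_fun_id_gaussianReal (μ := -(β / 2)) (v := β.toNNReal)) (k : ℝ)
  rw [mgf] at h
  simp_rw [← Real.exp_nat_mul]
  rw [limitGaussian, h, Real.coe_toNNReal β hβ, Nat.cast_choose_two]
  congr 1
  ring

/-- The comparison of the moments with those of the log-normal distribution. As `β` dominates the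
sum of the inverse widths, a bound for `β` bounds the exponent `ε` of `exists_moment_eq`. The factor
`β⁻¹` is gained from `1 ≤ b * β⁻¹`. -/
lemma IsModel.abs_moment_sub_le (h : IsModel P μ p n d W ξ) (hμ : IsEntryLaw μ)
    (hm : ∀ j : ℕ, ∫ x, x ^ j ∂μ = m j) (hn : ∀ i ≤ d, 0 < n i) (hd : 1 ≤ d) (hp : 0 < (p : ℝ))
    {u : EuclideanSpace ℝ (Fin (n 0))} (hu : ‖u‖ = 1) (k : ℕ) {b C : ℝ}
    (hb : beta μ p n d u ≤ b) (hC : C = 2 * logMomentConst m p (k - 2)) :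
    |∫ ω, normSq p n d W ξ u ω ^ k ∂P - ∫ x, Real.exp x ^ k ∂(limitGaussian (beta μ p n d u))| ≤
      Real.exp (k.choose 2 * b) * (C * Real.exp (C * (b / min 2 (m 4 - 1)))) * b *
        ((beta μ p n d u)⁻¹ * sumInvSq n d) := by
  obtain ⟨ε, hε, he⟩ := h.exists_moment_eq hμ hm hn hd hp hu k
  have hβ := beta_pos hμ hm hp hd hn hu
  have hC0 : 0 ≤ C := by rw [hC]; have := logMomentConst_nonneg (m := m) hp (k - 2); positivity
  rw [← hC] at hε
  rw [he, integral_exp_pow_limitGaussian hβ.le]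
  set β := beta μ p n d u with hβdef
  have hS := sumInvSq_nonneg (n := n) (d := d)
  have h4 := hμ.one_lt_moment_four hm
  have hmin : 0 < min 2 (m 4 - 1) := lt_min (by norm_num) (by linarith)
  have hSb : sumInvSq n d ≤ b / min 2 (m 4 - 1) := by
    rw [le_div_iff₀ hmin, mul_comm]
    exact (mul_le_mul_of_nonneg_left (sumInvSq_le hn) hmin.le).trans
      ((min_mul_le_beta hμ hm hp hd hu).trans hb)
  have hε2 : |ε| ≤ C * (b / min 2 (m 4 - 1)) := hε.trans (by gcongr)
  have hexp : |Real.exp ε - 1| ≤ |ε| * Real.exp |ε| := by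
    have h1 := Real.add_one_le_exp ε
    rcases le_total 0 ε with h0 | h0
    · have h2 := Real.add_one_le_exp (-ε)
      have h3 : Real.exp ε * Real.exp (-ε) = 1 := by rw [← Real.exp_add]; simp
      rw [abs_of_nonneg h0, abs_of_nonneg (by linarith)]
      nlinarith [Real.exp_pos ε]
    · have h2 : 1 ≤ Real.exp |ε| := Real.one_le_exp (abs_nonneg _)
      have h3 : Real.exp ε ≤ 1 := Real.exp_le_one_iff.2 h0
      rw [abs_of_nonpos (by linarith : Real.exp ε - 1 ≤ 0)]
      have h4 : |ε| = -ε := abs_of_nonpos h0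
      nlinarith [abs_nonneg ε]
  have hbβ : 1 ≤ b * β⁻¹ := by rw [← div_eq_mul_inv, le_div_iff₀ hβ]; linarith
  calc |Real.exp (k.choose 2 * β + ε) - Real.exp (k.choose 2 * β)|
      = Real.exp (k.choose 2 * β) * |Real.exp ε - 1| := by
        rw [Real.exp_add, ← mul_sub_one, abs_mul, Real.abs_exp]
    _ ≤ Real.exp (k.choose 2 * b) * ((C * sumInvSq n d) *
        Real.exp (C * (b / min 2 (m 4 - 1)))) := by
        gcongr
        refine hexp.trans ?_
        gcongr
    _ = Real.exp (k.choose 2 * b) * (C * Real.exp (C * (b / min 2 (m 4 - 1)))) *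
        sumInvSq n d * 1 := by ring
    _ ≤ Real.exp (k.choose 2 * b) * (C * Real.exp (C * (b / min 2 (m 4 - 1)))) *
        sumInvSq n d * (b * β⁻¹) := by gcongr
    _ = _ := by ring

end ProductMoments

/-! ### Taylor expansion of a function of the logarithm -/

section Taylor

/-- `f 0, …, f 4` is a function with its first four derivatives, all bounded by `A`. -/
structure BoundedJet (f : ℕ → ℝ → ℝ) (A : ℝ) : Prop where
  hasDerivAt : ∀ j < 4, ∀ x, HasDerivAt (f j) (f (j + 1) x) x
  bound : ∀ j ≤ 4, ∀ x, |f j x| ≤ A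
  continuous_four : Continuous (f 4)

lemma BoundedJet.nonneg {f : ℕ → ℝ → ℝ} {A : ℝ} (hf : BoundedJet f A) : 0 ≤ A :=
  (abs_nonneg _).trans (hf.bound 0 (by norm_num) 0)

lemma BoundedJet.continuous {f : ℕ → ℝ → ℝ} {A : ℝ} (hf : BoundedJet f A) {j : ℕ} (hj : j ≤ 4) :
    Continuous (f j) := by
  rcases hj.lt_or_eq with hj | rfl
  · exact continuous_iff_continuousAt.2 fun x => (hf.hasDerivAt j hj x).continuousAt
  · exact hf.continuous_four

lemma abs_le_of_hasDerivWithinAt {g g' : ℝ → ℝ} {B : ℝ}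
    (hg : ∀ s ∈ Set.Icc (0 : ℝ) 1, HasDerivWithinAt g (g' s) (Set.Icc 0 1) s)
    (hB : ∀ s ∈ Set.Icc (0 : ℝ) 1, |g' s| ≤ B) (h0 : g 0 = 0) {s : ℝ}
    (hs : s ∈ Set.Icc (0 : ℝ) 1) : |g s| ≤ B := by
  have h := Convex.norm_image_sub_le_of_norm_hasDerivWithin_le hg hB (convex_Icc 0 1)
    (Set.left_mem_Icc.2 zero_le_one) hs
  rw [h0, sub_zero, sub_zero, Real.norm_eq_abs, Real.norm_eq_abs, abs_of_nonneg hs.1] at h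
  have hB0 : 0 ≤ B := (abs_nonneg _).trans (hB s hs)
  exact h.trans (mul_le_of_le_one_right hB0 hs.2)

/-- Taylor's formula of order three on the unit interval, with a remainder that is not sharp. -/
lemma abs_sub_taylor_le {h₀ h₁ h₂ h₃ h₄ : ℝ → ℝ} {B : ℝ}
    (d₀ : ∀ s ∈ Set.Icc (0 : ℝ) 1, HasDerivAt h₀ (h₁ s) s)
    (d₁ : ∀ s ∈ Set.Icc (0 : ℝ) 1, HasDerivAt h₁ (h₂ s) s)
    (d₂ : ∀ s ∈ Set.Icc (0 : ℝ) 1, HasDerivAt h₂ (h₃ s) s)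
    (d₃ : ∀ s ∈ Set.Icc (0 : ℝ) 1, HasDerivAt h₃ (h₄ s) s)
    (hB : ∀ s ∈ Set.Icc (0 : ℝ) 1, |h₄ s| ≤ B) :
    |h₀ 1 - (h₀ 0 + h₁ 0 + h₂ 0 / 2 + h₃ 0 / 6)| ≤ B := by
  have e₃ := fun s hs => abs_le_of_hasDerivWithinAt (g := fun s => h₃ s - h₃ 0) (s := s)
    (fun s hs => ((d₃ s hs).sub_const (h₃ 0)).hasDerivWithinAt) hB (by simp) hs
  have e₂ := fun s hs => abs_le_of_hasDerivWithinAt (g := fun s => h₂ s - h₂ 0 - s * h₃ 0)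
    (g' := fun s => h₃ s - h₃ 0) (s := s)
    (fun s hs => by
      have := ((d₂ s hs).sub_const (h₂ 0)).sub ((hasDerivAt_id s).mul_const (h₃ 0))
      exact this.hasDerivWithinAt.congr_deriv (by simp)) e₃ (by simp) hs
  have e₁ := fun s hs => abs_le_of_hasDerivWithinAt
    (g := fun s => h₁ s - h₁ 0 - s * h₂ 0 - s ^ 2 * (h₃ 0 / 2))
    (g' := fun s => h₂ s - h₂ 0 - s * h₃ 0) (s := s)
    (fun s hs => by
      have := (((d₁ s hs).sub_const (h₁ 0)).sub ((hasDerivAt_id s).mul_const (h₂ 0))).sub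
        ((hasDerivAt_pow 2 s).mul_const (h₃ 0 / 2))
      refine this.hasDerivWithinAt.congr_deriv ?_
      simp; ring) e₂ (by simp) hs
  have e₀ := abs_le_of_hasDerivWithinAt
    (g := fun s => h₀ s - h₀ 0 - s * h₁ 0 - s ^ 2 * (h₂ 0 / 2) - s ^ 3 * (h₃ 0 / 6))
    (g' := fun s => h₁ s - h₁ 0 - s * h₂ 0 - s ^ 2 * (h₃ 0 / 2)) (s := 1)
    (fun s hs => by
      have := ((((d₀ s hs).sub_const (h₀ 0)).sub ((hasDerivAt_id s).mul_const (h₁ 0))).sub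
        ((hasDerivAt_pow 2 s).mul_const (h₂ 0 / 2))).sub
        ((hasDerivAt_pow 3 s).mul_const (h₃ 0 / 6))
      refine this.hasDerivWithinAt.congr_deriv ?_
      simp; ring) e₁ (by simp) (by simp)
  convert e₀ using 2
  ring

/-- The third order Taylor expansion of `r ↦ f (l + log r)` at `r = 1`. The remainder is uniform in
`r ≥ 0`: for `r < 1/2` boundedness of `f` suffices, so that there any bounded value may replace
`f (l + log r)`. -/
lemma BoundedJet.abs_sub_taylor_log_le {f : ℕ → ℝ → ℝ} {A : ℝ} (hf : BoundedJet f A) (l : ℝ)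
    {r y : ℝ} (hr : 0 ≤ r) (hy : |y| ≤ A) (hry : 1 / 2 ≤ r → y = f 0 (l + Real.log r)) :
    |y - (f 0 l + f 1 l * (r - 1) + (f 2 l - f 1 l) / 2 * (r - 1) ^ 2 +
      (f 3 l - 3 * f 2 l + 2 * f 1 l) / 6 * (r - 1) ^ 3)| ≤ 384 * A * (r - 1) ^ 4 := by
  have hA := hf.nonneg
  have b0 := fun x => abs_le.1 (hf.bound 0 (by norm_num) x)
  have b1 := fun x => abs_le.1 (hf.bound 1 (by norm_num) x)
  have b2 := fun x => abs_le.1 (hf.bound 2 (by norm_num) x)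
  have b3 := fun x => abs_le.1 (hf.bound 3 (by norm_num) x)
  have b4 := fun x => abs_le.1 (hf.bound 4 (by norm_num) x)
  rcases lt_or_ge r (1 / 2) with h | h
  · have a1 : |r - 1| ≤ 1 := by rw [abs_le]; constructor <;> linarith
    have k1 : |f 1 l * (r - 1)| ≤ A := by
      rw [abs_mul]
      exact (mul_le_of_le_one_right (abs_nonneg _) a1).trans (abs_le.2 (b1 l))
    have k2 : |(f 2 l - f 1 l) / 2 * (r - 1) ^ 2| ≤ A := by
      rw [abs_mul, abs_pow]
      refine (mul_le_of_le_one_right (abs_nonneg _) (pow_le_one₀ (abs_nonneg _) a1)).trans ?_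
      rw [abs_le]; constructor <;> linarith [b1 l, b2 l]
    have k3 : |(f 3 l - 3 * f 2 l + 2 * f 1 l) / 6 * (r - 1) ^ 3| ≤ A := by
      rw [abs_mul, abs_pow]
      refine (mul_le_of_le_one_right (abs_nonneg _) (pow_le_one₀ (abs_nonneg _) a1)).trans ?_
      rw [abs_le]; constructor <;> linarith [b1 l, b2 l, b3 l]
    have k4 : 1 / 16 ≤ (r - 1) ^ 4 := by
      have : (1 / 2 : ℝ) ≤ 1 - r := by linarith
      calc (1 / 16 : ℝ) = (1 / 2) ^ 4 := by norm_num
        _ ≤ (1 - r) ^ 4 := pow_le_pow_left₀ (by norm_num) this 4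
        _ = (r - 1) ^ 4 := by ring
    have k5 : A * (1 / 16) ≤ A * (r - 1) ^ 4 := mul_le_mul_of_nonneg_left k4 hA
    have := b0 l
    rw [abs_le] at k1 k2 k3 hy ⊢
    constructor <;> linarith
  · rw [hry h]
    set c := r - 1 with hc
    have hρ : ∀ s ∈ Set.Icc (0 : ℝ) 1, 1 / 2 ≤ 1 + s * c := by
      rintro s ⟨hs0, hs1⟩
      nlinarith
    have hder : ∀ s ∈ Set.Icc (0 : ℝ) 1, ∀ j < 4,
        HasDerivAt (fun s => f j (l + Real.log (1 + s * c)))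
          (f (j + 1) (l + Real.log (1 + s * c)) * (c / (1 + s * c))) s := by
      intro s hs j hj
      have h1 : HasDerivAt (fun s : ℝ => 1 + s * c) c s := by
        simpa using ((hasDerivAt_id s).mul_const c).const_add 1
      have h2 := (h1.log (by have := hρ s hs; linarith)).const_add l
      exact (hf.hasDerivAt j hj _).comp s h2
    have hinv : ∀ s ∈ Set.Icc (0 : ℝ) 1, ∀ k : ℕ,
        HasDerivAt (fun s => (c / (1 + s * c)) ^ k) (-(k * (c / (1 + s * c)) ^ (k + 1))) s := by
      intro s hs k
      have hne : 1 + s * c ≠ 0 := by have := hρ s hs; linarith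
      have h1 : HasDerivAt (fun s : ℝ => 1 + s * c) c s := by
        simpa using ((hasDerivAt_id s).mul_const c).const_add 1
      have h2 := ((hasDerivAt_const s c).div h1 hne).pow k
      refine h2.congr_deriv ?_
      rcases k with _ | k
      · simp
      · have e : (0 * (1 + s * c) - c * c) / (1 + s * c) ^ 2 = -(c / (1 + s * c)) ^ 2 := by
          rw [div_pow]; ring
        rw [e]
        simp only [Pi.div_apply, Nat.add_sub_cancel]
        ring
    have := abs_sub_taylor_le (B := 384 * A * c ^ 4)
      (h₀ := fun s => f 0 (l + Real.log (1 + s * c)))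
      (h₁ := fun s => f 1 (l + Real.log (1 + s * c)) * (c / (1 + s * c)) ^ 1)
      (h₂ := fun s => (f 2 (l + Real.log (1 + s * c)) - f 1 (l + Real.log (1 + s * c))) *
        (c / (1 + s * c)) ^ 2)
      (h₃ := fun s => (f 3 (l + Real.log (1 + s * c)) - 3 * f 2 (l + Real.log (1 + s * c)) +
        2 * f 1 (l + Real.log (1 + s * c))) * (c / (1 + s * c)) ^ 3)
      (h₄ := fun s => (f 4 (l + Real.log (1 + s * c)) - 6 * f 3 (l + Real.log (1 + s * c)) +
        11 * f 2 (l + Real.log (1 + s * c)) - 6 * f 1 (l + Real.log (1 + s * c))) *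
        (c / (1 + s * c)) ^ 4)
      (fun s hs => (hder s hs 0 (by norm_num)).congr_deriv (by simp))
      (fun s hs => ((hder s hs 1 (by norm_num)).mul (hinv s hs 1)).congr_deriv (by simp; ring))
      (fun s hs => (((hder s hs 2 (by norm_num)).sub (hder s hs 1 (by norm_num))).mul
        (hinv s hs 2)).congr_deriv (by simp; ring))
      (fun s hs => ((((hder s hs 3 (by norm_num)).sub
        ((hder s hs 2 (by norm_num)).const_mul 3)).add
        ((hder s hs 1 (by norm_num)).const_mul 2)).mul
        (hinv s hs 3)).congr_deriv (by simp; ring))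
      (fun s hs => by
        have h1 := hρ s hs
        have h2 : |c / (1 + s * c)| ≤ 2 * |c| := by
          rw [abs_div, abs_of_pos (by linarith : 0 < 1 + s * c), div_le_iff₀ (by linarith)]
          nlinarith [abs_nonneg c]
        have h3 : |(c / (1 + s * c)) ^ 4| ≤ 16 * c ^ 4 := by
          rw [abs_pow]
          refine (pow_le_pow_left₀ (abs_nonneg _) h2 4).trans_eq ?_
          rw [mul_pow, pow_abs, abs_of_nonneg (by positivity)]; norm_num
        set x := l + Real.log (1 + s * c)
        have h4 : |f 4 x - 6 * f 3 x + 11 * f 2 x - 6 * f 1 x| ≤ 24 * A := by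
          rw [abs_le]; constructor <;> linarith [b1 x, b2 x, b3 x, b4 x]
        rw [abs_mul]
        calc _ ≤ 24 * A * (16 * c ^ 4) := by gcongr
          _ = _ := by ring)
    simp only [one_mul, zero_mul, add_zero, Real.log_one, div_one] at this
    have e : 1 + c = r := by rw [hc]; ring
    rw [e] at this
    convert this using 2
    ring

/-- The expectation of `f (l + log R)` for a nonnegative variable `R` with mean one. The variable
`Y` is `f (l + log R)`, except that it may be any bounded value where `R < 1/2`. -/
lemma BoundedJet.abs_integral_sub_le {Ω : Type*} [MeasurableSpace Ω] {P : Measure Ω}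
    [IsProbabilityMeasure P] {f : ℕ → ℝ → ℝ} {A : ℝ} (hf : BoundedJet f A) (l : ℝ)
    {R Y : Ω → ℝ} {δ v : ℝ} (hR : ∀ ω, 0 ≤ R ω) (hRm : HasAllMoments (fun ω => R ω - 1) P)
    (hYm : AEMeasurable Y P)
    (hY : ∀ ω, |Y ω| ≤ A) (hRY : ∀ ω, 1 / 2 ≤ R ω → Y ω = f 0 (l + Real.log (R ω)))
    (h1 : ∫ ω, (R ω - 1) ∂P = 0) (h2 : ∫ ω, (R ω - 1) ^ 2 ∂P = v)
    (h3 : |∫ ω, (R ω - 1) ^ 3 ∂P| ≤ δ) (h4 : ∫ ω, (R ω - 1) ^ 4 ∂P ≤ δ) :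
    |∫ ω, Y ω ∂P - (f 0 l + (f 2 l - f 1 l) / 2 * v)| ≤ 385 * A * δ := by
  have hA := hf.nonneg
  have hYi : Integrable Y P := Integrable.of_bound hYm.aestronglyMeasurable A
    (ae_of_all _ fun ω => hY ω)
  set c := (f 3 l - 3 * f 2 l + 2 * f 1 l) / 6 with hc
  have hcA : |c| ≤ A := by
    have b1 := abs_le.1 (hf.bound 1 (by norm_num) l)
    have b2 := abs_le.1 (hf.bound 2 (by norm_num) l)
    have b3 := abs_le.1 (hf.bound 3 (by norm_num) l)
    rw [hc, abs_le]; constructor <;> linarith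
  have i1 : Integrable (fun ω => f 0 l + f 1 l * (R ω - 1)) P :=
    (integrable_const _).add (hRm.const_mul _).integrable
  have i2 : Integrable (fun ω => (f 2 l - f 1 l) / 2 * (R ω - 1) ^ 2) P :=
    ((hRm.pow 2).const_mul _).integrable
  have i3 : Integrable (fun ω => c * (R ω - 1) ^ 3) P := ((hRm.pow 3).const_mul _).integrable
  have i12 : Integrable (fun ω => f 0 l + f 1 l * (R ω - 1) +
      (f 2 l - f 1 l) / 2 * (R ω - 1) ^ 2) P := i1.add i2
  have iT : Integrable (fun ω => f 0 l + f 1 l * (R ω - 1) +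
      (f 2 l - f 1 l) / 2 * (R ω - 1) ^ 2 + c * (R ω - 1) ^ 3) P := i12.add i3
  have hT : ∫ ω, (f 0 l + f 1 l * (R ω - 1) + (f 2 l - f 1 l) / 2 * (R ω - 1) ^ 2 +
      c * (R ω - 1) ^ 3) ∂P = f 0 l + (f 2 l - f 1 l) / 2 * v + c * ∫ ω, (R ω - 1) ^ 3 ∂P := by
    rw [integral_add i12 i3, integral_add i1 i2,
      integral_add (integrable_const _) (hRm.const_mul _).integrable, integral_const_mul,
      integral_const_mul, integral_const_mul, h1, h2]
    simp
  have hdiff : |∫ ω, Y ω ∂P - ∫ ω, (f 0 l + f 1 l * (R ω - 1) +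
      (f 2 l - f 1 l) / 2 * (R ω - 1) ^ 2 + c * (R ω - 1) ^ 3) ∂P| ≤ 384 * A * δ := by
    rw [← integral_sub hYi iT]
    refine abs_integral_le_integral_abs.trans ?_
    calc _ ≤ ∫ ω, 384 * A * (R ω - 1) ^ 4 ∂P :=
          integral_mono (hYi.sub iT).abs ((hRm.pow 4).const_mul _).integrable fun ω =>
            hf.abs_sub_taylor_log_le l (hR ω) (hY ω) (hRY ω)
      _ ≤ _ := by rw [integral_const_mul]; gcongr
  have h5 : |c * ∫ ω, (R ω - 1) ^ 3 ∂P| ≤ A * δ := by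
    rw [abs_mul]; gcongr
  rw [hT] at hdiff
  rw [abs_le] at hdiff h5 ⊢
  constructor <;> linarith

/-- Averages of translates of a jet. -/
lemma BoundedJet.average {f : ℕ → ℝ → ℝ} {A : ℝ} (hf : BoundedJet f A) (ν : Measure ℝ)
    [IsProbabilityMeasure ν] : BoundedJet (fun j x => ∫ g, f j (x + g) ∂ν) A where
  hasDerivAt j hj x := by
    have hm : ∀ j ≤ 4, ∀ x, AEStronglyMeasurable (fun g => f j (x + g)) ν := fun j hj x =>
      ((hf.continuous hj).comp (continuous_const_add x)).aestronglyMeasurable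
    refine (hasDerivAt_integral_of_dominated_loc_of_deriv_le (bound := fun _ => A)
      (F := fun x g => f j (x + g)) (F' := fun x g => f (j + 1) (x + g))
      (s := Set.univ) Filter.univ_mem (Filter.Eventually.of_forall (hm j hj.le))
      (Integrable.of_bound (hm j hj.le x) A (ae_of_all _ fun g => hf.bound j hj.le _))
      (hm (j + 1) hj x) (ae_of_all _ fun g x _ => hf.bound (j + 1) hj _)
      (integrable_const _) (ae_of_all _ fun g x _ => ?_)).2
    exact (hf.hasDerivAt j hj (x + g)).comp_add_const x g
  bound j hj x := by
    have := norm_integral_le_of_norm_le_const (μ := ν) (f := fun g => f j (x + g))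
      (ae_of_all _ fun g => hf.bound j hj (x + g))
    simpa using this
  continuous_four := by
    refine continuous_of_dominated (bound := fun _ => A) (fun x => ?_) (fun x => ?_)
      (integrable_const _) (ae_of_all _ fun g => ?_)
    · exact (hf.continuous_four.comp (continuous_const_add x)).aestronglyMeasurable
    · exact ae_of_all _ fun g => hf.bound 4 le_rfl (x + g)
    · exact hf.continuous_four.comp (continuous_add_const g)

end Taylor

/-! ### The Gaussian semigroup -/

section Gaussian

instance (β : ℝ) : IsProbabilityMeasure (limitGaussian β) := by
  unfold limitGaussian; infer_instance

lemma limitGaussian_conv {s t : ℝ} (hs : 0 ≤ s) (ht : 0 ≤ t) :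
    (limitGaussian s).conv (limitGaussian t) = limitGaussian (s + t) := by
  rw [limitGaussian, limitGaussian, limitGaussian, gaussianReal_conv_gaussianReal,
    Real.toNNReal_add hs ht]
  congr 1
  ring

lemma limitGaussian_zero : limitGaussian 0 = Measure.dirac 0 := by
  simp [limitGaussian]

lemma abs_exp_sub_le {t : ℝ} (ht : 0 ≤ t) : |Real.exp t - 1 - t| ≤ t ^ 2 * Real.exp t := by
  have h1 := Real.add_one_le_exp t
  have h2 := Real.add_one_le_exp (-t)
  have h3 : Real.exp t * Real.exp (-t) = 1 := by rw [← Real.exp_add]; simp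
  have h4 := Real.exp_pos t
  rw [abs_of_nonneg (by linarith)]
  -- `exp t - 1 ≤ t * exp t`, used twice.
  have h5 : Real.exp t - 1 ≤ t * Real.exp t := by nlinarith
  nlinarith

lemma hasAllMoments_exp_limitGaussian (s : ℝ) :
    HasAllMoments (fun x => Real.exp x) (limitGaussian s) := by
  refine hasAllMoments_of_integrable_pow Real.continuous_exp.aestronglyMeasurable fun k => ?_
  simp_rw [← Real.exp_nat_mul]
  exact integrable_exp_mul_gaussianReal _

/-- The Gaussian semigroup has the generator `f ↦ (f'' - f') / 2`, up to an error of second order in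
time. The proof applies the expansion for nonnegative variables of mean one to the log-normal
distribution, whose moments are explicit. -/
lemma BoundedJet.abs_gaussian_sub_le {f : ℕ → ℝ → ℝ} {A : ℝ} (hf : BoundedJet f A) (l : ℝ)
    {s : ℝ} (hs : 0 ≤ s) :
    |∫ g, f 0 (l + g) ∂(limitGaussian s) - (f 0 l + (f 2 l - f 1 l) / 2 * s)| ≤
      30031 * A * (s ^ 2 * Real.exp (6 * s)) := by
  have hA := hf.nonneg
  have hm := hasAllMoments_exp_limitGaussian s
  have hM : ∀ k : ℕ, ∫ x, Real.exp x ^ k ∂(limitGaussian s) =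
    Real.exp ((k.choose 2 : ℝ) * s) := integral_exp_pow_limitGaussian hs
  have m1 : ∫ x, Real.exp x ∂(limitGaussian s) = 1 := by simpa using hM 1
  have m2 : ∫ x, Real.exp x ^ 2 ∂(limitGaussian s) = Real.exp s := by simpa using hM 2
  have m3 : ∫ x, Real.exp x ^ 3 ∂(limitGaussian s) = Real.exp (3 * s) := by
    rw [hM 3]; norm_num [Nat.choose]
  have m4 : ∫ x, Real.exp x ^ 4 ∂(limitGaussian s) = Real.exp (6 * s) := by
    rw [hM 4]; norm_num [Nat.choose]
  have i1 := hm.integrable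
  have i2 := (hm.pow 2).integrable
  have i3 := (hm.pow 3).integrable
  have i4 := (hm.pow 4).integrable
  have c1 : ∫ x, (Real.exp x - 1) ∂(limitGaussian s) = 0 := by
    rw [integral_sub i1 (integrable_const 1), m1]; simp
  have c2 : ∫ x, (Real.exp x - 1) ^ 2 ∂(limitGaussian s) = Real.exp s - 1 := by
    have e : ∀ x, (Real.exp x - 1) ^ 2 = Real.exp x ^ 2 - 2 * Real.exp x + 1 := fun x => by ring
    simp_rw [e]
    have j0 : Integrable (fun x => Real.exp x ^ 2 - 2 * Real.exp x) (limitGaussian s) :=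
      i2.sub (i1.const_mul 2)
    rw [integral_add j0 (integrable_const 1),
      integral_sub i2 (i1.const_mul 2), integral_const_mul, m1, m2]
    simp; ring
  have c3 : ∫ x, (Real.exp x - 1) ^ 3 ∂(limitGaussian s) =
      Real.exp (3 * s) - 3 * Real.exp s + 2 := by
    have e : ∀ x, (Real.exp x - 1) ^ 3 =
      Real.exp x ^ 3 - 3 * Real.exp x ^ 2 + (3 * Real.exp x - 1) := fun x => by ring
    simp_rw [e]
    have j1 : Integrable (fun x => 3 * Real.exp x - 1) (limitGaussian s) :=
      (i1.const_mul 3).sub (integrable_const 1)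
    have j0 : Integrable (fun x => Real.exp x ^ 3 - 3 * Real.exp x ^ 2) (limitGaussian s) :=
      i3.sub (i2.const_mul 3)
    rw [integral_add j0 j1, integral_sub i3 (i2.const_mul 3),
      integral_sub (i1.const_mul 3) (integrable_const 1), integral_const_mul, integral_const_mul,
      m1, m2, m3]
    simp; ring
  have c4 : ∫ x, (Real.exp x - 1) ^ 4 ∂(limitGaussian s) =
      Real.exp (6 * s) - 4 * Real.exp (3 * s) + 6 * Real.exp s - 3 := by
    have e : ∀ x, (Real.exp x - 1) ^ 4 = Real.exp x ^ 4 - 4 * Real.exp x ^ 3 +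
      (6 * Real.exp x ^ 2 - (4 * Real.exp x - 1)) := fun x => by ring
    simp_rw [e]
    have j1 : Integrable (fun x => 4 * Real.exp x - 1) (limitGaussian s) :=
      (i1.const_mul 4).sub (integrable_const 1)
    have j2 : Integrable (fun x => 6 * Real.exp x ^ 2 - (4 * Real.exp x - 1)) (limitGaussian s) :=
      (i2.const_mul 6).sub j1
    have j0 : Integrable (fun x => Real.exp x ^ 4 - 4 * Real.exp x ^ 3) (limitGaussian s) :=
      i4.sub (i3.const_mul 4)
    rw [integral_add j0 j2, integral_sub i4 (i3.const_mul 4),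
      integral_sub (i2.const_mul 6) j1, integral_sub (i1.const_mul 4) (integrable_const 1),
      integral_const_mul, integral_const_mul, integral_const_mul,
      m1, m2, m3, m4]
    simp; ring
  set E := Real.exp (6 * s) with hE
  have x1 := abs_exp_sub_le hs
  have x3 := abs_exp_sub_le (show 0 ≤ 3 * s by positivity)
  have x6 := abs_exp_sub_le (show 0 ≤ 6 * s by positivity)
  have l1 : Real.exp s ≤ E := Real.exp_le_exp.2 (by linarith)
  have l3 : Real.exp (3 * s) ≤ E := Real.exp_le_exp.2 (by linarith)
  have hs2 : 0 ≤ s ^ 2 := sq_nonneg s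
  have y1 : |Real.exp s - 1 - s| ≤ s ^ 2 * E := x1.trans (by gcongr)
  have y3 : |Real.exp (3 * s) - 1 - 3 * s| ≤ 9 * (s ^ 2 * E) := by
    refine x3.trans ?_
    calc _ ≤ (3 * s) ^ 2 * E := by gcongr
      _ = _ := by ring
  have y6 : |E - 1 - 6 * s| ≤ 36 * (s ^ 2 * E) := x6.trans_eq (by rw [← hE]; ring)
  have hpos : 0 ≤ s ^ 2 * E := by positivity
  have key := hf.abs_integral_sub_le (P := limitGaussian s) l (R := fun x => Real.exp x)
    (Y := fun x => f 0 (l + x)) (δ := 78 * (s ^ 2 * E)) (fun x => (Real.exp_pos x).le)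
    (hm.sub (HasAllMoments.const 1))
    ((hf.continuous (by norm_num)).comp (continuous_const_add l)).measurable.aemeasurable
    (fun x => hf.bound 0 (by norm_num) _) (fun x _ => by rw [Real.log_exp]) c1 c2
    (by rw [c3]; rw [abs_le] at y1 y3 ⊢; constructor <;> linarith)
    (by rw [c4]; rw [abs_le] at y1 y3 y6; linarith)
  have hD : |(f 2 l - f 1 l) / 2 * (Real.exp s - 1 - s)| ≤ A * (s ^ 2 * E) := by
    rw [abs_mul]
    have b1 := abs_le.1 (hf.bound 1 (by norm_num) l)
    have b2 := abs_le.1 (hf.bound 2 (by norm_num) l)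
    have : |(f 2 l - f 1 l) / 2| ≤ A := by rw [abs_le]; constructor <;> linarith
    gcongr
  have e : ∫ g, f 0 (l + g) ∂(limitGaussian s) - (f 0 l + (f 2 l - f 1 l) / 2 * s) =
      (∫ g, f 0 (l + g) ∂(limitGaussian s) - (f 0 l + (f 2 l - f 1 l) / 2 * (Real.exp s - 1))) +
      (f 2 l - f 1 l) / 2 * (Real.exp s - 1 - s) := by ring
  rw [e]
  refine (abs_add_le _ _).trans ?_
  nlinarith

end Gaussian

/-! ### Replacement of the layers by Gaussian increments -/

section Replacement

/-- The function `q ↦ φ (log q)`, extended by `c` to `q ≤ 0`, so that `c` is the value of `φ` at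
`log 0 = -∞`. -/
noncomputable def logValue (c : ℝ) (φ : ℝ → ℝ) (q : ℝ) : ℝ := if q ≤ 0 then c else φ (Real.log q)

lemma measurable_logValue (c : ℝ) {φ : ℝ → ℝ} (hφ : Measurable φ) : Measurable (logValue c φ) :=
  Measurable.ite measurableSet_Iic measurable_const (hφ.comp Real.measurable_log)

lemma abs_logValue_le {c A : ℝ} {φ : ℝ → ℝ} (hc : |c| ≤ A) (hφ : ∀ x, |φ x| ≤ A) (q : ℝ) :
    |logValue c φ q| ≤ A := by
  unfold logValue; split_ifs
  · exact hc
  · exact hφ _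

/-- The quotient `‖x‖₄⁴ / ‖x‖₂⁴`, which vanishes for `x = 0` by the convention for division. -/
noncomputable def flatness {N : ℕ} (x : Fin N → ℝ) : ℝ := sumFourth x / sumSq x ^ 2

lemma flatness_nonneg {N : ℕ} (x : Fin N → ℝ) : 0 ≤ flatness x :=
  div_nonneg (sumFourth_nonneg x) (sq_nonneg _)

lemma flatness_le_one {N : ℕ} (x : Fin N → ℝ) : flatness x ≤ 1 :=
  div_le_one_of_le₀ (sumFourth_le x) (sq_nonneg _)

lemma flatness_smul {N : ℕ} {c : ℝ} (hc : 0 < c) (x : Fin N → ℝ) :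
    flatness (c • x) = flatness x := by
  rw [flatness, flatness, sumFourth_smul, sumSq_smul]
  have : (c ^ 2 * sumSq x) ^ 2 = c ^ 4 * sumSq x ^ 2 := by ring
  rw [this, mul_div_mul_left _ _ (by positivity)]

lemma measurable_flatness {N : ℕ} : Measurable (flatness : (Fin N → ℝ) → ℝ) :=
  measurable_sumFourth.div (measurable_sumSq.pow_const 2)

/-- A bound for the contribution of a layer to `β`, multiplied by the width. -/
noncomputable def betaConst (m : ℕ → ℝ) (p₀ : ℝ) : ℝ := 3 / p₀ - 1 + |m 4 - 3| / p₀

/-- The constant in the replacement error of one layer. -/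
noncomputable def replaceConst (m : ℕ → ℝ) (p₀ : ℝ) : ℝ :=
  385 * (stepConst m p₀ 3 + stepConst m p₀ 4) +
    30031 * (betaConst m p₀ ^ 2 * Real.exp (6 * betaConst m p₀))

/-- The constant in the bound for the flatness of the output of a layer. -/
noncomputable def flatnessConst (m : ℕ → ℝ) (p₀ : ℝ) : ℝ :=
  4 * ((p₀⁻¹) ^ 2 * rowConst m 2) + 4 * betaConst m p₀

variable {Ω : Type*} [MeasurableSpace Ω] {P : Measure Ω}
variable {N' N : ℕ} {μ : Measure ℝ} {p : unitInterval}
  {w : Ω → Fin N' → Fin N → ℝ} {z : Ω → Fin N' → ℝ} {m : ℕ → ℝ} {p₀ : ℝ}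

lemma abs_betaStep_le (m : ℕ → ℝ) (hp₀ : 0 < p₀) (hp : p₀ ≤ p) {q : ℝ} (hq : |q| ≤ 1) :
    |(3 / (p : ℝ) - 1) + (m 4 - 3) / p * q| ≤ betaConst m p₀ := by
  have hpp : 0 < (p : ℝ) := hp₀.trans_le hp
  have h3 := le_three_div hpp
  refine (abs_add_le _ _).trans ?_
  rw [abs_of_nonneg (by linarith), abs_mul, abs_div, abs_of_pos hpp, betaConst]
  have h4 : 3 / (p : ℝ) ≤ 3 / p₀ := by gcongr
  have h5 : |m 4 - 3| / p * |q| ≤ |m 4 - 3| / p₀ * 1 := by gcongr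
  linarith

lemma betaConst_nonneg (m : ℕ → ℝ) (hp₀ : 0 < p₀) (hp : p₀ ≤ p) : 0 ≤ betaConst m p₀ :=
  (abs_nonneg _).trans (abs_betaStep_le m hp₀ hp (q := 0) (by simp))

lemma replaceConst_nonneg (m : ℕ → ℝ) (hp₀ : 0 < p₀) : 0 ≤ replaceConst m p₀ := by
  have h1 := stepConst_nonneg m hp₀ 3
  have h2 := stepConst_nonneg m hp₀ 4
  unfold replaceConst; positivity

lemma flatnessConst_nonneg (m : ℕ → ℝ) (hp₀ : 0 < p₀) (hp : p₀ ≤ p) : 0 ≤ flatnessConst m p₀ := by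
  have h1 := betaConst_nonneg m hp₀ hp
  have h2 := rowConst_nonneg m 2
  unfold flatnessConst; positivity

namespace IsLayer

variable [IsProbabilityMeasure P]

/-- One layer acts on functions of the logarithm of the squared norm like a Gaussian increment of
nearly the same variance. -/
lemma abs_integral_logValue_sub_le (h : IsLayer P μ p w z) (hμ : IsEntryLaw μ)
    (hm : ∀ j : ℕ, ∫ x, x ^ j ∂μ = m j) (hN : 0 < N') (hp₀ : 0 < p₀) (hp : p₀ ≤ p)
    {f : ℕ → ℝ → ℝ} {A : ℝ} (hf : BoundedJet f A) {c : ℝ} (hc : |c| ≤ A) (x : Fin N → ℝ)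
    {s : ℝ} (hs : 0 ≤ s) (hsN : s ≤ betaConst m p₀ / N') :
    |∫ ω, logValue c (f 0) (sumSq (layerStep p (w ω) (z ω) x)) ∂P -
      logValue c (fun l => ∫ g, f 0 (l + g) ∂(limitGaussian s)) (sumSq x)| ≤
      A * (replaceConst m p₀ / (N' : ℝ) ^ 2 +
        |((3 / p - 1) + (m 4 - 3) / p * flatness x) / N' - s|) := by
  have hA := hf.nonneg
  have hpp : 0 < (p : ℝ) := hp₀.trans_le hp
  have hN0 : (0 : ℝ) < N' := by positivity
  have hN1 : (1 : ℝ) ≤ N' := by exact_mod_cast hN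
  have hr := replaceConst_nonneg m hp₀
  have hB := betaConst_nonneg m hp₀ hp
  rcases eq_or_ne x 0 with rfl | hx
  · simp only [layerStep_zero, sumSq_zero, logValue, le_refl, if_true, integral_const,
      probReal_univ, one_smul, sub_self, abs_zero]
    positivity
  obtain ⟨a, y, ha, hy, rfl⟩ := exists_unit_smul hx
  have ha2 : 0 < a ^ 2 := by positivity
  simp_rw [layerStep_smul, sumSq_smul, flatness_smul ha, hy, mul_one]
  have hfl : flatness y = sumFourth y := by simp [flatness, hy]
  set l := Real.log (a ^ 2) with hl
  set v := ((3 / p - 1) + (m 4 - 3) / p * sumFourth y) / N' with hv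
  set δ := (stepConst m p₀ 3 + stepConst m p₀ 4) / (N' : ℝ) ^ 2 with hδ
  have h1 := hf.abs_integral_sub_le (P := P) l (δ := δ)
    (R := fun ω => sumSq (layerStep p (w ω) (z ω) y))
    (Y := fun ω => logValue c (f 0) (a ^ 2 * sumSq (layerStep p (w ω) (z ω) y)))
    (fun ω => sumSq_nonneg _) ((h.hasAllMoments_sumSq hμ y).sub (HasAllMoments.const 1))
    ((measurable_logValue c (hf.continuous (by norm_num)).measurable).comp_aemeasurable
      ((h.hasAllMoments_sumSq hμ y).const_mul _).aemeasurable)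
    (fun ω => abs_logValue_le hc (hf.bound 0 (by norm_num)) _)
    (fun ω hω => by
      have h0 : 0 < sumSq (layerStep p (w ω) (z ω) y) := by linarith
      rw [logValue, if_neg (not_le.2 (mul_pos ha2 h0)), Real.log_mul ha2.ne' h0.ne'])
    (h.integral_sumSq_sub_one hμ hN hpp hy) (h.integral_sumSq_sub_one_sq hμ hm hN hpp hy)
    ((h.abs_integral_sumSq_pow_le_div hμ hm hN hp₀ hp hy le_rfl).trans (by
      rw [hδ]; have := stepConst_nonneg m hp₀ 4; gcongr; linarith))
    ((le_abs_self _).trans ((h.abs_integral_sumSq_pow_le_div hμ hm hN hp₀ hp hy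
      (by norm_num)).trans (by
      rw [hδ]; have := stepConst_nonneg m hp₀ 3; gcongr; linarith)))
  have h2 := hf.abs_gaussian_sub_le l hs
  have h3 : s ^ 2 * Real.exp (6 * s) ≤
      betaConst m p₀ ^ 2 * Real.exp (6 * betaConst m p₀) / (N' : ℝ) ^ 2 := by
    have e1 : s ≤ betaConst m p₀ := hsN.trans (div_le_self hB hN1)
    calc s ^ 2 * Real.exp (6 * s) ≤ (betaConst m p₀ / N') ^ 2 * Real.exp (6 * betaConst m p₀) := by
          gcongr
      _ = _ := by ring
  have h4 : |(f 2 l - f 1 l) / 2 * (v - s)| ≤ A * |v - s| := by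
    rw [abs_mul]
    have b1 := abs_le.1 (hf.bound 1 (by norm_num) l)
    have b2 := abs_le.1 (hf.bound 2 (by norm_num) l)
    have : |(f 2 l - f 1 l) / 2| ≤ A := by rw [abs_le]; constructor <;> linarith
    gcongr
  rw [hfl, logValue.eq_def c _ (a ^ 2), if_neg (not_le.2 ha2)]
  have e : A * (replaceConst m p₀ / (N' : ℝ) ^ 2 + |v - s|) = 385 * A * δ + 30031 * A *
      (betaConst m p₀ ^ 2 * Real.exp (6 * betaConst m p₀) / (N' : ℝ) ^ 2) + A * |v - s| := by
    rw [hδ, replaceConst]; ring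
  rw [e]
  have h5 : 30031 * A * (s ^ 2 * Real.exp (6 * s)) ≤ 30031 * A *
      (betaConst m p₀ ^ 2 * Real.exp (6 * betaConst m p₀) / (N' : ℝ) ^ 2) := by gcongr
  rw [abs_le] at h1 h2 h4 ⊢
  constructor <;> linarith

/-- The output of a layer is flat in the mean. The denominator `‖b‖₂⁴` is harmless because
`flatness b ≤ 4 * ‖b‖₄⁴ + 4 * (‖b‖₂² - 1) ^ 2`: if `‖b‖₂² < 1/2`, the last term exceeds `1`. -/
lemma integral_flatness_le (h : IsLayer P μ p w z) (hμ : IsEntryLaw μ)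
    (hm : ∀ j : ℕ, ∫ x, x ^ j ∂μ = m j) (hN : 0 < N') (hp₀ : 0 < p₀) (hp : p₀ ≤ p)
    (x : Fin N → ℝ) :
    ∫ ω, flatness (layerStep p (w ω) (z ω) x) ∂P ≤ flatnessConst m p₀ / N' := by
  have hpp : 0 < (p : ℝ) := hp₀.trans_le hp
  have hN0 : (0 : ℝ) < N' := by positivity
  have hfc := flatnessConst_nonneg m hp₀ hp
  rcases eq_or_ne x 0 with rfl | hx
  · simp only [layerStep_zero, flatness, sumFourth_zero, zero_div, integral_zero]
    positivity
  obtain ⟨a, y, ha, hy, rfl⟩ := exists_unit_smul hx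
  simp_rw [layerStep_smul, flatness_smul ha]
  have hS := h.hasAllMoments_sumSq hμ y
  have hF := h.hasAllMoments_sumFourth hμ y
  have hT : HasAllMoments (fun ω => sumSq (layerStep p (w ω) (z ω) y) - 1) P :=
    hS.sub (HasAllMoments.const 1)
  have hfm : AEMeasurable (fun ω => flatness (layerStep p (w ω) (z ω) y)) P :=
    hF.aemeasurable.div (hS.pow 2).aemeasurable
  have hfi : Integrable (fun ω => flatness (layerStep p (w ω) (z ω) y)) P :=
    Integrable.of_bound hfm.aestronglyMeasurable 1 (ae_of_all _ fun ω => by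
      rw [Real.norm_eq_abs, abs_of_nonneg (flatness_nonneg _)]; exact flatness_le_one _)
  have h1 := h.integral_sumFourth_le_of_unit hμ hm hN hp₀ hp hy
  have h2 : ∫ ω, (sumSq (layerStep p (w ω) (z ω) y) - 1) ^ 2 ∂P ≤ betaConst m p₀ / N' := by
    rw [h.integral_sumSq_sub_one_sq hμ hm hN hpp hy]
    gcongr
    refine (le_abs_self _).trans (abs_betaStep_le m hp₀ hp ?_)
    have := sumFourth_le y
    rw [abs_of_nonneg (sumFourth_nonneg y)]
    rwa [hy, one_pow] at this
  calc ∫ ω, flatness (layerStep p (w ω) (z ω) y) ∂P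
      ≤ ∫ ω, 4 * sumFourth (layerStep p (w ω) (z ω) y) +
          4 * (sumSq (layerStep p (w ω) (z ω) y) - 1) ^ 2 ∂P := by
        refine integral_mono hfi ((hF.const_mul 4).add ((hT.pow 2).const_mul 4)).integrable
          fun ω => ?_
        simp only
        set b := layerStep p (w ω) (z ω) y
        have n4 := sumFourth_nonneg b
        rcases lt_or_ge (sumSq b) (1 / 2) with hb | hb
        · have := flatness_le_one b
          nlinarith
        · have e1 : flatness b ≤ 4 * sumFourth b := by
            rw [flatness, div_le_iff₀ (by positivity)]
            have : 1 ≤ 4 * sumSq b ^ 2 := by nlinarith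
            nlinarith
          nlinarith [sq_nonneg (sumSq b - 1)]
    _ = 4 * ∫ ω, sumFourth (layerStep p (w ω) (z ω) y) ∂P +
          4 * ∫ ω, (sumSq (layerStep p (w ω) (z ω) y) - 1) ^ 2 ∂P := by
        rw [integral_add (hF.const_mul 4).integrable ((hT.pow 2).const_mul 4).integrable,
          integral_const_mul, integral_const_mul]
    _ ≤ 4 * ((p₀⁻¹) ^ 2 * rowConst m 2 / N') + 4 * (betaConst m p₀ / N') := by gcongr
    _ = _ := by rw [flatnessConst]; ring

end IsLayer

/-- The part of `β` contributed by the layers `i, …, d - 1`. -/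
noncomputable def tailBeta (m : ℕ → ℝ) (p : unitInterval) (n : ℕ → ℕ) (d : ℕ) (q : ℝ) (i : ℕ) : ℝ :=
  ∑ j ∈ Finset.Ico i d, betaStep m p n q j

lemma integral_limitGaussian_add {f : ℕ → ℝ → ℝ} {A : ℝ} (hf : BoundedJet f A) {s t : ℝ}
    (hs : 0 ≤ s) (ht : 0 ≤ t) (x : ℝ) :
    ∫ g, f 0 (x + g) ∂(limitGaussian (s + t)) =
      ∫ g, ∫ g', f 0 (x + g + g') ∂(limitGaussian t) ∂(limitGaussian s) := by
  rw [← limitGaussian_conv hs ht, integral_conv]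
  · simp_rw [add_assoc]
  · exact Integrable.of_bound ((hf.continuous (by norm_num)).comp
      (continuous_const_add x)).aestronglyMeasurable A
      (ae_of_all _ fun g => hf.bound 0 (by norm_num) _)

variable [IsProbabilityMeasure P] {n : ℕ → ℕ} {d : ℕ}
  {W : (i : ℕ) → Ω → Matrix (Fin (n (i + 1))) (Fin (n i)) ℝ}
  {ξ : (i : ℕ) → Ω → Fin (n (i + 1)) → ℝ}

/-- The constant in the bound for the total replacement error. -/
noncomputable def totalConst (m : ℕ → ℝ) (p₀ : ℝ) : ℝ :=
  replaceConst m p₀ + |m 4 - 3| / p₀ * flatnessConst m p₀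

namespace IsModel

lemma integral_flatness_state_le (h : IsModel P μ p n d W ξ) (hμ : IsEntryLaw μ)
    (hm : ∀ j : ℕ, ∫ x, x ^ j ∂μ = m j) (hn : ∀ i ≤ d, 0 < n i) (hp₀ : 0 < p₀) (hp : p₀ ≤ p)
    (u : Fin (n 0) → ℝ) {i : ℕ} (hi : i < d) :
    ∫ ω, flatness (state p n W ξ u (i + 1) ω) ∂P ≤ flatnessConst m p₀ / n (i + 1) := by
  have hint : Integrable (fun ω => flatness (state p n W ξ u (i + 1) ω)) P :=
    Integrable.of_bound (measurable_flatness.comp_aemeasurable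
      (h.aemeasurable_state u hi)).aestronglyMeasurable 1 (ae_of_all _ fun ω => by
        rw [Real.norm_eq_abs, abs_of_nonneg (flatness_nonneg _)]; exact flatness_le_one _)
  obtain ⟨h1, h2⟩ := h.integral_state_succ u hi measurable_flatness hint
  rw [h2]
  calc _ ≤ ∫ _ω, flatnessConst m p₀ / n (i + 1) ∂P :=
        integral_mono h1 (integrable_const _) fun ω =>
          (h.isLayer hi).integral_flatness_le hμ hm (hn _ hi) hp₀ hp _
    _ = _ := by simp

/-- Replacing the layer `i` by a Gaussian increment of variance `betaStep m p n (sumFourth u) i`.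
The later layers have been replaced already, which is why the test function is averaged over a
Gaussian of variance `tailBeta`. -/
lemma abs_replacement_step_le (h : IsModel P μ p n d W ξ) (hμ : IsEntryLaw μ)
    (hm : ∀ j : ℕ, ∫ x, x ^ j ∂μ = m j) (hn : ∀ i ≤ d, 0 < n i) (hp₀ : 0 < p₀) (hp : p₀ ≤ p)
    {u : Fin (n 0) → ℝ} (hu : sumSq u = 1) {f : ℕ → ℝ → ℝ} {A : ℝ} (hf : BoundedJet f A)
    {c : ℝ} (hc : |c| ≤ A) {i : ℕ} (hi : i < d) :
    |∫ ω, logValue c (fun l => ∫ g, f 0 (l + g)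
        ∂(limitGaussian (tailBeta m p n d (sumFourth u) (i + 1))))
        (sumSq (state p n W ξ u (i + 1) ω)) ∂P -
      ∫ ω, logValue c (fun l => ∫ g, f 0 (l + g)
        ∂(limitGaussian (tailBeta m p n d (sumFourth u) i)))
        (sumSq (state p n W ξ u i ω)) ∂P| ≤ A * totalConst m p₀ * errorStep n i := by
  have hA := hf.nonneg
  have hpp : 0 < (p : ℝ) := hp₀.trans_le hp
  have hN : 0 < n (i + 1) := hn _ hi
  have hN0 : (0 : ℝ) < n (i + 1) := by positivity
  have hq0 := sumFourth_nonneg u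
  have hq1 : sumFourth u ≤ 1 := by
    have := sumFourth_le u
    rwa [hu, one_pow] at this
  have hr := replaceConst_nonneg m hp₀
  have hfc := flatnessConst_nonneg m hp₀ hp
  have h4 := hμ.one_lt_moment_four hm
  have hβ : ∀ j, 0 ≤ betaStep m p n (sumFourth u) j := fun j =>
    le_trans (mul_nonneg (le_min (by norm_num) (by linarith)) (by positivity))
      (min_mul_le_betaStep hμ hm hpp hq0 hq1 j)
  set s := betaStep m p n (sumFourth u) i with hs
  have hs0 : 0 ≤ s := hβ i
  have hsN : s ≤ betaConst m p₀ / n (i + 1) := by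
    rw [hs, betaStep]
    gcongr
    refine (le_abs_self _).trans (abs_betaStep_le m hp₀ hp ?_)
    split_ifs
    · rwa [abs_of_nonneg hq0]
    · simp
  set t := tailBeta m p n d (sumFourth u) (i + 1) with ht
  have ht0 : 0 ≤ t := Finset.sum_nonneg fun j _ => hβ j
  -- The Gaussian increment of the layer `i` and those of the later layers.
  have hst : tailBeta m p n d (sumFourth u) i = s + t := by
    rw [tailBeta, Finset.sum_eq_sum_Ico_succ_bot hi]; rfl
  have hG := hf.average (limitGaussian t)
  have hcont : ∀ τ : ℝ, Measurable fun l => ∫ g, f 0 (l + g) ∂(limitGaussian τ) := fun τ =>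
    ((hf.average (limitGaussian τ)).continuous (j := 0) (by norm_num)).measurable
  have hbd : ∀ τ l : ℝ, |∫ g, f 0 (l + g) ∂(limitGaussian τ)| ≤ A := fun τ l =>
    (hf.average (limitGaussian τ)).bound 0 (by norm_num) l
  have hint : ∀ (τ : ℝ) (j : ℕ), j ≤ d → Integrable (fun ω => logValue c
      (fun l => ∫ g, f 0 (l + g) ∂(limitGaussian τ)) (sumSq (state p n W ξ u j ω))) P :=
    fun τ j hj => Integrable.of_bound ((measurable_logValue c (hcont τ)).comp_aemeasurable
      (measurable_sumSq.comp_aemeasurable (h.aemeasurable_state u hj))).aestronglyMeasurable A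
      (ae_of_all _ fun ω => abs_logValue_le hc (hbd τ) _)
  obtain ⟨h1, h2⟩ := h.integral_state_succ u hi
    (g := fun x => logValue c (fun l => ∫ g, f 0 (l + g) ∂(limitGaussian t)) (sumSq x))
    ((measurable_logValue c (hcont t)).comp measurable_sumSq) (hint t (i + 1) hi)
  rw [h2, hst]
  have hsemi : (fun l => ∫ g, f 0 (l + g) ∂(limitGaussian (s + t))) =
      fun l => ∫ g, ∫ g', f 0 (l + g + g') ∂(limitGaussian t) ∂(limitGaussian s) :=
    funext fun l => integral_limitGaussian_add hf hs0 ht0 l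
  have hi2 := hint (s + t) i hi.le
  rw [hsemi] at hi2 ⊢
  refine (congrArg abs (integral_sub h1 hi2).symm).le.trans ?_
  refine abs_integral_le_integral_abs.trans ?_
  have hstep := fun ω => (h.isLayer hi).abs_integral_logValue_sub_le hμ hm hN hp₀ hp hG hc
    (state p n W ξ u i ω) hs0 hsN
  -- The difference of the exact variance of the layer and of the Gaussian increment.
  have hvar : ∀ x : Fin (n i) → ℝ,
      |((3 / (p : ℝ) - 1) + (m 4 - 3) / p * flatness x) / n (i + 1) - s| =
      |m 4 - 3| / p / n (i + 1) * |flatness x - if i = 0 then sumFourth u else 0| := fun x => by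
    have e : ((3 / (p : ℝ) - 1) + (m 4 - 3) / p * flatness x) / n (i + 1) - s =
        (m 4 - 3) / p / n (i + 1) * (flatness x - if i = 0 then sumFourth u else 0) := by
      rw [hs, betaStep]; ring
    rw [e, abs_mul, abs_div, abs_div, abs_of_pos hpp, abs_of_pos hN0]
  have hflat : Integrable (fun ω => |flatness (state p n W ξ u i ω) -
      if i = 0 then sumFourth u else 0|) P := by
    have : Integrable (fun ω => flatness (state p n W ξ u i ω)) P :=
      Integrable.of_bound (measurable_flatness.comp_aemeasurable
        (h.aemeasurable_state u hi.le)).aestronglyMeasurable 1 (ae_of_all _ fun ω => by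
          rw [Real.norm_eq_abs, abs_of_nonneg (flatness_nonneg _)]; exact flatness_le_one _)
    exact (this.sub (integrable_const _)).abs
  have hflat2 : ∫ ω, |flatness (state p n W ξ u i ω) - if i = 0 then sumFourth u else 0| ∂P ≤
      if i = 0 then 0 else flatnessConst m p₀ / n i := by
    rcases i with _ | i
    · have : ∀ ω, flatness (state p n W ξ u 0 ω) = sumFourth u := fun ω => by
        simp [state, flatness, hu]
      simp [this]
    · simp only [Nat.add_eq_zero_iff, one_ne_zero, and_false, if_false, sub_zero]
      simp_rw [abs_of_nonneg (flatness_nonneg _)]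
      exact h.integral_flatness_state_le hμ hm hn hp₀ hp u (by omega)
  calc _ ≤ ∫ ω, A * (replaceConst m p₀ / (n (i + 1) : ℝ) ^ 2 + |m 4 - 3| / p / n (i + 1) *
        |flatness (state p n W ξ u i ω) - if i = 0 then sumFourth u else 0|) ∂P := by
        refine integral_mono (h1.sub hi2).abs
          (((integrable_const _).add (hflat.const_mul _)).const_mul _) fun ω => ?_
        have := hstep ω
        rw [hvar] at this
        exact this
    _ = A * (replaceConst m p₀ / (n (i + 1) : ℝ) ^ 2 + |m 4 - 3| / p / n (i + 1) *
        ∫ ω, |flatness (state p n W ξ u i ω) - if i = 0 then sumFourth u else 0| ∂P) := by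
        rw [integral_const_mul, integral_add (integrable_const _) (hflat.const_mul _),
          integral_const_mul]
        simp
    _ ≤ A * (replaceConst m p₀ / (n (i + 1) : ℝ) ^ 2 + |m 4 - 3| / p₀ / n (i + 1) *
        if i = 0 then 0 else flatnessConst m p₀ / n i) := by gcongr
    _ ≤ A * (totalConst m p₀ * errorStep n i) := by
        gcongr
        rw [totalConst, add_mul]
        refine add_le_add ?_ ?_
        · rw [← mul_one_div]
          gcongr
          exact one_div_sq_le_errorStep i
        · split_ifs with hi0
          · have := errorStep_nonneg (n := n) i
            rw [mul_zero]; positivity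
          · have e : |m 4 - 3| / p₀ / n (i + 1) * (flatnessConst m p₀ / n i) =
              |m 4 - 3| / p₀ * flatnessConst m p₀ * ((1 / (n i : ℝ)) * (1 / n (i + 1))) := by ring
            rw [e]
            gcongr
            rw [errorStep, if_neg hi0, ← one_div_pow, ← one_div_pow]
            nlinarith [sq_nonneg (1 / (n i : ℝ) - 1 / n (i + 1)),
              sq_nonneg (1 / (n i : ℝ)), sq_nonneg (1 / (n (i + 1) : ℝ))]
    _ = _ := by ring

/-- Smooth functions of the logarithm of the squared norm have nearly Gaussian expectation. -/
lemma abs_integral_logValue_sub_gaussian_le (h : IsModel P μ p n d W ξ) (hμ : IsEntryLaw μ)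
    (hm : ∀ j : ℕ, ∫ x, x ^ j ∂μ = m j) (hn : ∀ i ≤ d, 0 < n i) (hd : 1 ≤ d)
    (hp₀ : 0 < p₀) (hp : p₀ ≤ p)
    {u : EuclideanSpace ℝ (Fin (n 0))} (hu : ‖u‖ = 1) {f : ℕ → ℝ → ℝ} {A : ℝ} (hf : BoundedJet f A)
    {c : ℝ} (hc : |c| ≤ A) :
    |∫ ω, logValue c (f 0) (normSq p n d W ξ u ω) ∂P -
      ∫ g, f 0 g ∂(limitGaussian (beta μ p n d u))| ≤
      2 * totalConst m p₀ * (A * sumInvSq n d) := by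
  have hA := hf.nonneg
  have hpp : 0 < (p : ℝ) := hp₀.trans_le hp
  have hu' := sumSq_ofLp hu
  have hT : 0 ≤ totalConst m p₀ := by
    have h1 := replaceConst_nonneg m hp₀
    have h2 := flatnessConst_nonneg m hp₀ hp
    unfold totalConst; positivity
  set F : ℕ → ℝ := fun i => ∫ ω, logValue c (fun l => ∫ g, f 0 (l + g)
        ∂(limitGaussian (tailBeta m p n d (sumFourth u.ofLp) i)))
        (sumSq (state p n W ξ u.ofLp i ω)) ∂P with hF
  have hFd : ∫ ω, logValue c (f 0) (normSq p n d W ξ u ω) ∂P = F d := by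
    simp_rw [normSq_eq_sumSq_state hpp hn, hF]
    simp [tailBeta, limitGaussian_zero]
  have hF0 : ∫ g, f 0 g ∂(limitGaussian (beta μ p n d u)) = F 0 := by
    have : tailBeta m p n d (sumFourth u.ofLp) 0 = beta μ p n d u := by
      rw [← sum_betaStep hm u hd, tailBeta, Finset.range_eq_Ico]
    simp [hF, this, state, hu', logValue]
  rw [hFd, hF0, ← Finset.sum_range_sub]
  calc _ ≤ ∑ i ∈ Finset.range d, A * totalConst m p₀ * errorStep n i :=
        (Finset.abs_sum_le_sum_abs _ _).trans (Finset.sum_le_sum fun i hi =>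
          h.abs_replacement_step_le hμ hm hn hp₀ hp hu' hf hc (Finset.mem_range.1 hi))
    _ = A * totalConst m p₀ * ∑ i ∈ Finset.range d, errorStep n i := by rw [Finset.mul_sum]
    _ ≤ A * totalConst m p₀ * (2 * sumInvSq n d) :=
        mul_le_mul_of_nonneg_left sum_errorStep_le (by positivity)
    _ = _ := by ring

end IsModel

end Replacement

/-! ### From smooth test functions to distribution functions -/

section Smoothing

/-- Outside `[0, 1]` the smooth transition is locally constant. -/
lemma exists_bound_iteratedDeriv_smoothTransition (j : ℕ) :
    ∃ A : ℝ, ∀ x, |iteratedDeriv j Real.smoothTransition x| ≤ A := by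
  have hc : Continuous (iteratedDeriv j Real.smoothTransition) :=
    (Real.smoothTransition.contDiff (n := j)).continuous_iteratedDeriv j le_rfl
  obtain ⟨A, hA⟩ := isCompact_Icc.exists_bound_of_continuousOn (s := Set.Icc (0 : ℝ) 1)
    hc.continuousOn
  refine ⟨max A 1, fun x => ?_⟩
  have hconst : ∀ (c : ℝ), |c| ≤ 1 → |iteratedDeriv j (fun _ : ℝ => c) x| ≤ 1 := fun c hc => by
    rw [iteratedDeriv_const]; split_ifs
    · exact hc
    · simp
  rcases lt_or_ge x 0 with h0 | h0
  · have : Real.smoothTransition =ᶠ[nhds x] fun _ => 0 := by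
      filter_upwards [Iio_mem_nhds h0] with y hy
      exact Real.smoothTransition.zero_of_nonpos (le_of_lt hy)
    rw [this.iteratedDeriv_eq]
    exact (hconst 0 (by simp)).trans (le_max_right _ _)
  rcases lt_or_ge 1 x with h1 | h1
  · have : Real.smoothTransition =ᶠ[nhds x] fun _ => 1 := by
      filter_upwards [Ioi_mem_nhds h1] with y hy
      exact Real.smoothTransition.one_of_one_le (le_of_lt hy)
    rw [this.iteratedDeriv_eq]
    exact (hconst 1 (by simp)).trans (le_max_right _ _)
  · exact (hA x ⟨h0, h1⟩).trans (le_max_left _ _)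

/-- The derivatives of the smooth function that decreases from `1` to `0` on `[t, t + h]`. -/
noncomputable def stepJet (t h : ℝ) (j : ℕ) (x : ℝ) : ℝ :=
  (if j = 0 then 1 else 0) - (h⁻¹) ^ j * iteratedDeriv j Real.smoothTransition (h⁻¹ * (x - t))

lemma stepJet_zero (t h x : ℝ) : stepJet t h 0 x = 1 - Real.smoothTransition (h⁻¹ * (x - t)) := by
  simp [stepJet]

/-- Smooth steps of width `h` have four derivatives of order at most `h ^ (-4)`. -/
lemma exists_boundedJet_stepJet : ∃ A : ℝ, 0 ≤ A ∧ ∀ t h : ℝ, 0 < h → h ≤ 1 →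
    1 ≤ A * (h⁻¹) ^ 4 ∧ BoundedJet (stepJet t h) (A * (h⁻¹) ^ 4) := by
  choose a ha using exists_bound_iteratedDeriv_smoothTransition
  have ha0 : ∀ j, 0 ≤ a j := fun j => (abs_nonneg _).trans (ha j 0)
  set A := 1 + ∑ j ∈ Finset.range 5, a j with hA
  have hsum : 0 ≤ ∑ j ∈ Finset.range 5, a j := Finset.sum_nonneg fun j _ => ha0 j
  refine ⟨A, by positivity, fun t h h0 h1 => ?_⟩
  have hinv : 1 ≤ h⁻¹ := (one_le_inv₀ h0).2 h1
  have hinv4 : 1 ≤ (h⁻¹) ^ 4 := one_le_pow₀ hinv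
  refine ⟨by nlinarith, ⟨fun j _ x => ?_, fun j hj x => ?_, ?_⟩⟩
  · have h2 : HasDerivAt (iteratedDeriv j Real.smoothTransition)
        (iteratedDeriv (j + 1) Real.smoothTransition (h⁻¹ * (x - t))) (h⁻¹ * (x - t)) := by
      rw [iteratedDeriv_succ]
      exact (((Real.smoothTransition.contDiff (n := (j + 1 : ℕ))).differentiable_iteratedDeriv j
        (by exact_mod_cast Nat.lt_succ_self j)) _).hasDerivAt
    have h3 : HasDerivAt (fun x : ℝ => h⁻¹ * (x - t)) h⁻¹ x := by
      simpa using ((hasDerivAt_id x).sub_const t).const_mul h⁻¹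
    have h4 := ((h2.comp x h3).const_mul ((h⁻¹) ^ j)).const_sub (if j = 0 then 1 else 0)
    refine h4.congr_deriv ?_
    simp only [stepJet, Nat.add_eq_zero_iff, one_ne_zero, and_false, if_false]
    ring
  · have h2 : a j ≤ ∑ j ∈ Finset.range 5, a j :=
      Finset.single_le_sum (fun i _ => ha0 i) (Finset.mem_range.2 (by omega))
    have h3 : (h⁻¹) ^ j ≤ (h⁻¹) ^ 4 := pow_le_pow_right₀ hinv hj
    have h4 : |(if j = 0 then (1 : ℝ) else 0)| ≤ 1 := by split_ifs <;> simp
    rw [stepJet]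
    refine (abs_sub _ _).trans ?_
    rw [abs_mul, abs_of_nonneg (by positivity : 0 ≤ (h⁻¹) ^ j)]
    have h5 : (h⁻¹) ^ j * |iteratedDeriv j Real.smoothTransition (h⁻¹ * (x - t))| ≤
        (h⁻¹) ^ 4 * a j := by
      gcongr
      exact ha j _
    rw [hA]
    nlinarith
  · have : Continuous (iteratedDeriv 4 Real.smoothTransition) :=
      (Real.smoothTransition.contDiff (n := (4 : ℕ))).continuous_iteratedDeriv 4 le_rfl
    unfold stepJet
    fun_prop

lemma limitGaussian_Ioc_le {β : ℝ} (hβ : 0 < β) (t : ℝ) {h : ℝ} (hh : 0 ≤ h) :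
    (limitGaussian β).real (Set.Ioc t (t + h)) ≤ (Real.sqrt (2 * Real.pi * β))⁻¹ * h := by
  have hv : β.toNNReal ≠ 0 := by simpa using hβ
  rw [limitGaussian, measureReal_def, gaussianReal_apply_eq_integral _ hv,
    ENNReal.toReal_ofReal (integral_nonneg fun x => gaussianPDFReal_nonneg _ _ _)]
  have hb : ∀ x, ‖gaussianPDFReal (-(β / 2)) β.toNNReal x‖ ≤ (Real.sqrt (2 * Real.pi * β))⁻¹ := by
    intro x
    rw [Real.norm_of_nonneg (gaussianPDFReal_nonneg _ _ _), gaussianPDFReal,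
      Real.coe_toNNReal β hβ.le]
    refine mul_le_of_le_one_right (by positivity) (Real.exp_le_one_iff.2 ?_)
    exact div_nonpos_of_nonpos_of_nonneg (neg_nonpos.2 (sq_nonneg _)) (by positivity)
  refine (le_abs_self _).trans ?_
  have := norm_setIntegral_le_of_norm_le_const (μ := volume) (s := Set.Ioc t (t + h))
    (by simp) (fun x _ => hb x)
  simpa [Real.volume_real_Ioc_of_le (show t ≤ t + h by linarith)] using this

lemma integral_indicator_le_of_le {α : Type*} [MeasurableSpace α] {ν : Measure α}
    [IsProbabilityMeasure ν] {s : Set α} (hs : MeasurableSet s) {f : α → ℝ} (hf : Integrable f ν)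
    (h1 : ∀ x ∈ s, 1 ≤ f x) (h0 : ∀ x, 0 ≤ f x) : ν.real s ≤ ∫ x, f x ∂ν := by
  rw [← integral_indicator_one hs]
  refine integral_mono ((integrable_const 1).indicator hs) hf fun x => ?_
  by_cases hx : x ∈ s
  · simpa [hx] using h1 x hx
  · simpa [hx] using h0 x

lemma integral_le_of_le_indicator {α : Type*} [MeasurableSpace α] {ν : Measure α}
    [IsProbabilityMeasure ν] {s : Set α} (hs : MeasurableSet s) {f : α → ℝ} (hf : Integrable f ν)
    (h1 : ∀ x, f x ≤ 1) (h0 : ∀ x ∉ s, f x ≤ 0) : ∫ x, f x ∂ν ≤ ν.real s := by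
  rw [← integral_indicator_one hs]
  refine integral_mono hf ((integrable_const 1).indicator hs) fun x => ?_
  by_cases hx : x ∈ s
  · simpa [hx] using h1 x
  · simpa [hx] using h0 x hx

/-- If smooth steps have nearly Gaussian expectation, then the distribution function is nearly
Gaussian: the indicator of `(-∞, t]` is enclosed between two smooth steps of width `h`, and a
Gaussian law charges intervals of length `h` with a mass of order `h`. The value `1` of the test
function at `-∞` accounts for the event `Z = 0`. -/
lemma abs_measureReal_sub_le {Ω : Type*} [MeasurableSpace Ω] {P : Measure Ω}
    [IsProbabilityMeasure P] {Z : Ω → ℝ} (hZ : AEMeasurable Z P) {β : ℝ} (hβ : 0 < β)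
    {h E : ℝ} (hh : 0 < h) (hjet : ∀ t : ℝ, Continuous (stepJet t h 0))
    (hE : ∀ t : ℝ, |∫ ω, logValue 1 (stepJet t h 0) (Z ω) ∂P -
      ∫ g, stepJet t h 0 g ∂(limitGaussian β)| ≤ E) (t : ℝ) :
    |P.real {ω | Z ω ≤ Real.exp t} - (limitGaussian β).real (Set.Iic t)| ≤
      E + (Real.sqrt (2 * Real.pi * β))⁻¹ * h := by
  have hle1 : ∀ s x, stepJet s h 0 x ≤ 1 := fun s x => by
    rw [stepJet_zero]; linarith [Real.smoothTransition.nonneg (h⁻¹ * (x - s))]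
  have hge0 : ∀ s x, 0 ≤ stepJet s h 0 x := fun s x => by
    rw [stepJet_zero]; linarith [Real.smoothTransition.le_one (h⁻¹ * (x - s))]
  have heq1 : ∀ s x, x ≤ s → stepJet s h 0 x = 1 := fun s x hx => by
    rw [stepJet_zero, Real.smoothTransition.zero_of_nonpos, sub_zero]
    exact mul_nonpos_of_nonneg_of_nonpos (by positivity) (by linarith)
  have heq0 : ∀ s x, s + h ≤ x → stepJet s h 0 x = 0 := fun s x hx => by
    rw [stepJet_zero, Real.smoothTransition.one_of_one_le, sub_self]
    rw [inv_mul_eq_div, le_div_iff₀ hh]; linarith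
  set ν := P.map Z with hν
  have : IsProbabilityMeasure ν := Measure.isProbabilityMeasure_map hZ
  have hPν : P.real {ω | Z ω ≤ Real.exp t} = ν.real (Set.Iic (Real.exp t)) := by
    rw [hν, map_measureReal_apply_of_aemeasurable hZ measurableSet_Iic]; rfl
  have hval_meas : ∀ s, Measurable (logValue 1 (stepJet s h 0)) := fun s =>
    measurable_logValue 1 (hjet s).measurable
  have hmapint : ∀ s, ∫ ω, logValue 1 (stepJet s h 0) (Z ω) ∂P =
      ∫ x, logValue 1 (stepJet s h 0) x ∂ν := fun s =>
    (integral_map hZ (hval_meas s).aestronglyMeasurable).symm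
  have hval_le : ∀ s x, logValue 1 (stepJet s h 0) x ≤ 1 := fun s x => by
    unfold logValue; split_ifs
    · exact le_rfl
    · exact hle1 _ _
  have hval_ge : ∀ s x, 0 ≤ logValue 1 (stepJet s h 0) x := fun s x => by
    unfold logValue; split_ifs
    · exact zero_le_one
    · exact hge0 _ _
  have hval_int : ∀ s, Integrable (logValue 1 (stepJet s h 0)) ν := fun s =>
    Integrable.of_bound (hval_meas s).aestronglyMeasurable 1 (ae_of_all _ fun x => by
      rw [Real.norm_of_nonneg (hval_ge s x)]; exact hval_le s x)
  have hstep_int : ∀ s, Integrable (stepJet s h 0) (limitGaussian β) := fun s =>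
    Integrable.of_bound (hjet s).aestronglyMeasurable 1 (ae_of_all _ fun x => by
      rw [Real.norm_of_nonneg (hge0 s x)]; exact hle1 s x)
  have hsplit : ∀ s, (limitGaussian β).real (Set.Iic (s + h)) ≤
      (limitGaussian β).real (Set.Iic s) + (Real.sqrt (2 * Real.pi * β))⁻¹ * h := fun s => by
    rw [← Set.Iic_union_Ioc_eq_Iic (show s ≤ s + h by linarith)]
    exact (measureReal_union_le _ _).trans (add_le_add_right (limitGaussian_Ioc_le hβ s hh.le) _)
  have hlog : ∀ x, 0 < x → (x ≤ Real.exp t ↔ Real.log x ≤ t) := fun x hx =>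
    (Real.log_le_iff_le_exp hx).symm
  have up : ν.real (Set.Iic (Real.exp t)) ≤ ∫ x, logValue 1 (stepJet t h 0) x ∂ν :=
    integral_indicator_le_of_le measurableSet_Iic (hval_int t) (fun x hx => by
      unfold logValue; split_ifs with hx0
      · exact le_rfl
      · exact (heq1 t _ ((hlog x (not_le.1 hx0)).1 hx)).ge) (hval_ge t)
  have up2 : ∫ g, stepJet t h 0 g ∂(limitGaussian β) ≤ (limitGaussian β).real (Set.Iic (t + h)) :=
    integral_le_of_le_indicator measurableSet_Iic (hstep_int t) (hle1 t) fun x hx =>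
      (heq0 t x (le_of_lt (by simpa using hx))).le
  have lo : ∫ x, logValue 1 (stepJet (t - h) h 0) x ∂ν ≤ ν.real (Set.Iic (Real.exp t)) :=
    integral_le_of_le_indicator measurableSet_Iic (hval_int _) (hval_le _) fun x hx => by
      have hx' : Real.exp t < x := by simpa using hx
      have hx0 : 0 < x := (Real.exp_pos t).trans hx'
      rw [logValue, if_neg (not_le.2 hx0)]
      have : t < Real.log x := by
        by_contra hcon
        exact absurd ((hlog x hx0).2 (not_lt.1 hcon)) (not_le.2 hx')
      exact (heq0 _ _ (by linarith)).le
  have lo2 : (limitGaussian β).real (Set.Iic (t - h)) ≤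
      ∫ g, stepJet (t - h) h 0 g ∂(limitGaussian β) :=
    integral_indicator_le_of_le measurableSet_Iic (hstep_int _)
      (fun x hx => (heq1 _ x hx).ge) (hge0 _)
  have s1 := hsplit t
  have s2 := hsplit (t - h)
  rw [sub_add_cancel] at s2
  have E1 := abs_le.1 (hE t)
  have E2 := abs_le.1 (hE (t - h))
  rw [hmapint] at E1 E2
  rw [hPν, abs_le]
  constructor <;> linarith

lemma log_ofReal_le_iff {x t : ℝ} :
    ENNReal.log (ENNReal.ofReal x) ≤ (t : EReal) ↔ x ≤ Real.exp t := by
  have h : (t : EReal) = ENNReal.log (ENNReal.ofReal (Real.exp t)) := by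
    rw [ENNReal.log_pos_real (by simpa using Real.exp_pos t) ENNReal.ofReal_ne_top,
      ENNReal.toReal_ofReal (Real.exp_pos t).le, Real.log_exp]
  rw [h, ENNReal.log_strictMono.le_iff_le, ENNReal.ofReal_le_ofReal_iff (Real.exp_pos t).le]

/-- The Kolmogorov–Smirnov bound, with the constants coming from a lower bound for `p` and a lower
bound for `β`. -/
lemma IsModel.ksDist_le {Ω : Type*} [MeasurableSpace Ω] {P : Measure Ω} [IsProbabilityMeasure P]
    {n : ℕ → ℕ} {d : ℕ} {p : unitInterval} {m : ℕ → ℝ} {μ : Measure ℝ}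
    {W : (i : ℕ) → Ω → Matrix (Fin (n (i + 1))) (Fin (n i)) ℝ}
    {ξ : (i : ℕ) → Ω → Fin (n (i + 1)) → ℝ} (h : IsModel P μ p n d W ξ) (hμ : IsEntryLaw μ)
    (hm : ∀ j : ℕ, ∫ x, x ^ j ∂μ = m j) (hn : ∀ i ≤ d, 0 < n i) (hd : 1 ≤ d)
    {p₀ : ℝ} (hp₀ : 0 < p₀) (hp : p₀ ≤ p)
    {u : EuclideanSpace ℝ (Fin (n 0))} (hu : ‖u‖ = 1) {b : ℝ} (hb : 0 < b)
    (hbβ : b ≤ beta μ p n d u) {A : ℝ} (hA : ∀ t h : ℝ, 0 < h → h ≤ 1 →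
      1 ≤ A * (h⁻¹) ^ 4 ∧ BoundedJet (stepJet t h) (A * (h⁻¹) ^ 4)) :
    ksDist P (logNormSq p n d W ξ u) (limitGaussian (beta μ p n d u)) ≤
      max 1 (2 * totalConst m p₀ * A + (Real.sqrt (2 * Real.pi * b))⁻¹) *
        sumInvSq n d ^ (1 / 5 : ℝ) := by
  have hpp : 0 < (p : ℝ) := hp₀.trans_le hp
  have hβ : 0 < beta μ p n d u := hb.trans_le hbβ
  have hS := sumInvSq_pos hd hn
  have hrhs : 0 ≤ max 1 (2 * totalConst m p₀ * A + (Real.sqrt (2 * Real.pi * b))⁻¹) *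
      sumInvSq n d ^ (1 / 5 : ℝ) := by positivity
  refine Real.iSup_le (fun t => ?_) hrhs
  have hset : {ω | logNormSq p n d W ξ u ω ≤ (t : EReal)} =
      {ω | normSq p n d W ξ u ω ≤ Real.exp t} := by
    ext ω; exact log_ofReal_le_iff
  rw [hset]
  rcases le_total 1 (sumInvSq n d) with h1 | h1
  -- For `sumInvSq n d ≥ 1` the bound is trivial.
  · have r1 : 1 ≤ sumInvSq n d ^ (1 / 5 : ℝ) := Real.one_le_rpow h1 (by norm_num)
    have r2 : 1 ≤ max 1 (2 * totalConst m p₀ * A + (Real.sqrt (2 * Real.pi * b))⁻¹) *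
        sumInvSq n d ^ (1 / 5 : ℝ) := one_le_mul_of_one_le_of_one_le (le_max_left _ _) r1
    refine le_trans ?_ r2
    have a1 := measureReal_le_one (μ := P) (s := {ω | normSq p n d W ξ u ω ≤ Real.exp t})
    have a2 := measureReal_le_one (μ := limitGaussian (beta μ p n d u)) (s := Set.Iic t)
    have a3 := measureReal_nonneg (μ := P) (s := {ω | normSq p n d W ξ u ω ≤ Real.exp t})
    have a4 := measureReal_nonneg (μ := limitGaussian (beta μ p n d u)) (s := Set.Iic t)
    rw [abs_le]; constructor <;> linarith
  -- The width that balances the smoothing error and the replacement error.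
  · set w := sumInvSq n d ^ (1 / 5 : ℝ) with hw
    have hw0 : 0 < w := Real.rpow_pos_of_pos hS _
    have hw1 : w ≤ 1 := Real.rpow_le_one hS.le h1 (by norm_num)
    have hw5 : sumInvSq n d = w ^ 5 := by
      rw [hw, ← Real.rpow_natCast, ← Real.rpow_mul hS.le]; norm_num
    have key := abs_measureReal_sub_le (P := P) (Z := normSq p n d W ξ u)
      (by
        have := h.aemeasurable_state u.ofLp le_rfl
        refine (measurable_sumSq.comp_aemeasurable this).congr (ae_of_all _ fun ω => ?_)
        exact (normSq_eq_sumSq_state hpp hn u ω).symm) hβ hw0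
      (fun t => (hA t w hw0 hw1).2.continuous (by norm_num))
      (fun t => h.abs_integral_logValue_sub_gaussian_le hμ hm hn hd hp₀ hp hu (hA t w hw0 hw1).2
        (by rw [abs_one]; exact (hA t w hw0 hw1).1)) t
    refine key.trans ?_
    have e : 2 * totalConst m p₀ * (A * (w⁻¹) ^ 4 * sumInvSq n d) =
        2 * totalConst m p₀ * A * w := by
      rw [hw5]; field_simp
    have hsq : (Real.sqrt (2 * Real.pi * beta μ p n d u))⁻¹ ≤ (Real.sqrt (2 * Real.pi * b))⁻¹ := by
      apply inv_anti₀ (Real.sqrt_pos.2 (by positivity))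
      apply Real.sqrt_le_sqrt
      have := Real.pi_pos
      gcongr
    calc _ ≤ 2 * totalConst m p₀ * A * w + (Real.sqrt (2 * Real.pi * b))⁻¹ * w := by
          rw [e]; gcongr
      _ = (2 * totalConst m p₀ * A + (Real.sqrt (2 * Real.pi * b))⁻¹) * w := by ring
      _ ≤ _ := by gcongr; exact le_max_right _ _

end Smoothing

end RandomMatrixProduct

open RandomMatrixProduct in
theorem theorem1 (m : ℕ → ℝ) :
    -- Gaussian approximation of the logarithm in Kolmogorov–Smirnov distance
    (∀ K : Set ℝ, IsCompact K → K ⊆ Set.Ioc 0 1 →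
      ∀ B : Set ℝ, IsCompact B → B ⊆ Set.Ioi 0 →
      ∃ C : ℝ, ∀ μ : Measure ℝ, IsEntryLaw μ → (∀ j : ℕ, ∫ x, x ^ j ∂μ = m j) →
      ∀ p : unitInterval, (p : ℝ) ∈ K →
      ∀ (d : ℕ) (n : ℕ → ℕ), 1 ≤ d → (∀ i ≤ d, 0 < n i) →
      ∀ u : EuclideanSpace ℝ (Fin (n 0)), ‖u‖ = 1 → beta μ p n d u ∈ B →
      ∀ (Ω : Type v) [MeasurableSpace Ω] (P : Measure Ω) [IsProbabilityMeasure P]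
        (W : (i : ℕ) → Ω → Matrix (Fin (n (i + 1))) (Fin (n i)) ℝ)
        (ξ : (i : ℕ) → Ω → Fin (n (i + 1)) → ℝ), IsModel P μ p n d W ξ →
      ksDist P (logNormSq p n d W ξ u) (limitGaussian (beta μ p n d u))
        ≤ C * sumInvSq n d ^ (1 / 5 : ℝ)) ∧
    -- moments, multiplicative form
    (∀ p : unitInterval, 0 < (p : ℝ) → ∀ k : ℕ,
      ∃ C : ℝ, ∀ μ : Measure ℝ, IsEntryLaw μ → (∀ j : ℕ, ∫ x, x ^ j ∂μ = m j) →
      ∀ (d : ℕ) (n : ℕ → ℕ), 1 ≤ d → (∀ i ≤ d, 0 < n i) →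
      (∀ i, 1 ≤ i → i ≤ d → k.choose 2 < n i) →
      ∀ u : EuclideanSpace ℝ (Fin (n 0)), ‖u‖ = 1 →
      ∀ (Ω : Type v) [MeasurableSpace Ω] (P : Measure Ω) [IsProbabilityMeasure P]
        (W : (i : ℕ) → Ω → Matrix (Fin (n (i + 1))) (Fin (n i)) ℝ)
        (ξ : (i : ℕ) → Ω → Fin (n (i + 1)) → ℝ), IsModel P μ p n d W ξ →
      Integrable (fun ω => normSq p n d W ξ u ω ^ k) P ∧
      ∃ ε : ℝ, |ε| ≤ C * sumInvSq n d ∧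
        ∫ ω, normSq p n d W ξ u ω ^ k ∂P
          = Real.exp ((k.choose 2 : ℝ) * beta μ p n d u + ε)) ∧
    -- moments, comparison with the moments of the log-normal distribution
    (∀ p : unitInterval, 0 < (p : ℝ) → ∀ (k : ℕ) (b : ℝ),
      ∃ C : ℝ, ∀ μ : Measure ℝ, IsEntryLaw μ → (∀ j : ℕ, ∫ x, x ^ j ∂μ = m j) →
      ∀ (d : ℕ) (n : ℕ → ℕ), 1 ≤ d → (∀ i ≤ d, 0 < n i) →
      (∀ i, 1 ≤ i → i ≤ d → k.choose 2 < n i) →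
      ∀ u : EuclideanSpace ℝ (Fin (n 0)), ‖u‖ = 1 → beta μ p n d u ≤ b →
      ∀ (Ω : Type v) [MeasurableSpace Ω] (P : Measure Ω) [IsProbabilityMeasure P]
        (W : (i : ℕ) → Ω → Matrix (Fin (n (i + 1))) (Fin (n i)) ℝ)
        (ξ : (i : ℕ) → Ω → Fin (n (i + 1)) → ℝ), IsModel P μ p n d W ξ →
      |∫ ω, normSq p n d W ξ u ω ^ k ∂P -
          ∫ x, Real.exp x ^ k ∂(limitGaussian (beta μ p n d u))|
        ≤ C * ((beta μ p n d u)⁻¹ * sumInvSq n d)) := by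
  refine ⟨?_, ?_, ?_⟩
  · intro K hK hK₀ B hB hB₀
    rcases K.eq_empty_or_nonempty with rfl | hKne
    · exact ⟨0, fun μ _ _ p hp => hp.elim⟩
    rcases B.eq_empty_or_nonempty with rfl | hBne
    · exact ⟨0, fun μ _ _ p _ d n _ _ u _ hβ => hβ.elim⟩
    obtain ⟨p₀, hp₀, hp₀_le⟩ := hK.exists_isLeast hKne
    obtain ⟨b, hb, hb_le⟩ := hB.exists_isLeast hBne
    obtain ⟨A, -, hA⟩ := exists_boundedJet_stepJet
    exact ⟨_, fun μ hμ hm p hp d n hd hn u hu hβ Ω _ P _ W ξ h =>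
      h.ksDist_le hμ hm hn hd (hK₀ hp₀).1 (hp₀_le hp) hu (hB₀ hb) (hb_le hβ) hA⟩
  · intro p hp k
    exact ⟨2 * logMomentConst m p (k - 2), fun μ hμ hm d n hd hn _ u hu Ω _ P _ W ξ h =>
      ⟨h.integrable_normSq_pow hμ hn hp u k, h.exists_moment_eq hμ hm hn hd hp hu k⟩⟩
  · intro p hp k b
    exact ⟨_, fun μ hμ hm d n hd hn _ u hu hβ Ω _ P _ W ξ h =>
      h.abs_moment_sub_le hμ hm hn hd hp hu k hβ rfl⟩
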